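/- **Theorem 2 (Simulation of circulant Hamiltonians).** There is an absolute constant $K>0$ such that the following holds for all $N=2^L$ with $L\ge 1$, all times $t\ge 0$ and all $\delta>0$. There is a quantum circuit $W$ (depending only on $N,t,\delta$) on $L$ qubits and some number of ancilla qubits, consisting of - at most $K\sqrt N\,t(\log N)^2/\delta^{3/2}$ arbitrary one- or two-qubit gates, and - at most $K\sqrt N\,t/\delta^{3/2}$ calls of the controlled oracle $|0\rangle\langle 0|\otimes I+|1\rangle\langle 1|\otimes O$ and of its inverse, with the following property. Let $c=(c_0,\dots,c_{N-1})\in\mathbb C^N$ be any unit vector whose circulant matrix $C=(c_{(k-j)\bmod N})_{j,k}$ is Hermitian, and let the oracle $O$ be any unitary on $L$ qubits with $O|0\rangle=\sum_j c_j|j\rangle$. Then $W$, run with $O$ and with all ancillas initially in $|0\rangle$, performs $e^{-iCt}$ within error $\delta$ in operator norm, and returns the ancillas to $|0\rangle$ within the same error: $\|W|s\rangle|0\rangle-(e^{-iCt}|s\rangle)|0\rangle\|\le\delta\,\|s\|$ for all $s\in\mathbb C^N$. Moreover, whenever $\sqrt N\,t\ge\delta^{3/2}$ (that is, unless the bound on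 the number of oracle calls, without the constant $K$, is below one), $W$ can be taken of the following form: apply $\mathrm{QFT}^\dagger$ to the main register; apply a circuit $Q$ performing the Fourier transform in the computational basis (QFTC) of $c$ with precision $\varepsilon=\sqrt\delta/(\sqrt N\,t)$; apply the phase gates $e^{+i\sqrt N t|1\rangle\langle 1|}$ to the digit qubit $f_0$ and $e^{-i2^{-j}\sqrt N t|1\rangle\langle 1|}$ to the digit qubits $f_j$, $1\le j\le p$; undo $Q$; apply the QFT. Here $\mathrm{QFT}$ is the unitary with entries $e^{2\pi ijk/N}/\sqrt N$, and that $Q$ performs the QFTC with precision $\varepsilon$ means, for all $c$ and $O$ as above: on input $|k\rangle|0\rangle$ it keeps $|k\rangle$ in the main register, and with probability at least $1-\delta$ the digit qubits $f_0.f_1\cdots f_p$ of its output encode (as $-f_0+\sum_{j\ge1}f_j2^{-j}$) a number at distance less than $\varepsilon$ from $F_k=\frac1{\sqrt N}\sum_j e^{2\pi ijk/N}c_j$ (so that $\sqrt N F_k$, $0\le k<N$, are the eigenvalues of $C$). -/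

import Mathlib

open scoped Matrix

noncomputable section

/-! ### Circuits with oracle gates

The wires (qubits) are the elements of a finite type `ι`; a computational basis state is a
function `ι → Fin 2`, and a pure state is a vector in `EuclideanSpace ℂ (ι → Fin 2)`. -/

/-- The operator on all wires that acts as `U` on the wires `e s` (in this order) and as the
identity on all the other wires. -/
def onWires {σ ι : Type} [Fintype σ] [Fintype ι] [DecidableEq ι] (e : σ ↪ ι)
    (U : Matrix (σ → Fin 2) (σ → Fin 2) ℂ) : Matrix (ι → Fin 2) (ι → Fin 2) ℂ :=
  Matrix.of fun x y =>
    if ∀ i : ι, (∀ s : σ, e s ≠ i) → x i = y i then U (x ∘ e) (y ∘ e) else 0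

/-- The number `< 2 ^ L` that is written in binary on `L` qubits. -/
abbrev toNumber (L : ℕ) : (Fin L → Fin 2) ≃ Fin (2 ^ L) := finFunctionFinEquiv

/-- An operator on `ℂ ^ (2 ^ L)` as an operator on `L` qubits. -/
def onQubits {L : ℕ} (U : Matrix (Fin (2 ^ L)) (Fin (2 ^ L)) ℂ) :
    Matrix (Fin L → Fin 2) (Fin L → Fin 2) ℂ :=
  U.submatrix (toNumber L) (toNumber L)

/-- The controlled operator `|0⟩⟨0| ⊗ I + |1⟩⟨1| ⊗ U`; the control is the qubit `none`. -/
def controlled {L : ℕ} (U : Matrix (Fin L → Fin 2) (Fin L → Fin 2) ℂ) :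
    Matrix (Option (Fin L) → Fin 2) (Option (Fin L) → Fin 2) ℂ :=
  Matrix.of fun x y =>
    if x none = y none then
      (if x none = 1 then U (x ∘ some) (y ∘ some)
        else (1 : Matrix (Fin L → Fin 2) (Fin L → Fin 2) ℂ) (x ∘ some) (y ∘ some))
    else 0

/-- The gates: arbitrary one-qubit and two-qubit unitaries, and calls of the controlled oracle
(for an oracle on `L` qubits) or of its inverse, on any distinct wires. -/
inductive Gate (L : ℕ) (ι : Type) : Type
  | one (e : Fin 1 ↪ ι) (U : Matrix.unitaryGroup (Fin 1 → Fin 2) ℂ) : Gate L ι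
  | two (e : Fin 2 ↪ ι) (U : Matrix.unitaryGroup (Fin 2 → Fin 2) ℂ) : Gate L ι
  | oracle (e : Option (Fin L) ↪ ι) : Gate L ι
  | oracleInv (e : Option (Fin L) ↪ ι) : Gate L ι

/-- The operator performed by a gate when the oracle is `O`. -/
def Gate.eval {L : ℕ} {ι : Type} [Fintype ι] [DecidableEq ι]
    (O : Matrix (Fin (2 ^ L)) (Fin (2 ^ L)) ℂ) :
    Gate L ι → Matrix (ι → Fin 2) (ι → Fin 2) ℂ
  | .one e U => onWires e U.1
  | .two e U => onWires e U.1
  | .oracle e => onWires e (controlled (onQubits O))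
  | .oracleInv e => onWires e (controlled (onQubits Oᴴ))

/-- The inverse gate. -/
def Gate.inv {L : ℕ} {ι : Type} : Gate L ι → Gate L ι
  | .one e U => .one e U⁻¹
  | .two e U => .two e U⁻¹
  | .oracle e => .oracleInv e
  | .oracleInv e => .oracle e

/-- Is the gate a call of the controlled oracle or of its inverse? -/
def Gate.isCall {L : ℕ} {ι : Type} : Gate L ι → Bool
  | .one _ _ => false
  | .two _ _ => false
  | .oracle _ => true
  | .oracleInv _ => true

/-- A circuit is a list of gates; the head of the list is applied first. -/
abbrev Circuit (L : ℕ) (ι : Type) : Type := List (Gate L ι)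

/-- The operator performed by a circuit when the oracle is `O`. -/
def Circuit.eval {L : ℕ} {ι : Type} [Fintype ι] [DecidableEq ι]
    (O : Matrix (Fin (2 ^ L)) (Fin (2 ^ L)) ℂ) :
    Circuit L ι → Matrix (ι → Fin 2) (ι → Fin 2) ℂ
  | [] => 1
  | g :: W => Circuit.eval O W * g.eval O

/-- The inverse circuit: the inverse gates in the reverse order. -/
def Circuit.inv {L : ℕ} {ι : Type} (W : Circuit L ι) : Circuit L ι :=
  (W.map Gate.inv).reverse

/-- The number of one- and two-qubit gates of a circuit. -/
def Circuit.gateCount {L : ℕ} {ι : Type} (W : Circuit L ι) : ℕ :=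
  W.countP fun g => !g.isCall

/-- The number of calls of the controlled oracle and of its inverse. -/
def Circuit.callCount {L : ℕ} {ι : Type} (W : Circuit L ι) : ℕ :=
  W.countP fun g => g.isCall

/-! ### Circulant matrices and the Fourier transform -/

/-- The circulant matrix with first row `c`: its entry in row `j` and column `k` is
`c_{(k - j) mod N}` (subtraction in `Fin N` is modulo `N`). -/
def circulantMatrix {N : ℕ} (c : EuclideanSpace ℂ (Fin N)) : Matrix (Fin N) (Fin N) ℂ :=
  Matrix.of fun j k => c (k - j)

/-- The Fourier matrix, that is the QFT: `F_{kj} = exp (2πi jk / N) / √N`. -/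
def fourierMatrix (N : ℕ) : Matrix (Fin N) (Fin N) ℂ :=
  Matrix.of fun k j =>
    Complex.exp (2 * Real.pi * Complex.I * ((j : ℕ) : ℂ) * ((k : ℕ) : ℂ) / (N : ℂ)) /
      ((Real.sqrt N : ℝ) : ℂ)

/-- The Fourier coefficient `F_k = N^{-1/2} ∑_j exp (2πi jk / N) c_j`. -/
def dftCoeff {N : ℕ} (c : EuclideanSpace ℂ (Fin N)) (k : Fin N) : ℂ :=
  ∑ j, fourierMatrix N k j * c j

/-- `O` is an oracle for `c`: a unitary with `O |0⟩ = ∑_j c_j |j⟩`. -/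
def IsOracleFor {L : ℕ} (O : Matrix (Fin (2 ^ L)) (Fin (2 ^ L)) ℂ)
    (c : EuclideanSpace ℂ (Fin (2 ^ L))) : Prop :=
  O ∈ Matrix.unitaryGroup (Fin (2 ^ L)) ℂ ∧ ∀ j, O j 0 = c j

/-! ### Simulation with ancillas

The wires are `Fin L ⊕ Fin a`: a main register of `L` qubits and `a` ancillas. -/

/-- The state `|s⟩ |0^a⟩`. -/
def withAncillas {L : ℕ} (a : ℕ) (s : Fin (2 ^ L) → ℂ) :
    EuclideanSpace ℂ (Fin L ⊕ Fin a → Fin 2) :=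
  WithLp.toLp 2 fun x =>
    if ∀ i : Fin a, x (Sum.inr i) = 0 then s (toNumber L (x ∘ Sum.inl)) else 0

/-- The operator `U` on main register and ancillas performs `V` on the main register within
error `δ` in operator norm, the ancillas starting in `|0⟩` and being returned to `|0⟩`:
`‖U |s⟩|0⟩ - (V |s⟩)|0⟩‖ ≤ δ ‖s‖` for all `s`. -/
def PerformsWithin {L a : ℕ}
    (U : Matrix (Fin L ⊕ Fin a → Fin 2) (Fin L ⊕ Fin a → Fin 2) ℂ)
    (V : Matrix (Fin (2 ^ L)) (Fin (2 ^ L)) ℂ) (δ : ℝ) : Prop :=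
  ∀ s : EuclideanSpace ℂ (Fin (2 ^ L)),
    ‖Matrix.toEuclideanLin U (withAncillas a s) - withAncillas a (V *ᵥ s)‖ ≤ δ * ‖s‖

/-! ### The Fourier transform in the computational basis -/

/-- The number in `[-1, 1)` with complemental (two's complement) code `f_0.f_1 f_2 ⋯ f_p`. -/
def codeValue {p : ℕ} (f : Fin (p + 1) → Fin 2) : ℝ :=
  -((f 0 : ℕ) : ℝ) + ∑ i : Fin p, ((f i.succ : ℕ) : ℝ) / 2 ^ ((i : ℕ) + 1)

/-- The operator `U` performs the QFTC of `c`, `|k⟩|0⟩ ↦ |k⟩|F_k⟩`, to precision `ε` up to a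
failure probability `δ`: it leaves `k` unchanged, and with probability at least `1 - δ` the wires
`dig` hold the complemental code of a number at distance less than `ε` from `F_k`. -/
def IsQFTC {L a p : ℕ} (dig : Fin (p + 1) ↪ Fin a)
    (U : Matrix (Fin L ⊕ Fin a → Fin 2) (Fin L ⊕ Fin a → Fin 2) ℂ)
    (c : EuclideanSpace ℂ (Fin (2 ^ L))) (ε δ : ℝ) : Prop :=
  ∀ k : Fin (2 ^ L),
    let ψ := Matrix.toEuclideanLin U (withAncillas a (Pi.single k 1))
    (∀ x, ψ x ≠ 0 → toNumber L (x ∘ Sum.inl) = k) ∧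
    1 - δ ≤ ∑ x, Set.indicator
      {x | ‖((codeValue (fun i => x (Sum.inr (dig i))) : ℝ) : ℂ) - dftCoeff c k‖ < ε}
      (fun x => ‖ψ x‖ ^ 2) x

/-- The one-qubit operator `exp (i φ |1⟩⟨1|)`. -/
def phaseMatrix (φ : ℝ) : Matrix (Fin 1 → Fin 2) (Fin 1 → Fin 2) ℂ :=
  Matrix.diagonal fun x => if x 0 = 1 then Complex.exp (φ * Complex.I) else 1

theorem phaseMatrix_mem (φ : ℝ) :
    phaseMatrix φ ∈ Matrix.unitaryGroup (Fin 1 → Fin 2) ℂ := by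
  rw [Matrix.mem_unitaryGroup_iff, Matrix.star_eq_conjTranspose, phaseMatrix,
    Matrix.diagonal_conjTranspose, Matrix.diagonal_mul_diagonal, ← Matrix.diagonal_one]
  congr 1
  funext x
  by_cases h : x 0 = 1
  · simp [h, ← Complex.exp_conj, ← Complex.exp_add]
  · simp [h]

/-- The gate `exp (i φ |1⟩⟨1|)` on the wire `q`. -/
def phaseGate {L : ℕ} {ι : Type} (q : ι) (φ : ℝ) : Gate L ι :=
  .one ⟨fun _ => q, fun _ _ _ => Subsingleton.elim _ _⟩ ⟨phaseMatrix φ, phaseMatrix_mem φ⟩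

/-- The phase gates on the digits `f_0.f_1 ⋯ f_p`: `exp (+ i √N t |1⟩⟨1|)` on `f_0`, and
`exp (- i √N t 2^{-j} |1⟩⟨1|)` on `f_j` for `j ≥ 1`, where `N = 2 ^ L`. -/
def digitPhases {L a p : ℕ} (dig : Fin (p + 1) ↪ Fin a) (t : ℝ) : Circuit L (Fin L ⊕ Fin a) :=
  phaseGate (Sum.inr (dig 0)) (Real.sqrt (2 ^ L) * t) ::
    List.ofFn fun i : Fin p =>
      phaseGate (Sum.inr (dig i.succ)) (-(Real.sqrt (2 ^ L) * t / 2 ^ ((i : ℕ) + 1)))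

/-- The circuit `W` consists of QFT†, a circuit `Q`, the phase gates on the digit wires, the
inverse of `Q`, and QFT. Here `F` is an exact circuit for the QFT on the main register, and `Q`
performs the QFTC, to precision `ε` up to a failure probability `δ`, for every unit vector `c`
whose circulant matrix is Hermitian and every oracle for `c`. -/
def IsQFTCSimulation {L a : ℕ} (W : Circuit L (Fin L ⊕ Fin a)) (t ε δ : ℝ) : Prop :=
  ∃ (p : ℕ) (dig : Fin (p + 1) ↪ Fin a) (F Q : Circuit L (Fin L ⊕ Fin a)),
    W = F.inv ++ Q ++ digitPhases dig t ++ Q.inv ++ F ∧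
    (∀ O ∈ Matrix.unitaryGroup (Fin (2 ^ L)) ℂ,
      F.eval O = onWires ⟨Sum.inl, Sum.inl_injective⟩ (onQubits (fourierMatrix (2 ^ L)))) ∧
    ∀ (c : EuclideanSpace ℂ (Fin (2 ^ L))) (O : Matrix (Fin (2 ^ L)) (Fin (2 ^ L)) ℂ),
      ‖c‖ = 1 → (circulantMatrix c).IsHermitian → IsOracleFor O c →
        IsQFTC dig (Q.eval O) c ε δ

end

set_option linter.unusedSectionVars false

/-! ### Operators on some of the wires -/

section OnWires

variable {σ ι κ : Type} [Fintype σ] [Fintype ι] [Fintype κ]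
  [DecidableEq σ] [DecidableEq ι] [DecidableEq κ]

/-! The Fourier matrix `F` diagonalizes every circulant matrix, `C = F D F†` with eigenvalues `√N
F_k`. Since `C` is Hermitian the `F_k` are real, and since `c` is a unit vector they have modulus at
most one. Hence `e^{-iCt} = F diag(e^{-i√N t F_k}) F†`: in the Fourier basis it suffices to write
`F_k` into a register, multiply by the phase digit by digit, and erase the register. Everything
rests on a circuit that writes `F_k` with small error in mean square.

For fixed `k` let `E` be the vector with entries `e^{2πijk/N} c_j` and `u` the uniform
superposition. One oracle call prepares `φ = (|0⟩E + |1⟩u)/√2` (`walkPreparation_mulVec`), and if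
`X` flips the flag, then `⟨φ, Xφ⟩ = Re ⟨u, E⟩ = F_k` (`walkState_overlap`). On the relevant states
the walk operator is `U = (2|φ⟩⟨φ| - 1) X`, so `Uφ = 2F_k φ - Xφ` and `U†φ = Xφ`. Therefore `Uφ +
U†φ = 2F_k φ` (`walkOperator_add_conjTranspose_mulVec`), which gives the Chebyshev recurrence
`U^{n+1}φ + U^{n-1}φ = 2F_k U^nφ`. No eigenvectors of `U` are needed.

Phase estimation with `M = 2^m` counter values produces `v_j = a_j U^jφ`, to which the inverse
Fourier transform over `ℤ/M` is applied. An outcome `y` is read as `cos(2πy/M)`. Multiplication by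
this cosine in the Fourier basis is the average of the two cyclic shifts, so the mean square error
is exactly `∑_j ‖(v_{j+1} + v_{j-1})/2 - F_k v_j‖²` (`sum_norm_sq_gridCos_sub`). By the recurrence
only the differences `a_{j±1} - a_j` remain. The choice `a_j = (1 - e^{2πij/M})/√(2M)` makes these
differences of order `M^{-3/2}`, and `a_0 = 0` removes the mismatch at the wraparound, where `U^M`
need not be the identity. The error is at most `2π²/M²` (`phaseEstimationState_meanSquare`).

The cosine is then obtained from a reversible lookup table with `O(M)` gates (`exists_lookup`). It
must not cost a factor `log M`, because the gate bound allows only powers of `log N` beside `M`. The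
result is a circuit with root mean square error `7/M`.

This mean square bound serves twice. Since `e^{-iTv}` is Lipschitz in `v` with constant `T = √N t`,
and since different `k` stay orthogonal, the simulation error is at most `7T/M`
(`TransformsWithin.performsWithin`); Chebyshev's inequality gives the probability statement of the
QFTC (`TransformsWithin.isQFTC`). Both requirements amount to `7/M ≤ δ/T`. Hence `M` of order `T/δ`
suffices, which for `δ < 2` is within the bound `T/δ^{3/2}`; the remaining cases are trivial ones
where no estimation is needed. -/

theorem onWires_mulVec (e : σ ↪ ι) (U : Matrix (σ → Fin 2) (σ → Fin 2) ℂ)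
    (ψ : (ι → Fin 2) → ℂ) (x : ι → Fin 2) :
    (onWires e U *ᵥ ψ) x = ∑ s, U (x ∘ e) s * ψ (Function.extend e s x) := by
  rw [Matrix.mulVec, dotProduct]
  symm
  -- Row `x` is supported on the strings that agree with `x` off the range of `e`, and these are
  -- parametrized by their restriction `s` to that range.
  refine Fintype.sum_of_injective (fun s => Function.extend e s x) ?_ _ _ ?_ ?_
  · intro s s' h
    funext i
    have := congrFun h (e i)
    simpa [e.injective.extend_apply] using this
  · intro y hy
    rw [onWires, Matrix.of_apply, if_neg, zero_mul]
    intro h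
    refine hy ⟨y ∘ e, ?_⟩
    funext i
    by_cases hi : ∃ s, e s = i
    · obtain ⟨s, rfl⟩ := hi
      simp [e.injective.extend_apply]
    · exact (Function.extend_apply' _ _ _ hi).trans (h i fun s hs => hi ⟨s, hs⟩)
  · intro s
    rw [onWires, Matrix.of_apply, if_pos]
    · congr 2
      funext i
      simp [e.injective.extend_apply]
    · intro i hi
      rw [Function.extend_apply' _ _ _ (by simpa using hi)]

theorem onWires_one (e : σ ↪ ι) : onWires e (1 : Matrix (σ → Fin 2) (σ → Fin 2) ℂ) = 1 := by
  ext x y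
  rw [onWires, Matrix.of_apply, Matrix.one_apply, Matrix.one_apply]
  by_cases h : x = y
  · simp [h]
  · rw [if_neg h]
    split_ifs with h1 h2
    · refine absurd ?_ h
      funext i
      by_cases hi : ∃ s, e s = i
      · obtain ⟨s, rfl⟩ := hi
        exact congrFun h2 s
      · exact h1 i (by simpa using hi)
    · rfl
    · rfl

theorem onWires_mul (e : σ ↪ ι) (U V : Matrix (σ → Fin 2) (σ → Fin 2) ℂ) :
    onWires e (U * V) = onWires e U * onWires e V := by
  ext x z
  have h := onWires_mulVec e U (fun y => onWires e V y z) x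
  rw [Matrix.mul_apply]
  rw [Matrix.mulVec, dotProduct] at h
  rw [h, onWires, Matrix.of_apply]
  have hc (s : σ → Fin 2) : (∀ i, (∀ t, e t ≠ i) → Function.extend e s x i = z i) ↔
      ∀ i, (∀ t, e t ≠ i) → x i = z i := by
    refine forall_congr' fun i => imp_congr_right fun hi => ?_
    rw [Function.extend_apply' _ _ _ (by simpa using hi)]
  have hs (s : σ → Fin 2) : Function.extend e s x ∘ e = s := by
    funext i
    simp [e.injective.extend_apply]
  simp only [onWires, Matrix.of_apply, hc, hs]
  split_ifs
  · rw [Matrix.mul_apply]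
  · simp

theorem onWires_conjTranspose (e : σ ↪ ι) (U : Matrix (σ → Fin 2) (σ → Fin 2) ℂ) :
    onWires e Uᴴ = (onWires e U)ᴴ := by
  ext x y
  simp only [onWires, Matrix.of_apply, Matrix.conjTranspose_apply]
  simp only [eq_comm (a := y _)]
  split_ifs <;> simp

theorem onWires_trans (e : σ ↪ ι) (f : ι ↪ κ) (U : Matrix (σ → Fin 2) (σ → Fin 2) ℂ) :
    onWires (e.trans f) U = onWires f (onWires e U) := by
  ext x y
  simp only [onWires, Matrix.of_apply, Function.Embedding.trans_apply, Function.comp_apply]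
  by_cases h1 : ∀ i, (∀ s, f s ≠ i) → x i = y i
  · rw [if_pos h1]
    refine if_congr ⟨fun h i hi => h _ fun s hs => hi s (f.injective hs), fun h i hi => ?_⟩ rfl rfl
    by_cases hj : ∃ j, f j = i
    · obtain ⟨j, rfl⟩ := hj
      exact h j fun s hs => hi s (by rw [hs])
    · exact h1 i (by simpa using hj)
  · rw [if_neg h1, if_neg]
    exact fun h => h1 fun i hi => h i fun s hs => hi _ hs

theorem onWires_mem_unitaryGroup (e : σ ↪ ι) {U : Matrix (σ → Fin 2) (σ → Fin 2) ℂ}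
    (hU : U ∈ Matrix.unitaryGroup (σ → Fin 2) ℂ) :
    onWires e U ∈ Matrix.unitaryGroup (ι → Fin 2) ℂ := by
  rw [Matrix.mem_unitaryGroup_iff, Matrix.star_eq_conjTranspose] at hU ⊢
  rw [← onWires_conjTranspose, ← onWires_mul, hU, onWires_one]

theorem onWires_equiv_mulVec (f : ι ≃ κ) (U : Matrix (ι → Fin 2) (ι → Fin 2) ℂ)
    (ψ : (κ → Fin 2) → ℂ) (x : κ → Fin 2) :
    (onWires f.toEmbedding U *ᵥ ψ) x = (U *ᵥ fun y => ψ (y ∘ f.symm)) (x ∘ f) := by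
  rw [onWires_mulVec, Matrix.mulVec, dotProduct]
  refine Finset.sum_congr rfl fun s _ => ?_
  congr 2
  funext i
  obtain ⟨j, rfl⟩ := f.surjective i
  simp

end OnWires

/-! ### Controlled operators -/

section Controlled

variable {L : ℕ}

theorem controlled_mul (U V : Matrix (Fin L → Fin 2) (Fin L → Fin 2) ℂ) :
    controlled (U * V) = controlled U * controlled V := by
  -- Up to reindexing by the value of the control, a controlled operator is block diagonal with
  -- blocks `1` and `U`, so products are taken blockwise.
  have key (U : Matrix (Fin L → Fin 2) (Fin L → Fin 2) ℂ) : controlled U =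
      (Matrix.blockDiagonal fun i : Fin 2 => if i = 1 then U else 1).submatrix
        (fun x : Option (Fin L) → Fin 2 => (x ∘ some, x none)) (fun x => (x ∘ some, x none)) := by
    ext x y
    simp only [controlled, Matrix.of_apply, Matrix.submatrix_apply, Matrix.blockDiagonal_apply]
    split_ifs <;> rfl
  have hb : Function.Bijective fun x : Option (Fin L) → Fin 2 => (x ∘ some, x none) := by
    refine ⟨fun x y h => ?_, fun p => ⟨fun o => o.elim p.2 p.1, by ext <;> simp⟩⟩
    simp only [Prod.mk.injEq] at h
    funext o
    cases o with
    | none => exact h.2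
    | some i => exact congrFun h.1 i
  rw [key, key, key, ← Matrix.submatrix_mul _ _ _ _ _ hb, ← Matrix.blockDiagonal_mul]
  congr 2
  funext i
  split_ifs <;> simp

theorem controlled_one : controlled (1 : Matrix (Fin L → Fin 2) (Fin L → Fin 2) ℂ) = 1 := by
  ext x y
  simp only [controlled, Matrix.of_apply, ite_self, Matrix.one_apply]
  by_cases h : x = y
  · simp [h]
  · rw [if_neg h]
    split_ifs with h1 h2
    · refine absurd ?_ h
      funext o
      cases o with
      | none => exact h1
      | some i => exact congrFun h2 i
    · rfl
    · rfl

theorem controlled_conjTranspose (U : Matrix (Fin L → Fin 2) (Fin L → Fin 2) ℂ) :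
    controlled Uᴴ = (controlled U)ᴴ := by
  ext x y
  simp only [controlled, Matrix.of_apply, Matrix.conjTranspose_apply, Matrix.one_apply]
  by_cases h : x none = y none
  · simp only [h, if_true, eq_comm (a := y ∘ some)]
    split_ifs <;> simp
  · rw [if_neg h, if_neg (Ne.symm h), star_zero]

theorem onQubits_conjTranspose (U : Matrix (Fin (2 ^ L)) (Fin (2 ^ L)) ℂ) :
    onQubits Uᴴ = (onQubits U)ᴴ := rfl

theorem onQubits_mul (U V : Matrix (Fin (2 ^ L)) (Fin (2 ^ L)) ℂ) :
    onQubits (U * V) = onQubits U * onQubits V :=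
  (Matrix.submatrix_mul_equiv _ _ _ _ _).symm

theorem onQubits_one : onQubits (1 : Matrix (Fin (2 ^ L)) (Fin (2 ^ L)) ℂ) = 1 :=
  Matrix.submatrix_one_equiv _

end Controlled

/-! ### Circuits -/

section Circuits

variable {L : ℕ} {ι κ : Type}

/-- The gate on other wires. -/
def Gate.map (f : ι ↪ κ) : Gate L ι → Gate L κ
  | .one e U => .one (e.trans f) U
  | .two e U => .two (e.trans f) U
  | .oracle e => .oracle (e.trans f)
  | .oracleInv e => .oracleInv (e.trans f)

/-- The circuit on other wires. -/
def Circuit.mapWires (f : ι ↪ κ) (W : Circuit L ι) : Circuit L κ :=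
  List.map (Gate.map f) W

theorem Gate.isCall_map (f : ι ↪ κ) (g : Gate L ι) : (g.map f).isCall = g.isCall := by
  cases g <;> rfl

theorem Gate.isCall_inv (g : Gate L ι) : g.inv.isCall = g.isCall := by
  cases g <;> rfl

theorem Circuit.gateCount_append (W₁ W₂ : Circuit L ι) :
    Circuit.gateCount (W₁ ++ W₂) = W₁.gateCount + W₂.gateCount :=
  List.countP_append

theorem Circuit.callCount_append (W₁ W₂ : Circuit L ι) :
    Circuit.callCount (W₁ ++ W₂) = W₁.callCount + W₂.callCount :=
  List.countP_append

theorem Circuit.gateCount_inv (W : Circuit L ι) : W.inv.gateCount = W.gateCount := by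
  simp only [Circuit.inv, Circuit.gateCount, List.countP_reverse, List.countP_map]
  congr 1
  funext g
  simp [Gate.isCall_inv]

theorem Circuit.callCount_inv (W : Circuit L ι) : W.inv.callCount = W.callCount := by
  simp only [Circuit.inv, Circuit.callCount, List.countP_reverse, List.countP_map]
  congr 1
  funext g
  simp [Gate.isCall_inv]

theorem Circuit.gateCount_mapWires (f : ι ↪ κ) (W : Circuit L ι) :
    (W.mapWires f).gateCount = W.gateCount := by
  simp only [Circuit.mapWires, Circuit.gateCount, List.countP_map]
  congr 1
  funext g
  simp [Gate.isCall_map]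

theorem Circuit.callCount_mapWires (f : ι ↪ κ) (W : Circuit L ι) :
    (W.mapWires f).callCount = W.callCount := by
  simp only [Circuit.mapWires, Circuit.callCount, List.countP_map]
  congr 1
  funext g
  simp [Gate.isCall_map]

theorem Circuit.gateCount_flatMap {α : Type*} (l : List α) (W : α → Circuit L ι) :
    Circuit.gateCount (l.flatMap W) = (l.map fun i => (W i).gateCount).sum := by
  induction l with
  | nil => rfl
  | cons i l ih =>
    rw [List.flatMap_cons, Circuit.gateCount_append, ih, List.map_cons, List.sum_cons]

theorem Circuit.callCount_flatMap {α : Type*} (l : List α) (W : α → Circuit L ι) :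
    Circuit.callCount (l.flatMap W) = (l.map fun i => (W i).callCount).sum := by
  induction l with
  | nil => rfl
  | cons i l ih =>
    rw [List.flatMap_cons, Circuit.callCount_append, ih, List.map_cons, List.sum_cons]

variable [Fintype ι] [DecidableEq ι] [Fintype κ] [DecidableEq κ]
  (O : Matrix (Fin (2 ^ L)) (Fin (2 ^ L)) ℂ)

theorem Circuit.eval_cons (g : Gate L ι) (W : Circuit L ι) :
    Circuit.eval O (g :: W) = W.eval O * g.eval O := rfl

theorem Circuit.eval_append (W₁ W₂ : Circuit L ι) :
    Circuit.eval O (W₁ ++ W₂) = W₂.eval O * W₁.eval O := by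
  induction W₁ with
  | nil => simp [Circuit.eval]
  | cons g W ih => rw [List.cons_append, Circuit.eval_cons, Circuit.eval_cons, ih, mul_assoc]

theorem Circuit.eval_singleton (g : Gate L ι) : Circuit.eval O [g] = g.eval O := by
  simp [Circuit.eval]

theorem Gate.eval_inv (g : Gate L ι) : g.inv.eval O = (g.eval O)ᴴ := by
  cases g <;> simp only [Gate.inv, Gate.eval, onQubits_conjTranspose, controlled_conjTranspose,
    onWires_conjTranspose, Matrix.conjTranspose_conjTranspose]
  all_goals
    rw [← onWires_conjTranspose]
    rfl

theorem Circuit.eval_inv (W : Circuit L ι) : W.inv.eval O = (W.eval O)ᴴ := by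
  induction W with
  | nil => simp [Circuit.inv, Circuit.eval]
  | cons g W ih =>
    rw [Circuit.eval_cons, Matrix.conjTranspose_mul, ← ih, ← Gate.eval_inv,
      ← Circuit.eval_singleton O g.inv, ← Circuit.eval_append]
    simp [Circuit.inv]

theorem Gate.eval_map (f : ι ↪ κ) (g : Gate L ι) : (g.map f).eval O = onWires f (g.eval O) := by
  cases g <;> exact onWires_trans _ _ _

theorem Circuit.eval_mapWires (f : ι ↪ κ) (W : Circuit L ι) :
    (W.mapWires f).eval O = onWires f (W.eval O) := by
  induction W with
  | nil => exact (onWires_one f).symm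
  | cons g W ih =>
    change Circuit.eval O (g.map f :: Circuit.mapWires f W) = _
    rw [Circuit.eval_cons, Circuit.eval_cons, ih, Gate.eval_map, onWires_mul]

variable {O}

theorem Gate.eval_mem_unitaryGroup (hO : O ∈ Matrix.unitaryGroup (Fin (2 ^ L)) ℂ) (g : Gate L ι) :
    g.eval O ∈ Matrix.unitaryGroup (ι → Fin 2) ℂ := by
  have h : controlled (onQubits O) ∈ Matrix.unitaryGroup (Option (Fin L) → Fin 2) ℂ := by
    rw [Matrix.mem_unitaryGroup_iff, Matrix.star_eq_conjTranspose] at hO ⊢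
    rw [← controlled_conjTranspose, ← onQubits_conjTranspose, ← controlled_mul, ← onQubits_mul,
      hO, onQubits_one, controlled_one]
  cases g with
  | one e U => exact onWires_mem_unitaryGroup e U.2
  | two e U => exact onWires_mem_unitaryGroup e U.2
  | oracle e => exact onWires_mem_unitaryGroup e h
  | oracleInv e =>
    refine onWires_mem_unitaryGroup e ?_
    rw [onQubits_conjTranspose, controlled_conjTranspose]
    exact Unitary.star_mem h

theorem Circuit.eval_mem_unitaryGroup (hO : O ∈ Matrix.unitaryGroup (Fin (2 ^ L)) ℂ)
    (W : Circuit L ι) : W.eval O ∈ Matrix.unitaryGroup (ι → Fin 2) ℂ := by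
  induction W with
  | nil => exact one_mem _
  | cons g W ih => exact mul_mem ih (g.eval_mem_unitaryGroup hO)

theorem Circuit.eval_mul_conjTranspose (hO : O ∈ Matrix.unitaryGroup (Fin (2 ^ L)) ℂ)
    (W : Circuit L ι) : W.eval O * (W.eval O)ᴴ = 1 :=
  Matrix.mem_unitaryGroup_iff.mp (W.eval_mem_unitaryGroup hO)

theorem Circuit.conjTranspose_mul_eval (hO : O ∈ Matrix.unitaryGroup (Fin (2 ^ L)) ℂ)
    (W : Circuit L ι) : (W.eval O)ᴴ * W.eval O = 1 :=
  Matrix.mem_unitaryGroup_iff'.mp (W.eval_mem_unitaryGroup hO)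

end Circuits

/-! ### Operators that preserve the value of a wire -/

section PreservesWire

variable {σ ι κ : Type} [Fintype σ] [Fintype ι] [DecidableEq ι]

/-- The operator leaves the value of the wire `i` unchanged. -/
def PreservesWire (M : Matrix (ι → Fin 2) (ι → Fin 2) ℂ) (i : ι) : Prop :=
  ∀ x y, M x y ≠ 0 → x i = y i

theorem PreservesWire.one (i : ι) : PreservesWire 1 i := by
  intro x y h
  by_contra hne
  exact h (Matrix.one_apply_ne fun hxy => hne (by rw [hxy]))

theorem PreservesWire.mul {M M' : Matrix (ι → Fin 2) (ι → Fin 2) ℂ} {i : ι}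
    (h : PreservesWire M i) (h' : PreservesWire M' i) : PreservesWire (M * M') i := by
  intro x z hxz
  rw [Matrix.mul_apply] at hxz
  obtain ⟨y, -, hy⟩ := Finset.exists_ne_zero_of_sum_ne_zero hxz
  exact (h x y (left_ne_zero_of_mul hy)).trans (h' y z (right_ne_zero_of_mul hy))

theorem PreservesWire.conjTranspose {M : Matrix (ι → Fin 2) (ι → Fin 2) ℂ} {i : ι}
    (h : PreservesWire M i) : PreservesWire Mᴴ i := by
  intro x y hxy
  exact (h y x (star_ne_zero.mp hxy)).symm

theorem PreservesWire.onWires_of_notMem (e : σ ↪ ι) (U : Matrix (σ → Fin 2) (σ → Fin 2) ℂ) {i : ι}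
    (hi : ∀ s, e s ≠ i) : PreservesWire (onWires e U) i := by
  intro x y hxy
  by_contra hne
  rw [onWires, Matrix.of_apply, if_neg] at hxy
  · exact hxy rfl
  · exact fun h => hne (h i hi)

theorem PreservesWire.onWires [DecidableEq σ] (e : σ ↪ ι)
    {U : Matrix (σ → Fin 2) (σ → Fin 2) ℂ} {s : σ}
    (h : PreservesWire U s) : PreservesWire (onWires e U) (e s) := by
  intro x y hxy
  rw [_root_.onWires, Matrix.of_apply] at hxy
  split_ifs at hxy with h1
  · exact h _ _ hxy
  · exact absurd rfl hxy

theorem PreservesWire.circuit {L : ℕ} (O : Matrix (Fin (2 ^ L)) (Fin (2 ^ L)) ℂ) {i : ι}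
    {W : Circuit L ι} (h : ∀ g ∈ W, PreservesWire (g.eval O) i) :
    PreservesWire (W.eval O) i := by
  induction W with
  | nil => exact .one i
  | cons g W ih =>
    exact (ih fun g' hg' => h g' (List.mem_cons_of_mem _ hg')).mul (h g List.mem_cons_self)

theorem PreservesWire.mulVec_ne_zero {M : Matrix (ι → Fin 2) (ι → Fin 2) ℂ} {i : ι}
    (h : PreservesWire M i) {ψ : (ι → Fin 2) → ℂ} {b : Fin 2} (hψ : ∀ x, ψ x ≠ 0 → x i = b)
    {x : ι → Fin 2} (hx : (M *ᵥ ψ) x ≠ 0) : x i = b := by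
  rw [Matrix.mulVec, dotProduct] at hx
  obtain ⟨y, -, hy⟩ := Finset.exists_ne_zero_of_sum_ne_zero hx
  exact (h x y (left_ne_zero_of_mul hy)).trans (hψ y (right_ne_zero_of_mul hy))

end PreservesWire

/-! ### One-qubit gates and controlled one-qubit gates -/

section PrimitiveGates

variable {L : ℕ} {ι : Type}

theorem fin_two_eq_zero_or_one (b : Fin 2) : b = 0 ∨ b = 1 := by
  revert b
  decide

/-- A `2 × 2` matrix as an operator on one qubit. -/
def oneQubitMatrix (G : Matrix (Fin 2) (Fin 2) ℂ) : Matrix (Fin 1 → Fin 2) (Fin 1 → Fin 2) ℂ :=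
  G.submatrix (Equiv.funUnique (Fin 1) (Fin 2)) (Equiv.funUnique (Fin 1) (Fin 2))

/-- The controlled version of a `2 × 2` matrix; the control is the qubit `0`. -/
def ctrlMatrix (G : Matrix (Fin 2) (Fin 2) ℂ) : Matrix (Fin 2 → Fin 2) (Fin 2 → Fin 2) ℂ :=
  (Matrix.blockDiagonal fun i : Fin 2 => if i = 1 then G else 1).submatrix
    ((finTwoArrowEquiv (Fin 2)).trans (Equiv.prodComm _ _))
    ((finTwoArrowEquiv (Fin 2)).trans (Equiv.prodComm _ _))

theorem oneQubitMatrix_mem_unitaryGroup (G : Matrix.unitaryGroup (Fin 2) ℂ) :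
    oneQubitMatrix G.1 ∈ Matrix.unitaryGroup (Fin 1 → Fin 2) ℂ := by
  have hG := Matrix.mem_unitaryGroup_iff.mp G.2
  rw [Matrix.star_eq_conjTranspose] at hG
  rw [Matrix.mem_unitaryGroup_iff, Matrix.star_eq_conjTranspose, oneQubitMatrix,
    Matrix.conjTranspose_submatrix, Matrix.submatrix_mul_equiv, hG, Matrix.submatrix_one_equiv]

theorem ctrlMatrix_mem_unitaryGroup (G : Matrix.unitaryGroup (Fin 2) ℂ) :
    ctrlMatrix G.1 ∈ Matrix.unitaryGroup (Fin 2 → Fin 2) ℂ := by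
  have hG := Matrix.mem_unitaryGroup_iff.mp G.2
  rw [Matrix.star_eq_conjTranspose] at hG
  rw [Matrix.mem_unitaryGroup_iff, Matrix.star_eq_conjTranspose, ctrlMatrix,
    Matrix.conjTranspose_submatrix, Matrix.submatrix_mul_equiv, Matrix.blockDiagonal_conjTranspose,
    ← Matrix.blockDiagonal_mul]
  have : (fun k : Fin 2 => (if k = 1 then G.1 else 1) * (if k = 1 then G.1 else 1)ᴴ) = 1 := by
    funext k
    split_ifs <;> simp [hG]
  rw [this, Matrix.blockDiagonal_one, Matrix.submatrix_one_equiv]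

/-- The embedding of one wire. -/
def oneWire (q : ι) : Fin 1 ↪ ι := ⟨fun _ => q, fun _ _ _ => Subsingleton.elim _ _⟩

/-- The embedding of two distinct wires. -/
def twoWires (q r : ι) (h : q ≠ r) : Fin 2 ↪ ι :=
  ⟨![q, r], by
    intro i j hij
    fin_cases i <;> fin_cases j <;> simp_all [eq_comm]⟩

/-- The gate `G` on the wire `q`. -/
def oneGate (q : ι) (G : Matrix.unitaryGroup (Fin 2) ℂ) : Gate L ι :=
  .one (oneWire q) ⟨_, oneQubitMatrix_mem_unitaryGroup G⟩

/-- The gate `G` on the wire `r`, controlled by the wire `q`. -/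
def ctrlGate (q r : ι) (h : q ≠ r) (G : Matrix.unitaryGroup (Fin 2) ℂ) : Gate L ι :=
  .two (twoWires q r h) ⟨_, ctrlMatrix_mem_unitaryGroup G⟩

variable [Fintype ι] [DecidableEq ι] (O : Matrix (Fin (2 ^ L)) (Fin (2 ^ L)) ℂ)

theorem extend_oneWire (q : ι) (s : Fin 1 → Fin 2) (x : ι → Fin 2) :
    Function.extend (oneWire q) s x = Function.update x q (s 0) := by
  funext i
  by_cases hi : i = q
  · subst hi
    rw [Function.update_self]
    exact (oneWire i).injective.extend_apply s x 0
  · rw [Function.update_of_ne hi, Function.extend_apply']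
    rintro ⟨_, rfl⟩
    exact hi rfl

theorem extend_twoWires (q r : ι) (h : q ≠ r) (s : Fin 2 → Fin 2) (x : ι → Fin 2) :
    Function.extend (twoWires q r h) s x =
      Function.update (Function.update x q (s 0)) r (s 1) := by
  funext i
  by_cases hr : i = r
  · subst hr
    rw [Function.update_self]
    exact (twoWires q i h).injective.extend_apply s x 1
  rw [Function.update_of_ne hr]
  by_cases hq : i = q
  · subst hq
    rw [Function.update_self]
    exact (twoWires i r h).injective.extend_apply s x 0
  rw [Function.update_of_ne hq, Function.extend_apply']
  rintro ⟨j, hj⟩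
  fin_cases j
  · exact hq hj.symm
  · exact hr hj.symm

theorem onWires_oneWire_mulVec (q : ι) (U : Matrix (Fin 1 → Fin 2) (Fin 1 → Fin 2) ℂ)
    (ψ : (ι → Fin 2) → ℂ) (x : ι → Fin 2) :
    (onWires (oneWire q) U *ᵥ ψ) x =
      ∑ b, U (fun _ => x q) (fun _ => b) * ψ (Function.update x q b) := by
  rw [onWires_mulVec, ← Equiv.sum_comp (Equiv.funUnique (Fin 1) (Fin 2)).symm]
  simp only [extend_oneWire]
  rfl

theorem oneGate_mulVec (q : ι) (G : Matrix.unitaryGroup (Fin 2) ℂ) (ψ : (ι → Fin 2) → ℂ)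
    (x : ι → Fin 2) :
    ((oneGate q G : Gate L ι).eval O *ᵥ ψ) x =
      ∑ b, G.1 (x q) b * ψ (Function.update x q b) :=
  onWires_oneWire_mulVec q _ ψ x

theorem ctrlGate_mulVec (q r : ι) (h : q ≠ r) (G : Matrix.unitaryGroup (Fin 2) ℂ)
    (ψ : (ι → Fin 2) → ℂ) (x : ι → Fin 2) :
    ((ctrlGate q r h G : Gate L ι).eval O *ᵥ ψ) x =
      if x q = 1 then ∑ b, G.1 (x r) b * ψ (Function.update x r b) else ψ x := by
  change (onWires (twoWires q r h) (ctrlMatrix G.1) *ᵥ ψ) x = _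
  rw [onWires_mulVec, ← Equiv.sum_comp (finTwoArrowEquiv (Fin 2)).symm]
  simp only [extend_twoWires, Fintype.sum_prod_type]
  have hc (b c : Fin 2) : ctrlMatrix G.1 (x ∘ twoWires q r h)
      ((finTwoArrowEquiv (Fin 2)).symm (b, c)) =
      if x q = b then (if x q = 1 then G.1 else 1) (x r) c else 0 := by
    simp only [ctrlMatrix, Matrix.submatrix_apply, Matrix.blockDiagonal_apply]
    rfl
  simp only [hc, ite_mul, zero_mul, Finset.sum_ite_irrel, Finset.sum_const_zero]
  rw [Finset.sum_ite_eq, if_pos (Finset.mem_univ _)]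
  simp only [finTwoArrowEquiv_symm_apply, Matrix.cons_val_zero, Matrix.cons_val_one,
    Function.update_eq_self]
  split_ifs
  · rfl
  · simp [Matrix.one_apply]

theorem preservesWire_oneGate {q i : ι} (h : i ≠ q) (G : Matrix.unitaryGroup (Fin 2) ℂ) :
    PreservesWire ((oneGate q G : Gate L ι).eval O) i :=
  PreservesWire.onWires_of_notMem _ _ fun _ => h.symm

theorem preservesWire_ctrlGate {q r i : ι} (h : q ≠ r) (hi : i ≠ r)
    (G : Matrix.unitaryGroup (Fin 2) ℂ) :
    PreservesWire ((ctrlGate q r h G : Gate L ι).eval O) i := by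
  by_cases hq : i = q
  · subst hq
    refine PreservesWire.onWires (twoWires i r h) (s := 0) ?_
    intro x y hxy
    by_contra hne
    refine hxy ?_
    simp only [ctrlMatrix, Matrix.submatrix_apply, Matrix.blockDiagonal_apply]
    exact if_neg hne
  · refine PreservesWire.onWires_of_notMem _ _ fun s => ?_
    fin_cases s
    · exact Ne.symm hq
    · exact hi.symm

/-- The Pauli matrix `X`. -/
def pauliX : Matrix.unitaryGroup (Fin 2) ℂ :=
  ⟨!![0, 1; 1, 0], by
    rw [Matrix.mem_unitaryGroup_iff]
    ext i j
    fin_cases i <;> fin_cases j <;> simp [Matrix.mul_apply]⟩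

/-- The Hadamard matrix. -/
noncomputable def hadamard : Matrix.unitaryGroup (Fin 2) ℂ :=
  ⟨((Real.sqrt 2 : ℝ) : ℂ)⁻¹ • !![1, 1; 1, -1], by
    have h : ((Real.sqrt 2 : ℝ) : ℂ)⁻¹ * ((Real.sqrt 2 : ℝ) : ℂ)⁻¹ = 2⁻¹ := by
      rw [← mul_inv, ← Complex.ofReal_mul, Real.mul_self_sqrt zero_le_two]
      norm_num
    rw [Matrix.mem_unitaryGroup_iff]
    ext i j
    fin_cases i <;> fin_cases j <;>
      simp [Matrix.mul_apply, h, -mul_inv_rev] <;> norm_num⟩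

/-- The diagonal one-qubit gate with entries of modulus one. -/
def diagonalUnitary (u : Fin 2 → ℂ) (hu : ∀ i, ‖u i‖ = 1) : Matrix.unitaryGroup (Fin 2) ℂ :=
  ⟨Matrix.diagonal u, by
    rw [Matrix.mem_unitaryGroup_iff, Matrix.star_eq_conjTranspose, Matrix.diagonal_conjTranspose,
      Matrix.diagonal_mul_diagonal, ← Matrix.diagonal_one]
    congr 1
    funext i
    simp [Complex.mul_conj, Complex.normSq_eq_norm_sq, hu i]⟩

/-- The one-qubit gate `exp (i φ |1⟩⟨1|)`. -/
noncomputable def phaseUnitary (φ : ℝ) : Matrix.unitaryGroup (Fin 2) ℂ :=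
  diagonalUnitary ![1, Complex.exp (φ * Complex.I)] (by
    intro i
    fin_cases i
    · simp
    · exact Complex.norm_exp_ofReal_mul_I φ)

theorem hadamard_apply (b c : Fin 2) :
    hadamard.1 b c = ((Real.sqrt 2 : ℝ) : ℂ)⁻¹ * (if b = 1 ∧ c = 1 then -1 else 1) := by
  fin_cases b <;> fin_cases c <;> simp [hadamard]

theorem oneGate_pauliX_mulVec (q : ι) (ψ : (ι → Fin 2) → ℂ) (x : ι → Fin 2) :
    ((oneGate q pauliX : Gate L ι).eval O *ᵥ ψ) x = ψ (Function.update x q (x q + 1)) := by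
  rw [oneGate_mulVec, Fin.sum_univ_two]
  rcases fin_two_eq_zero_or_one (x q) with h | h <;> simp [h, pauliX]

theorem ctrlGate_pauliX_mulVec (q r : ι) (h : q ≠ r) (ψ : (ι → Fin 2) → ℂ) (x : ι → Fin 2) :
    ((ctrlGate q r h pauliX : Gate L ι).eval O *ᵥ ψ) x =
      ψ (Function.update x r (x r + x q)) := by
  rw [ctrlGate_mulVec, Fin.sum_univ_two]
  rcases fin_two_eq_zero_or_one (x q) with h | h <;>
    rcases fin_two_eq_zero_or_one (x r) with h' | h' <;> simp [h, h', pauliX]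
  all_goals rw [← h', Function.update_eq_self]

theorem oneGate_diagonal_mulVec (q : ι) (u : Fin 2 → ℂ) (hu : ∀ i, ‖u i‖ = 1)
    (ψ : (ι → Fin 2) → ℂ) (x : ι → Fin 2) :
    ((oneGate q (diagonalUnitary u hu) : Gate L ι).eval O *ᵥ ψ) x = u (x q) * ψ x := by
  rw [oneGate_mulVec, Finset.sum_eq_single (x q)]
  · simp [diagonalUnitary]
  · intro b _ hb
    simp [diagonalUnitary, Matrix.diagonal_apply_ne' _ hb]
  · simp

theorem ctrlGate_diagonal_mulVec (q r : ι) (h : q ≠ r) (u : Fin 2 → ℂ) (hu : ∀ i, ‖u i‖ = 1)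
    (ψ : (ι → Fin 2) → ℂ) (x : ι → Fin 2) :
    ((ctrlGate q r h (diagonalUnitary u hu) : Gate L ι).eval O *ᵥ ψ) x =
      (if x q = 1 then u (x r) else 1) * ψ x := by
  rw [ctrlGate_mulVec, Finset.sum_eq_single (x r), ite_mul, one_mul]
  · simp [diagonalUnitary]
  · intro b _ hb
    simp [diagonalUnitary, Matrix.diagonal_apply_ne' _ hb]
  · simp

theorem ctrlGate_phase_mulVec (q r : ι) (h : q ≠ r) (φ : ℝ) (ψ : (ι → Fin 2) → ℂ)
    (x : ι → Fin 2) :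
    ((ctrlGate q r h (phaseUnitary φ) : Gate L ι).eval O *ᵥ ψ) x =
      Complex.exp ((((x q : ℕ) * (x r : ℕ) : ℕ) : ℂ) * (φ * Complex.I)) * ψ x := by
  rw [phaseUnitary, ctrlGate_diagonal_mulVec]
  rcases fin_two_eq_zero_or_one (x q) with h | h <;>
    rcases fin_two_eq_zero_or_one (x r) with h' | h' <;> simp [h, h']

theorem phaseGate_mulVec (q : ι) (φ : ℝ) (ψ : (ι → Fin 2) → ℂ) (x : ι → Fin 2) :
    ((phaseGate q φ : Gate L ι).eval O *ᵥ ψ) x =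
      Complex.exp (((x q : ℕ) : ℂ) * (φ * Complex.I)) * ψ x := by
  change (onWires (oneWire q) (phaseMatrix φ) *ᵥ ψ) x = _
  have h01 : (fun _ : Fin 1 => (0 : Fin 2)) ≠ fun _ => 1 := fun h => absurd (congrFun h 0) (by simp)
  rw [onWires_oneWire_mulVec, Fin.sum_univ_two]
  rcases fin_two_eq_zero_or_one (x q) with h | h <;> simp [h, phaseMatrix, h01, h01.symm] <;>
    rw [← h, Function.update_eq_self]

/-- A circuit all of whose gates multiply by a phase. -/
theorem Circuit.eval_mulVec_of_diagonal {α : Type*} (l : List α) (g : α → Gate L ι)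
    (θ : α → (ι → Fin 2) → ℂ)
    (h : ∀ i ∈ l, ∀ ψ x, ((g i).eval O *ᵥ ψ) x = Complex.exp (θ i x) * ψ x)
    (ψ : (ι → Fin 2) → ℂ) (x : ι → Fin 2) :
    (Circuit.eval O (l.map g) *ᵥ ψ) x = Complex.exp (l.map fun i => θ i x).sum * ψ x := by
  induction l generalizing ψ with
  | nil => simp [Circuit.eval]
  | cons i l ih =>
    rw [List.map_cons, Circuit.eval_cons, ← Matrix.mulVec_mulVec,
      ih (fun j hj => h j (List.mem_cons_of_mem _ hj)), h i List.mem_cons_self, List.map_cons,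
      List.sum_cons, Complex.exp_add]
    ring

end PrimitiveGates

/-! ### Classical reversible circuits -/

section Classical

variable {L : ℕ} {ι κ : Type}

/-- A reversible classical gate: it adds to the bit on its target wire a constant, a bit, or the
product of two bits. -/
inductive ClassicalGate (ι : Type) : Type
  | not (t : ι) : ClassicalGate ι
  | cnot (a t : ι) (h : a ≠ t) : ClassicalGate ι
  | toffoli (a b t : ι) (hab : a ≠ b) (hat : a ≠ t) (hbt : b ≠ t) : ClassicalGate ι

namespace ClassicalGate

/-- The target wire. -/
def target : ClassicalGate ι → ι
  | .not t => t
  | .cnot _ t _ => t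
  | .toffoli _ _ t _ _ _ => t

/-- The source wires. -/
def sources : ClassicalGate ι → List ι
  | .not _ => []
  | .cnot a _ _ => [a]
  | .toffoli a b _ _ _ _ => [a, b]

/-- The bit that is added to the target. -/
def increment (x : ι → Fin 2) : ClassicalGate ι → Fin 2
  | .not _ => 1
  | .cnot a _ _ => x a
  | .toffoli a b _ _ _ _ => x a * x b

theorem increment_congr {x y : ι → Fin 2} (g : ClassicalGate ι)
    (h : ∀ a ∈ g.sources, x a = y a) : g.increment x = g.increment y := by
  cases g <;> simp_all [increment, sources]

theorem target_notMem_sources (g : ClassicalGate ι) : g.target ∉ g.sources := by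
  cases g <;> simp_all [target, sources, eq_comm]

variable [DecidableEq ι]

/-- The action on bit strings. -/
def apply (g : ClassicalGate ι) (x : ι → Fin 2) : ι → Fin 2 :=
  Function.update x g.target (x g.target + g.increment x)

theorem apply_target (g : ClassicalGate ι) (x : ι → Fin 2) :
    g.apply x g.target = x g.target + g.increment x :=
  Function.update_self ..

theorem apply_of_ne (g : ClassicalGate ι) (x : ι → Fin 2) {i : ι} (h : i ≠ g.target) :
    g.apply x i = x i :=
  Function.update_of_ne h ..

theorem increment_apply (g : ClassicalGate ι) (x : ι → Fin 2) :
    g.increment (g.apply x) = g.increment x :=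
  g.increment_congr fun _ ha => g.apply_of_ne x fun h => g.target_notMem_sources (h ▸ ha)

theorem fin_two_add_add_self (b c : Fin 2) : b + c + c = b := by
  revert b c
  decide

theorem apply_apply (g : ClassicalGate ι) (x : ι → Fin 2) : g.apply (g.apply x) = x := by
  funext i
  by_cases h : i = g.target
  · subst h
    rw [apply_target, increment_apply, apply_target, fin_two_add_add_self]
  · rw [apply_of_ne _ _ h, apply_of_ne _ _ h]

/-- The implementation by one- and two-qubit gates. -/
noncomputable def toCircuit : ClassicalGate ι → Circuit L ι
  | .not t => [oneGate t pauliX]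
  | .cnot a t h => [ctrlGate a t h pauliX]
  | .toffoli a b t hab hat hbt =>
    [oneGate t hadamard, ctrlGate a t hat (phaseUnitary (Real.pi / 2)), ctrlGate a b hab pauliX,
      ctrlGate b t hbt (phaseUnitary (-(Real.pi / 2))), ctrlGate a b hab pauliX,
      ctrlGate b t hbt (phaseUnitary (Real.pi / 2)), oneGate t hadamard]

theorem gateCount_toCircuit_le (g : ClassicalGate ι) :
    (g.toCircuit : Circuit L ι).gateCount ≤ 7 := by
  cases g <;> simp [toCircuit, Circuit.gateCount, oneGate, ctrlGate, Gate.isCall]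

theorem callCount_toCircuit (g : ClassicalGate ι) :
    (g.toCircuit : Circuit L ι).callCount = 0 := by
  cases g <;> simp [toCircuit, Circuit.callCount, oneGate, ctrlGate, Gate.isCall]

variable [Fintype ι] (O : Matrix (Fin (2 ^ L)) (Fin (2 ^ L)) ℂ)

/-- For bits, `a + b - (a ⊕ b) = 2ab`. The three controlled phases therefore multiply to `i^{2abt} =
(-1)^{abt}`, and the two CNOTs only compute and uncompute `a ⊕ b` on the wire `b`. -/
theorem ccz_mulVec (a b t : ι) (hab : a ≠ b) (hat : a ≠ t) (hbt : b ≠ t) (ψ : (ι → Fin 2) → ℂ)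
    (x : ι → Fin 2) :
    (Circuit.eval O [ctrlGate a t hat (phaseUnitary (Real.pi / 2)), ctrlGate a b hab pauliX,
      ctrlGate b t hbt (phaseUnitary (-(Real.pi / 2))), ctrlGate a b hab pauliX,
      ctrlGate b t hbt (phaseUnitary (Real.pi / 2))] *ᵥ ψ) x =
      (if x t = 1 ∧ x a * x b = 1 then -1 else 1) * ψ x := by
  have hI : Complex.exp (Real.pi / 2 * Complex.I) = Complex.I := Complex.exp_pi_div_two_mul_I
  have hI' : Complex.exp (-(Real.pi / 2 * Complex.I)) = -Complex.I := by
    rw [Complex.exp_neg, hI, Complex.inv_I]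
  simp only [Circuit.eval, one_mul, ← Matrix.mulVec_mulVec, ctrlGate_phase_mulVec,
    ctrlGate_pauliX_mulVec, Function.update_self, Function.update_of_ne hab,
    Function.update_of_ne hbt.symm, Function.update_idem, fin_two_add_add_self,
    Function.update_eq_self]
  rcases fin_two_eq_zero_or_one (x a) with h | h <;>
    rcases fin_two_eq_zero_or_one (x b) with h' | h' <;>
    rcases fin_two_eq_zero_or_one (x t) with h'' | h'' <;>
    simp [h, h', h'', hI, hI', ← mul_assoc]

/-- A Toffoli gate is the doubly controlled sign of `ccz_mulVec` conjugated by Hadamard gates on the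
target. No inverse of the action appears on the right because each classical gate is an involution.
-/
theorem eval_toCircuit_mulVec (g : ClassicalGate ι) (ψ : (ι → Fin 2) → ℂ) (x : ι → Fin 2) :
    (g.toCircuit.eval O *ᵥ ψ) x = ψ (g.apply x) := by
  cases g with
  | not t => rw [toCircuit, Circuit.eval_singleton, oneGate_pauliX_mulVec]; rfl
  | cnot a t h => rw [toCircuit, Circuit.eval_singleton, ctrlGate_pauliX_mulVec]; rfl
  | toffoli a b t hab hat hbt =>
    have hs : ((Real.sqrt 2 : ℝ) : ℂ)⁻¹ * ((Real.sqrt 2 : ℝ) : ℂ)⁻¹ = 2⁻¹ := by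
      rw [← mul_inv, ← Complex.ofReal_mul, Real.mul_self_sqrt zero_le_two]
      norm_num
    have hsplit : (ClassicalGate.toffoli a b t hab hat hbt).toCircuit =
        [oneGate t hadamard] ++ [ctrlGate a t hat (phaseUnitary (Real.pi / 2)),
          ctrlGate a b hab pauliX, ctrlGate b t hbt (phaseUnitary (-(Real.pi / 2))),
          ctrlGate a b hab pauliX, ctrlGate b t hbt (phaseUnitary (Real.pi / 2))] ++
        ([oneGate t hadamard] : Circuit L ι) := rfl
    rw [hsplit, Circuit.eval_append, Circuit.eval_append, Circuit.eval_singleton,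
      ← Matrix.mulVec_mulVec, ← Matrix.mulVec_mulVec, oneGate_mulVec]
    simp only [ccz_mulVec O a b t hab hat hbt, oneGate_mulVec, Fin.sum_univ_two, hadamard_apply,
      Function.update_self, Function.update_of_ne hat, Function.update_of_ne hbt,
      Function.update_idem, apply, target, increment]
    have h2 (z : ℂ) : ((Real.sqrt 2 : ℝ) : ℂ)⁻¹ * (((Real.sqrt 2 : ℝ) : ℂ)⁻¹ * z) = 2⁻¹ * z := by
      rw [← mul_assoc, hs]
    rcases fin_two_eq_zero_or_one (x t) with h | h <;>
      rcases fin_two_eq_zero_or_one (x a * x b) with h' | h' <;>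
      simp [h, h', mul_add, h2] <;> ring

end ClassicalGate

/-- The action on bit strings of a list of classical gates; the head is applied first. -/
def runClassical [DecidableEq ι] : List (ClassicalGate ι) → (ι → Fin 2) → ι → Fin 2
  | [], x => x
  | g :: l, x => runClassical l (g.apply x)

/-- The implementation by one- and two-qubit gates. -/
noncomputable def classicalCircuit [DecidableEq ι] (l : List (ClassicalGate ι)) : Circuit L ι :=
  l.flatMap ClassicalGate.toCircuit

section Run

variable [DecidableEq ι]

theorem runClassical_injective (l : List (ClassicalGate ι)) :
    Function.Injective (runClassical l) := by
  induction l with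
  | nil => exact Function.injective_id
  | cons g l ih =>
    exact ih.comp (Function.LeftInverse.injective g.apply_apply)

theorem gateCount_classicalCircuit_le (l : List (ClassicalGate ι)) :
    (classicalCircuit l : Circuit L ι).gateCount ≤ 7 * l.length := by
  induction l with
  | nil => simp [classicalCircuit, Circuit.gateCount]
  | cons g l ih =>
    rw [classicalCircuit, List.flatMap_cons, Circuit.gateCount_append, List.length_cons, mul_add,
      mul_one, add_comm]
    exact add_le_add ih g.gateCount_toCircuit_le

theorem callCount_classicalCircuit (l : List (ClassicalGate ι)) :
    (classicalCircuit l : Circuit L ι).callCount = 0 := by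
  rw [classicalCircuit, Circuit.callCount_flatMap]
  simp [ClassicalGate.callCount_toCircuit]

theorem runClassical_of_forall_target_ne (l : List (ClassicalGate ι)) (x : ι → Fin 2) {i : ι}
    (h : ∀ g ∈ l, i ≠ g.target) : runClassical l x i = x i := by
  induction l generalizing x with
  | nil => rfl
  | cons g l ih =>
    rw [runClassical, ih _ fun g' hg' => h g' (List.mem_cons_of_mem _ hg'),
      g.apply_of_ne _ (h g List.mem_cons_self)]

/-- If no gate is targeted at a source of itself or of an earlier gate, then each wire ends up
with its initial bit plus the increments, computed from the final bits. -/
theorem runClassical_apply (l : List (ClassicalGate ι))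
    (hl : l.Pairwise fun g g' => g'.target ∉ g.sources) (x : ι → Fin 2) (i : ι) :
    runClassical l x i =
      x i + (l.map fun g => if g.target = i then g.increment (runClassical l x) else 0).sum := by
  induction l generalizing x with
  | nil => simp [runClassical]
  | cons g l ih =>
    rw [List.pairwise_cons] at hl
    -- The sources of `g` are changed neither by `g` itself nor by any later gate, so the increment
    -- may as well be read off from the final bits.
    have hinc : g.increment (runClassical l (g.apply x)) = g.increment x := by
      rw [← g.increment_apply x]
      refine g.increment_congr fun a ha => runClassical_of_forall_target_ne l _ ?_
      exact fun g' hg' h => hl.1 g' hg' (h ▸ ha)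
    rw [runClassical, ih hl.2, List.map_cons, List.sum_cons, hinc, ← add_assoc]
    congr 1
    by_cases h : i = g.target
    · subst h
      rw [g.apply_target, if_pos rfl]
    · rw [g.apply_of_ne _ h, if_neg (Ne.symm h), add_zero]

/-- Gates whose sources have smaller rank than their targets can be ordered so that each wire ends
up with its initial bit plus the increments, computed from the final bits. -/
theorem exists_perm_runClassical_apply (rank : ι → ℕ) (l : List (ClassicalGate ι))
    (hl : ∀ g ∈ l, ∀ a ∈ g.sources, rank a < rank g.target) :
    ∃ l' : List (ClassicalGate ι), l'.Perm l ∧ ∀ x i, runClassical l' x i =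
      x i + (l.map fun g => if g.target = i then g.increment (runClassical l' x) else 0).sum := by
  -- After sorting by the rank of the target, a later gate cannot target a source of an earlier one,
  -- since that source has strictly smaller rank. The sum of the increments does not see the order,
  -- so a circuit is specified by an unordered set of gates and analysed through the equations
  -- satisfied by its final bits.
  let r : ClassicalGate ι → ClassicalGate ι → Prop := fun g g' => rank g.target ≤ rank g'.target
  have : DecidableRel r := fun _ _ => inferInstanceAs (Decidable (_ ≤ _))
  have : Std.Total r := ⟨fun _ _ => le_total _ _⟩
  have : IsTrans _ r := ⟨fun _ _ _ => le_trans⟩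
  have hp := List.perm_insertionSort r l
  refine ⟨l.insertionSort r, hp, fun x i => ?_⟩
  rw [← (hp.map _).sum_eq]
  refine runClassical_apply _ ?_ x i
  refine (List.pairwise_insertionSort r l).imp_of_mem fun {g g'} hg _ hr hmem => ?_
  exact absurd hr (not_le.mpr (hl g (hp.mem_iff.mp hg) _ hmem))

variable [Fintype ι] (O : Matrix (Fin (2 ^ L)) (Fin (2 ^ L)) ℂ)

/-- Evaluating at the image point describes the permutation of basis states without naming the
inverse of `runClassical l`. -/
theorem classicalCircuit_mulVec_runClassical (l : List (ClassicalGate ι)) (ψ : (ι → Fin 2) → ℂ)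
    (x : ι → Fin 2) :
    ((classicalCircuit l).eval O *ᵥ ψ) (runClassical l x) = ψ x := by
  induction l generalizing ψ x with
  | nil => simp [classicalCircuit, Circuit.eval, runClassical]
  | cons g l ih =>
    rw [classicalCircuit, List.flatMap_cons, Circuit.eval_append, ← Matrix.mulVec_mulVec]
    refine (ih _ _).trans ?_
    rw [g.eval_toCircuit_mulVec, g.apply_apply]

theorem classicalCircuit_conjTranspose_mulVec
    (hO : O ∈ Matrix.unitaryGroup (Fin (2 ^ L)) ℂ)
    (l : List (ClassicalGate ι)) (ψ : (ι → Fin 2) → ℂ) (x : ι → Fin 2) :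
    (((classicalCircuit l).eval O)ᴴ *ᵥ ψ) x = ψ (runClassical l x) := by
  rw [← classicalCircuit_mulVec_runClassical O l (_ *ᵥ ψ) x, Matrix.mulVec_mulVec,
    Circuit.eval_mul_conjTranspose hO, Matrix.one_mulVec]

end Run

end Classical

/-! ### Permutations of the wires -/

section WirePermutations

variable {L : ℕ} {ι : Type} [Fintype ι] [DecidableEq ι]

/-- The circuit that swaps two wires. -/
noncomputable def swapCircuit (a b : ι) (h : a ≠ b) : Circuit L ι :=
  classicalCircuit [.cnot a b h, .cnot b a h.symm, .cnot a b h]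

theorem swapCircuit_mulVec (O : Matrix (Fin (2 ^ L)) (Fin (2 ^ L)) ℂ) (a b : ι) (h : a ≠ b)
    (ψ : (ι → Fin 2) → ℂ) (x : ι → Fin 2) :
    ((swapCircuit a b h).eval O *ᵥ ψ) x = ψ (x ∘ Equiv.swap a b) := by
  have hrun : runClassical [.cnot a b h, .cnot b a h.symm, .cnot a b h] (x ∘ Equiv.swap a b) = x := by
    simp only [runClassical, ClassicalGate.apply, ClassicalGate.target, ClassicalGate.increment]
    funext i
    by_cases hb : i = b
    · subst hb
      simp only [Function.update_self, Function.update_of_ne h, Function.update_of_ne h.symm,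
        Function.comp_apply, Equiv.swap_apply_left, Equiv.swap_apply_right]
      generalize x a = u
      generalize x i = v
      revert u v
      decide
    · by_cases ha : i = a
      · subst ha
        simp only [Function.update_self, Function.update_of_ne h, Function.update_of_ne h.symm,
          Function.comp_apply, Equiv.swap_apply_left, Equiv.swap_apply_right]
        generalize x b = u
        generalize x i = v
        revert u v
        decide
      · simp [Function.update_of_ne ha, Function.update_of_ne hb,
          Equiv.swap_apply_of_ne_of_ne ha hb]
  conv_lhs => rw [← hrun]
  exact classicalCircuit_mulVec_runClassical O _ ψ _

/-- Composing `σ` with the swap of `a` and `σ a` makes `a` a fixed point, so one swap per wire is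
enough. A swap is three CNOTs, each counted with the uniform bound `7` for classical gates, whence
`21`. -/
theorem exists_circuit_wirePerm (σ : Equiv.Perm ι) :
    ∃ W : Circuit L ι, W.gateCount ≤ 21 * Fintype.card ι ∧ W.callCount = 0 ∧
      ∀ (O : Matrix (Fin (2 ^ L)) (Fin (2 ^ L)) ℂ) (ψ : (ι → Fin 2) → ℂ) (x : ι → Fin 2),
        (W.eval O *ᵥ ψ) x = ψ (x ∘ σ) := by
  have key (l : List ι) (σ : Equiv.Perm ι) (hl : ∀ i, σ i ≠ i → i ∈ l) :
      ∃ W : Circuit L ι, W.gateCount ≤ 21 * l.length ∧ W.callCount = 0 ∧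
        ∀ (O : Matrix (Fin (2 ^ L)) (Fin (2 ^ L)) ℂ) (ψ : (ι → Fin 2) → ℂ) (x : ι → Fin 2),
          (W.eval O *ᵥ ψ) x = ψ (x ∘ σ) := by
    induction l generalizing σ with
    | nil =>
      have : σ = 1 := Equiv.ext fun i => by_contra fun h => List.not_mem_nil (hl i h)
      subst this
      exact ⟨[], by simp [Circuit.gateCount], by simp [Circuit.callCount], fun O ψ x => by
        simp [Circuit.eval]⟩
    | cons a l ih =>
      by_cases ha : σ a = a
      · obtain ⟨W, hW, h⟩ := ih σ fun i hi =>
          (List.mem_cons.mp (hl i hi)).resolve_left fun h => hi (h ▸ ha)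
        exact ⟨W, hW.trans (by simp), h⟩
      · obtain ⟨W, hW, hW0, h⟩ := ih (Equiv.swap a (σ a) * σ) fun i hi => by
          have hia : i ≠ a := by
            rintro rfl
            simp at hi
          refine (List.mem_cons.mp (hl i fun hσ => hi ?_)).resolve_left hia
          rw [Equiv.Perm.mul_apply, hσ]
          refine Equiv.swap_apply_of_ne_of_ne hia fun h => hia ?_
          rw [h] at hσ
          rw [h]
          exact σ.injective hσ
        refine ⟨W ++ swapCircuit a (σ a) (Ne.symm ha), ?_, ?_, fun O ψ x => ?_⟩
        · have := gateCount_classicalCircuit_le (L := L) [ClassicalGate.cnot a (σ a) (Ne.symm ha),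
            .cnot (σ a) a ha, .cnot a (σ a) (Ne.symm ha)]
          rw [Circuit.gateCount_append, List.length_cons, mul_add]
          exact add_le_add hW this
        · rw [Circuit.callCount_append, hW0, swapCircuit, callCount_classicalCircuit]
        · rw [Circuit.eval_append, ← Matrix.mulVec_mulVec, swapCircuit_mulVec, h]
          congr 1
          funext i
          simp
  obtain ⟨W, hW, h⟩ := key Finset.univ.toList σ fun i _ => by simp
  exact ⟨W, by simpa using hW, h⟩

end WirePermutations

/-! ### The quantum Fourier transform -/

section FourierCircuit

variable {L : ℕ}

/-- The number written in binary, the least significant bit first. -/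
def binaryValue {n : ℕ} (x : Fin n → Fin 2) : ℕ := ∑ i, (x i : ℕ) * 2 ^ (i : ℕ)

theorem toNumber_val {n : ℕ} (x : Fin n → Fin 2) : (toNumber n x : ℕ) = binaryValue x :=
  finFunctionFinEquiv_apply x

theorem binaryValue_snoc {n : ℕ} (x : Fin (n + 1) → Fin 2) :
    binaryValue x = binaryValue (fun i : Fin n => x i.castSucc) + x (Fin.last n) * 2 ^ n := by
  simp [binaryValue, Fin.sum_univ_castSucc]

theorem binaryValue_rev {n : ℕ} (x : Fin (n + 1) → Fin 2) :
    binaryValue (x ∘ Fin.rev) =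
      x (Fin.last n) + 2 * binaryValue ((fun i : Fin n => x i.castSucc) ∘ Fin.rev) := by
  simp only [binaryValue, Fin.sum_univ_succ, Function.comp_apply, Fin.rev_zero, Fin.val_zero,
    pow_zero, mul_one, Finset.mul_sum, Fin.val_succ, pow_succ, Fin.rev_succ]
  congr 1
  exact Finset.sum_congr rfl fun i _ => by ring

/-- The circuit for the Fourier transform up to the reversal of the wires. -/
noncomputable def fourierCore (L : ℕ) : (n : ℕ) → Circuit L (Fin n)
  | 0 => []
  | n + 1 => oneGate (Fin.last n) hadamard ::
      ((List.finRange n).map (fun a : Fin n => ctrlGate a.castSucc (Fin.last n) a.castSucc_lt_last.ne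
        (phaseUnitary (2 * Real.pi * 2 ^ (a : ℕ) / 2 ^ (n + 1)))) ++
      Circuit.mapWires Fin.castSuccEmb (fourierCore L n))

theorem gateCount_fourierCore_le (n : ℕ) : (fourierCore L n).gateCount ≤ n ^ 2 := by
  induction n with
  | zero => simp [fourierCore, Circuit.gateCount]
  | succ n ih =>
    have h1 : Circuit.gateCount (L := L) ((List.finRange n).map (fun a : Fin n => ctrlGate a.castSucc
        (Fin.last n) a.castSucc_lt_last.ne
        (phaseUnitary (2 * Real.pi * 2 ^ (a : ℕ) / 2 ^ (n + 1))))) ≤ n :=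
      List.countP_le_length.trans (by simp)
    have h2 : Circuit.gateCount [(oneGate (Fin.last n) hadamard : Gate L (Fin (n + 1)))] ≤ 1 :=
      List.countP_le_length
    rw [fourierCore, ← List.singleton_append, Circuit.gateCount_append, Circuit.gateCount_append,
      Circuit.gateCount_mapWires]
    nlinarith

theorem callCount_fourierCore (n : ℕ) : (fourierCore L n).callCount = 0 := by
  induction n with
  | zero => simp [fourierCore, Circuit.callCount]
  | succ n ih =>
    rw [fourierCore, ← List.singleton_append, Circuit.callCount_append, Circuit.callCount_append,
      Circuit.callCount_mapWires, ih]
    simp [Circuit.callCount, oneGate, ctrlGate, Gate.isCall]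

/-- The matrix of `fourierCore`. -/
noncomputable def fourierKernel {n : ℕ} (x y : Fin n → Fin 2) : ℂ :=
  ((Real.sqrt 2 : ℝ) : ℂ)⁻¹ ^ n * Complex.exp (2 * Real.pi * Complex.I *
    binaryValue y * binaryValue (x ∘ Fin.rev) / 2 ^ n)

theorem hadamard_apply_exp (b c : Fin 2) :
    hadamard.1 b c = ((Real.sqrt 2 : ℝ) : ℂ)⁻¹ *
      Complex.exp (Real.pi * Complex.I * (b : ℕ) * (c : ℕ)) := by
  rw [hadamard_apply]
  rcases fin_two_eq_zero_or_one b with h | h <;>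
    rcases fin_two_eq_zero_or_one c with h' | h' <;> simp [h, h']

/-- Write `y = u + c 2^n` and the reversed `x` as `b + 2v`. Then `y (b + 2v) / 2^{n+1} = uv/2^n +
bu/2^{n+1} + bc/2 + cv`: the smaller transform, the controlled phases, the Hadamard gate, and an
integer that the exponential ignores. -/
theorem fourierKernel_snoc {n : ℕ} (x y : Fin (n + 1) → Fin 2) :
    fourierKernel x y =
      fourierKernel (fun i : Fin n => x i.castSucc) (fun i => y i.castSucc) *
        (Complex.exp (∑ a : Fin n, (((y a.castSucc : ℕ) * (x (Fin.last n) : ℕ) : ℕ) : ℂ) *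
          (((2 * Real.pi * 2 ^ (a : ℕ) / 2 ^ (n + 1) : ℝ) : ℂ) * Complex.I)) *
        hadamard.1 (x (Fin.last n)) (y (Fin.last n))) := by
  have hsum : ∑ a : Fin n, (((y a.castSucc : ℕ) * (x (Fin.last n) : ℕ) : ℕ) : ℂ) *
      (((2 * Real.pi * 2 ^ (a : ℕ) / 2 ^ (n + 1) : ℝ) : ℂ) * Complex.I) =
      2 * Real.pi * Complex.I * (x (Fin.last n) : ℕ) *
        binaryValue (fun i : Fin n => y i.castSucc) / 2 ^ (n + 1) := by
    rw [binaryValue, Nat.cast_sum, Finset.mul_sum, Finset.sum_div]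
    refine Finset.sum_congr rfl fun a _ => ?_
    push_cast
    ring
  rw [hsum, hadamard_apply_exp, fourierKernel, fourierKernel, binaryValue_snoc y, binaryValue_rev x]
  set u := binaryValue fun i : Fin n => y i.castSucc
  set v := binaryValue ((fun i : Fin n => x i.castSucc) ∘ Fin.rev)
  set b : ℕ := (x (Fin.last n)).val
  set c : ℕ := (y (Fin.last n)).val
  have harg : 2 * (Real.pi : ℂ) * Complex.I * ((u + c * 2 ^ n : ℕ) : ℂ) * ((b + 2 * v : ℕ) : ℂ) /
      2 ^ (n + 1) = 2 * Real.pi * Complex.I * u * v / 2 ^ n +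
      (2 * Real.pi * Complex.I * b * u / 2 ^ (n + 1) + Real.pi * Complex.I * b * c) +
      ((c * v : ℕ) : ℂ) * (2 * Real.pi * Complex.I) := by
    push_cast
    field_simp
    ring
  rw [harg, Complex.exp_add, Complex.exp_nat_mul_two_pi_mul_I, Complex.exp_add, Complex.exp_add]
  ring

/-- Induction on the number of qubits: the highest input bit is transformed by the Hadamard gate and
the phases, after which its wire carries the lowest bit of the output. This is why the outputs come
in reversed order. -/
theorem eval_fourierCore (O : Matrix (Fin (2 ^ L)) (Fin (2 ^ L)) ℂ) (n : ℕ) :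
    (fourierCore L n).eval O = Matrix.of fourierKernel := by
  induction n with
  | zero =>
    ext x y
    simp [fourierCore, Circuit.eval, fourierKernel, binaryValue, Subsingleton.elim x y]
  | succ n ih =>
    refine Matrix.ext_of_mulVec_single fun z => ?_
    generalize (Pi.single z 1 : (Fin (n + 1) → Fin 2) → ℂ) = ψ
    funext x
    rw [fourierCore, ← List.singleton_append, Circuit.eval_append, Circuit.eval_append,
      Circuit.eval_singleton, Circuit.eval_mapWires, ih, ← Matrix.mulVec_mulVec,
      ← Matrix.mulVec_mulVec, onWires_mulVec]
    rw [Matrix.mulVec, dotProduct, ← (Fin.snocEquiv fun _ => Fin 2).sum_comp,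
      Fintype.sum_prod_type_right]
    refine Finset.sum_congr rfl fun s _ => ?_
    rw [Circuit.eval_mulVec_of_diagonal O _ _ _ fun a _ ψ x => ctrlGate_phase_mulVec O _ _ _ _ ψ x,
      oneGate_mulVec, Finset.mul_sum, Finset.mul_sum]
    refine Finset.sum_congr rfl fun b _ => ?_
    have hlast : Function.extend (Fin.castSuccEmb) s x (Fin.last n) =
        x (Fin.last n) :=
      Function.extend_apply' _ _ _ fun ⟨a, ha⟩ => a.castSucc_lt_last.ne ha
    have hcast (a : Fin n) : Function.extend (Fin.castSuccEmb) s x a.castSucc = s a :=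
      (Fin.castSuccEmb.injective).extend_apply s x a
    have hupd : Function.update (Function.extend (Fin.castSuccEmb) s x) (Fin.last n) b =
        Fin.snoc (α := fun _ => Fin 2) s b := by
      funext i
      refine Fin.lastCases ?_ (fun a => ?_) i
      · simp
      · rw [Function.update_of_ne a.castSucc_lt_last.ne, hcast, Fin.snoc_castSucc]
    have hk := fourierKernel_snoc x (Fin.snoc (α := fun _ => Fin 2) s b)
    simp only [Fin.snoc_castSucc, Fin.snoc_last] at hk
    symm
    change fourierKernel x (Fin.snoc (α := fun _ => Fin 2) s b) *
      ψ (Fin.snoc (α := fun _ => Fin 2) s b) = _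
    rw [hupd, hlast, hk]
    simp only [hcast, ← List.ofFn_eq_map, List.sum_ofFn, Matrix.of_apply]
    rw [mul_assoc, mul_assoc]
    rfl

theorem sqrt_two_pow_cast (n : ℕ) :
    ((Real.sqrt ((2 ^ n : ℕ) : ℝ) : ℝ) : ℂ) = ((Real.sqrt 2 : ℝ) : ℂ) ^ n := by
  rw [← Complex.ofReal_pow]
  congr 1
  rw [Real.sqrt_eq_iff_mul_self_eq (by positivity) (by positivity), ← mul_pow,
    Real.mul_self_sqrt zero_le_two]
  push_cast
  rfl

theorem exists_fourierCircuit (L n : ℕ) : ∃ W : Circuit L (Fin n),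
    W.gateCount ≤ n ^ 2 + 21 * n ∧ W.callCount = 0 ∧
      ∀ O, W.eval O = onQubits (fourierMatrix (2 ^ n)) := by
  obtain ⟨W, hW, hW0, h⟩ := exists_circuit_wirePerm (L := L) (Fin.revPerm : Equiv.Perm (Fin n))
  refine ⟨fourierCore L n ++ W, ?_, ?_, fun O => ?_⟩
  · rw [Circuit.gateCount_append]
    exact add_le_add (gateCount_fourierCore_le n) (by simpa using hW)
  · rw [Circuit.callCount_append, callCount_fourierCore, hW0]
  · refine Matrix.ext_of_mulVec_single fun y => ?_
    funext x
    rw [Circuit.eval_append, ← Matrix.mulVec_mulVec, h, eval_fourierCore, Matrix.mulVec_single_one,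
      Matrix.mulVec_single_one]
    change fourierKernel _ y = fourierMatrix (2 ^ n) (toNumber n x) (toNumber n y)
    have hr : (x ∘ (Fin.revPerm : Equiv.Perm (Fin n))) ∘ Fin.rev = x := by
      funext i
      simp
    rw [fourierKernel, fourierMatrix, Matrix.of_apply, hr, toNumber_val, toNumber_val,
      sqrt_two_pow_cast, inv_pow, mul_comm, div_eq_mul_inv]
    push_cast
    rfl

/-- Unitarity is inherited from the circuit, whose gates are unitary, so orthogonality of characters
is not needed. The oracle is irrelevant and taken to be trivial. -/
theorem fourierMatrix_mem_unitaryGroup (n : ℕ) :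
    fourierMatrix (2 ^ n) ∈ Matrix.unitaryGroup (Fin (2 ^ n)) ℂ := by
  obtain ⟨W, -, -, h⟩ := exists_fourierCircuit 0 n
  have hW := W.eval_mul_conjTranspose (O := 1) (one_mem _)
  rw [h, ← onQubits_conjTranspose, ← onQubits_mul, ← onQubits_one] at hW
  rw [Matrix.mem_unitaryGroup_iff]
  ext i j
  have := congrFun (congrFun hW ((toNumber n).symm i)) ((toNumber n).symm j)
  simp only [onQubits, Matrix.submatrix_apply] at this
  rwa [(toNumber n).apply_symm_apply, (toNumber n).apply_symm_apply] at this

end FourierCircuit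

/-! ### The walk operator -/

section Walk

variable {L : ℕ}

/-- The ancillas of the walk operator: a flag, a work register of `L` qubits for the state prepared
by the oracle, and the wires on which it is tested whether all of them are zero. -/
inductive WalkAncilla (L : ℕ) : Type
  | flag : WalkAncilla L
  | work (i : Fin L) : WalkAncilla L
  | chain (i : Fin (L + 2)) : WalkAncilla L
  deriving DecidableEq, Fintype

/-- The wires of the walk operator: the main register and the ancillas. -/
abbrev WalkWire (L : ℕ) : Type := Fin L ⊕ WalkAncilla L

/-- The wire of the flag. -/
abbrev flagWire (L : ℕ) : WalkWire L := Sum.inr .flag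

/-- The wires of the work register. -/
abbrev workWire {L : ℕ} (i : Fin L) : WalkWire L := Sum.inr (.work i)

/-- The wires of the test for zero. -/
abbrev chainWire {L : ℕ} (i : Fin (L + 2)) : WalkWire L := Sum.inr (.chain i)

/-- The wires that are tested for zero. -/
def testedWire {L : ℕ} (i : Fin (L + 1)) : WalkWire L := Fin.cases (flagWire L) workWire i

theorem testedWire_ne_chainWire (i : Fin (L + 1)) (j : Fin (L + 2)) :
    testedWire i ≠ chainWire j := by
  refine Fin.cases ?_ (fun i => ?_) i <;> simp [testedWire]

/-- The order in which the wires of the test for zero are computed. -/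
def walkRank : WalkWire L → ℕ
  | Sum.inr (.chain i) => i + 1
  | _ => 0

theorem walkRank_testedWire (i : Fin (L + 1)) : walkRank (testedWire i) = 0 := by
  refine Fin.cases ?_ (fun i => ?_) i <;> rfl

/-- The chain is computed by `h_0 = 1` and `h_{i+1} = h_i + h_i z_i = h_i (1 - z_i)` modulo two,
where `z_i` is the tested bit. Thus `h_j = 1` means that the first `j` tested bits vanish. Adding
`h_i` by a separate CNOT avoids negating the inputs. -/
theorem exists_zeroTest (L : ℕ) : ∃ l : List (ClassicalGate (WalkWire L)),
    l.length ≤ 2 * L + 3 ∧ (∀ g ∈ l, ∃ j, g.target = chainWire j) ∧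
      ∀ x : WalkWire L → Fin 2, (∀ j, x (chainWire j) = 0) →
        (runClassical l x (chainWire (Fin.last _)) = 1 ↔ ∀ i, x (testedWire i) = 0) := by
  let f (i : Fin (L + 1)) : ClassicalGate (WalkWire L) :=
    .cnot (chainWire i.castSucc) (chainWire i.succ) (by simp [Fin.ext_iff])
  let g (i : Fin (L + 1)) : ClassicalGate (WalkWire L) :=
    .toffoli (chainWire i.castSucc) (testedWire i) (chainWire i.succ)
      (testedWire_ne_chainWire i _).symm (by simp [Fin.ext_iff]) (testedWire_ne_chainWire i _)
  let l₀ : List (ClassicalGate (WalkWire L)) :=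
    .not (chainWire 0) :: ((List.finRange _).map f ++ (List.finRange _).map g)
  have hrank : ∀ h ∈ l₀, ∀ a ∈ h.sources, walkRank a < walkRank h.target := by
    intro h hh a ha
    simp only [l₀, List.mem_cons, List.mem_append, List.mem_map] at hh
    rcases hh with rfl | ⟨i, -, rfl⟩ | ⟨i, -, rfl⟩
    · simp [ClassicalGate.sources] at ha
    · simp only [f, ClassicalGate.sources, List.mem_singleton] at ha
      subst ha
      simp [f, ClassicalGate.target, walkRank]
    · simp only [g, ClassicalGate.sources, List.mem_cons, List.not_mem_nil, or_false] at ha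
      rcases ha with rfl | rfl
      · simp [g, ClassicalGate.target, walkRank]
      · rw [walkRank_testedWire]
        simp [g, ClassicalGate.target, walkRank]
  obtain ⟨l, hperm, hrun⟩ := exists_perm_runClassical_apply walkRank l₀ hrank
  have htarget : ∀ h ∈ l, ∃ j, h.target = chainWire j := by
    intro h hh
    have hh := hperm.mem_iff.mp hh
    simp only [l₀, List.mem_cons, List.mem_append, List.mem_map] at hh
    rcases hh with rfl | ⟨i, -, rfl⟩ | ⟨i, -, rfl⟩
    exacts [⟨_, rfl⟩, ⟨_, rfl⟩, ⟨_, rfl⟩]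
  refine ⟨l, ?_, htarget, fun x hx => ?_⟩
  · rw [hperm.length_eq]
    simp [l₀]
    omega
  have htested (i : Fin (L + 1)) : runClassical l x (testedWire i) = x (testedWire i) := by
    refine runClassical_of_forall_target_ne l x fun h hh => ?_
    obtain ⟨j, hj⟩ := htarget h hh
    rw [hj]
    exact testedWire_ne_chainWire i j
  have hsum (h : Fin (L + 1) → Fin 2) : ((List.finRange _).map h).sum = ∑ i, h i := by
    rw [← List.ofFn_eq_map, List.sum_ofFn]
  have hzero : runClassical l x (chainWire 0) = 1 := by
    rw [hrun, hx]
    simp only [l₀, f, g, List.map_cons, List.map_append, List.map_map, List.sum_cons,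
      List.sum_append, hsum, Function.comp_def, ClassicalGate.target, ClassicalGate.increment]
    simp
  have hsucc (i : Fin (L + 1)) : runClassical l x (chainWire i.succ) =
      runClassical l x (chainWire i.castSucc) +
        runClassical l x (chainWire i.castSucc) * x (testedWire i) := by
    rw [hrun, hx, ← htested i]
    simp only [l₀, f, g, List.map_cons, List.map_append, List.map_map, List.sum_cons,
      List.sum_append, hsum, Function.comp_def, ClassicalGate.target, ClassicalGate.increment]
    simp [(Fin.succ_ne_zero i).symm]
  have key (j : Fin (L + 2)) : runClassical l x (chainWire j) = 1 ↔
      ∀ i : Fin (L + 1), i.castSucc < j → x (testedWire i) = 0 := by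
    refine Fin.induction ?_ (fun j ih => ?_) j
    · simp [hzero]
    · have hiff : (∀ i : Fin (L + 1), i.castSucc < j.succ → x (testedWire i) = 0) ↔
          (∀ i : Fin (L + 1), i.castSucc < j.castSucc → x (testedWire i) = 0) ∧
            x (testedWire j) = 0 := by
        constructor
        · exact fun h => ⟨fun i hi => h i (hi.trans Fin.castSucc_lt_succ), h j Fin.castSucc_lt_succ⟩
        · rintro ⟨h1, h2⟩ i hi
          rcases (Fin.castSucc_lt_succ_iff.mp hi).lt_or_eq with h | h
          · exact h1 i (Fin.castSucc_lt_castSucc_iff.mpr h)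
          · rw [h, h2]
      rw [hiff, ← ih, hsucc]
      generalize runClassical l x (chainWire j.castSucc) = u
      generalize x (testedWire j) = v
      revert u v
      decide
  rw [key]
  simp [Fin.castSucc_lt_last]

/-- The wires on which the controlled oracle is called. -/
def oracleWires (L : ℕ) : Option (Fin L) ↪ WalkWire L :=
  ⟨fun o => o.elim (flagWire L) workWire, by
    intro o o' h
    cases o <;> cases o' <;> simp_all⟩

@[simp]
theorem oracleWires_none : oracleWires L none = flagWire L := rfl

@[simp]
theorem oracleWires_some (i : Fin L) : oracleWires L (some i) = workWire i := rfl

/-- The gates that multiply by `exp (2πi jk / N)`, for `k` in the main register and `j` in the work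
register. -/
noncomputable def fourierPhases (L : ℕ) : Circuit L (WalkWire L) :=
  (Finset.univ : Finset (Fin L × Fin L)).toList.map fun p =>
    ctrlGate (Sum.inl p.1) (workWire p.2) (by simp)
      (phaseUnitary (2 * Real.pi * 2 ^ ((p.1 : ℕ) + p.2) / 2 ^ L))

/-- The circuit that prepares the state on which the walk operator acts. -/
noncomputable def walkPreparation (L : ℕ) : Circuit L (WalkWire L) :=
  [oneGate (flagWire L) hadamard] ++ [.oracle (oracleWires L)] ++ fourierPhases L ++
    [oneGate (flagWire L) pauliX] ++
    (List.finRange L).map fun i => ctrlGate (flagWire L) (workWire i) (by simp) hadamard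

theorem gateCount_walkPreparation_le : (walkPreparation L).gateCount ≤ L ^ 2 + L + 2 := by
  have h1 : (fourierPhases L).gateCount ≤ L ^ 2 :=
    List.countP_le_length.trans (by simp [fourierPhases, sq])
  have h2 : Circuit.gateCount (L := L) ((List.finRange L).map fun i => ctrlGate (flagWire L)
      (workWire i) (by simp) hadamard) ≤ L := List.countP_le_length.trans (by simp)
  simp only [walkPreparation, Circuit.gateCount_append]
  have h3 (G : Matrix.unitaryGroup (Fin 2) ℂ) :
      Circuit.gateCount [(oneGate (flagWire L) G : Gate L (WalkWire L))] = 1 := rfl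
  have h4 : Circuit.gateCount [(.oracle (oracleWires L) : Gate L (WalkWire L))] = 0 := rfl
  rw [h3, h3, h4]
  omega

theorem callCount_walkPreparation : (walkPreparation L).callCount = 1 := by
  simp [walkPreparation, fourierPhases, Circuit.callCount, oneGate, ctrlGate,
    Gate.isCall, Function.comp_def]

/-- Multiplying out the binary expansions of `j` and `k` turns the phase into one controlled phase
gate for each pair of bits. -/
theorem fourierPhases_mulVec (O : Matrix (Fin (2 ^ L)) (Fin (2 ^ L)) ℂ)
    (ψ : (WalkWire L → Fin 2) → ℂ) (x : WalkWire L → Fin 2) :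
    ((fourierPhases L).eval O *ᵥ ψ) x = Complex.exp (2 * Real.pi * Complex.I *
      binaryValue (x ∘ workWire) * binaryValue (x ∘ Sum.inl) / 2 ^ L) * ψ x := by
  rw [fourierPhases, Circuit.eval_mulVec_of_diagonal O _ _ _
    fun p _ ψ x => ctrlGate_phase_mulVec O _ _ _ _ ψ x]
  congr 2
  rw [Finset.sum_map_toList, Fintype.sum_prod_type, binaryValue, binaryValue, mul_assoc _ (Nat.cast _),
    ← Nat.cast_mul, mul_comm (∑ i, _ : ℕ), Finset.sum_mul_sum, Nat.cast_sum, Finset.mul_sum,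
    Finset.sum_div]
  refine Finset.sum_congr rfl fun i _ => ?_
  rw [Nat.cast_sum, Finset.mul_sum, Finset.sum_div]
  refine Finset.sum_congr rfl fun j _ => ?_
  simp only [Function.comp_apply]
  push_cast
  ring

/-- The basis state with `κ` in the main register and zeros elsewhere. -/
def walkBasis (κ : Fin L → Fin 2) : WalkWire L → Fin 2 := Sum.elim κ 0

/-- The bit string has `κ` in the main register, and zeros on the wires of the test for zero. -/
def IsWalkSector (κ : Fin L → Fin 2) (x : WalkWire L → Fin 2) : Prop :=
  x ∘ Sum.inl = κ ∧ ∀ j, x (chainWire j) = 0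

theorem isWalkSector_update {κ : Fin L → Fin 2} {x : WalkWire L → Fin 2} {q : WalkWire L}
    (b : Fin 2) (hq : ∀ i, q ≠ Sum.inl i) (hq' : ∀ j, q ≠ chainWire j) :
    IsWalkSector κ (Function.update x q b) ↔ IsWalkSector κ x := by
  unfold IsWalkSector
  refine and_congr (Eq.congr_left ?_) (forall_congr' fun j => ?_)
  · funext i
    exact Function.update_of_ne (hq i).symm _ _
  · rw [Function.update_of_ne (hq' j).symm]

theorem eq_walkBasis_iff {κ : Fin L → Fin 2} {x : WalkWire L → Fin 2} :
    x = walkBasis κ ↔ IsWalkSector κ x ∧ x (flagWire L) = 0 ∧ ∀ i, x (workWire i) = 0 := by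
  constructor
  · rintro rfl
    exact ⟨⟨rfl, fun _ => rfl⟩, rfl, fun _ => rfl⟩
  · rintro ⟨⟨h1, h2⟩, h3, h4⟩
    funext w
    rcases w with i | i | i | i
    exacts [congrFun h1 i, h3, h4 i, h2 i]

open Classical in
/-- The state prepared by `walkPreparation`. -/
noncomputable def walkState (c : EuclideanSpace ℂ (Fin (2 ^ L))) (κ : Fin L → Fin 2)
    (x : WalkWire L → Fin 2) : ℂ :=
  if IsWalkSector κ x then
    ((Real.sqrt 2 : ℝ) : ℂ)⁻¹ * (if x (flagWire L) = 1 then ((Real.sqrt 2 : ℝ) : ℂ)⁻¹ ^ L else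
      Complex.exp (2 * Real.pi * Complex.I * binaryValue (x ∘ workWire) * binaryValue κ / 2 ^ L) *
        c (toNumber L (x ∘ workWire)))
  else 0

open Classical in
theorem oneGate_hadamard_walkBasis (O : Matrix (Fin (2 ^ L)) (Fin (2 ^ L)) ℂ) (κ : Fin L → Fin 2)
    (x : WalkWire L → Fin 2) :
    ((oneGate (flagWire L) hadamard : Gate L (WalkWire L)).eval O *ᵥ Pi.single (walkBasis κ) 1) x =
      if IsWalkSector κ x ∧ ∀ i, x (workWire i) = 0 then ((Real.sqrt 2 : ℝ) : ℂ)⁻¹ else 0 := by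
  rw [oneGate_mulVec, Fin.sum_univ_two]
  have h (b : Fin 2) : (Pi.single (walkBasis κ) 1 : (WalkWire L → Fin 2) → ℂ)
      (Function.update x (flagWire L) b) =
      if IsWalkSector κ x ∧ b = 0 ∧ ∀ i, x (workWire i) = 0 then 1 else 0 := by
    rw [Pi.single_apply]
    refine if_congr ?_ rfl rfl
    rw [eq_walkBasis_iff, isWalkSector_update _ (by simp) (by simp)]
    simp
  rw [h, h]
  simp [hadamard_apply]

open Classical in
theorem oracle_mulVec_walk {O : Matrix (Fin (2 ^ L)) (Fin (2 ^ L)) ℂ}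
    {c : EuclideanSpace ℂ (Fin (2 ^ L))} (hO : ∀ j, O j 0 = c j) (κ : Fin L → Fin 2) (a : ℂ)
    (x : WalkWire L → Fin 2) :
    ((Gate.oracle (oracleWires L)).eval O *ᵥ
      fun x => if IsWalkSector κ x ∧ ∀ i, x (workWire i) = 0 then a else 0) x =
      if IsWalkSector κ x then (if x (flagWire L) = 1 then c (toNumber L (x ∘ workWire)) else
        if ∀ i, x (workWire i) = 0 then 1 else 0) * a else 0 := by
  change (onWires (oracleWires L) _ *ᵥ _) x = _
  rw [onWires_mulVec]
  let s₀ : Option (Fin L) → Fin 2 := fun o => o.elim (x (flagWire L)) 0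
  have hw (s : Option (Fin L) → Fin 2) (i : Fin L) :
      Function.extend (oracleWires L) s x (workWire i) = s (some i) :=
    (oracleWires L).injective.extend_apply s x (some i)
  have hsec (s : Option (Fin L) → Fin 2) :
      IsWalkSector κ (Function.extend (oracleWires L) s x) ↔ IsWalkSector κ x := by
    unfold IsWalkSector
    refine and_congr (Eq.congr_left ?_) (forall_congr' fun j => ?_)
    · funext i
      refine Function.extend_apply' _ _ _ ?_
      rintro ⟨_ | _, h⟩ <;> exact Sum.inr_ne_inl h
    · rw [Function.extend_apply']
      rintro ⟨_ | _, h⟩ <;> simp at h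
  rw [Finset.sum_eq_single s₀]
  · simp only [hw, hsec]
    have hc : controlled (onQubits O) (x ∘ oracleWires L) s₀ =
        if x (flagWire L) = 1 then c (toNumber L (x ∘ workWire)) else
        if ∀ i, x (workWire i) = 0 then 1 else 0 := by
      have h0 : toNumber L (s₀ ∘ some) = 0 := by
        refine Fin.ext ?_
        rw [toNumber_val]
        simp [binaryValue, s₀]
      rw [controlled, Matrix.of_apply, if_pos (by rfl)]
      refine if_congr Iff.rfl ?_ ?_
      · rw [onQubits, Matrix.submatrix_apply, h0, hO]
        rfl
      · rw [Matrix.one_apply]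
        exact if_congr funext_iff rfl rfl
    rw [hc]
    by_cases h : IsWalkSector κ x <;> simp [h, s₀]
  · intro s _ hs
    by_cases h1 : s none = x (flagWire L)
    · have h2 : ¬ ∀ i, s (some i) = 0 := by
        intro h
        refine hs (funext fun o => ?_)
        cases o with
        | none => exact h1
        | some i => exact h i
      simp [hw, h2]
    · rw [controlled, Matrix.of_apply, if_neg, zero_mul]
      exact fun h => h1 h.symm
  · simp

open Classical in
-- Each controlled Hadamard gate spreads one more work wire uniformly, in the branch with flag one
-- only. The induction records that the wires not yet reached are still zero.
theorem ctrlHadamards_mulVec (O : Matrix (Fin (2 ^ L)) (Fin (2 ^ L)) ℂ) (κ : Fin L → Fin 2) (a : ℂ)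
    (ψ : (WalkWire L → Fin 2) → ℂ)
    (hψ : ∀ x, x (flagWire L) = 1 →
      ψ x = if IsWalkSector κ x ∧ ∀ i, x (workWire i) = 0 then a else 0)
    (l : List (Fin L)) (hl : l.Nodup) (x : WalkWire L → Fin 2) :
    (Circuit.eval O (l.map fun i => (ctrlGate (flagWire L) (workWire i) (by simp) hadamard :
      Gate L (WalkWire L))) *ᵥ ψ) x =
      if x (flagWire L) = 1 then
        if IsWalkSector κ x ∧ ∀ i ∉ l, x (workWire i) = 0 then
          ((Real.sqrt 2 : ℝ) : ℂ)⁻¹ ^ l.length * a else 0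
      else ψ x := by
  induction l using List.reverseRecOn generalizing x with
  | nil =>
    by_cases h1 : x (flagWire L) = 1
    · simp [Circuit.eval, h1, hψ x h1]
    · simp [Circuit.eval, h1]
  | append_singleton l i ih =>
    have hi : i ∉ l := by
      rw [List.nodup_append] at hl
      exact fun h => hl.2.2 i h i (by simp) rfl
    have hl' : l.Nodup := (List.nodup_append.mp hl).1
    rw [List.map_append, List.map_singleton, Circuit.eval_append, ← Matrix.mulVec_mulVec,
      Circuit.eval_singleton, ctrlGate_mulVec, ih hl']
    by_cases hf : x (flagWire L) = 1
    · rw [if_pos hf, if_pos hf, Fin.sum_univ_two]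
      simp only [ih hl', isWalkSector_update (q := workWire i) _ (by simp) (by simp)]
      have hf' (b : Fin 2) : Function.update x (workWire i) b (flagWire L) = 1 := by
        rw [Function.update_of_ne (by simp), hf]
      have h0 : (∀ j ∉ l, Function.update x (workWire i) 0 (workWire j) = 0) ↔
          ∀ j ∉ l ++ [i], x (workWire j) = 0 := by
        refine forall_congr' fun j => ?_
        by_cases hj : j = i
        · simp [hj]
        · simp [hj, Function.update_of_ne]
      have h1 : ¬ ∀ j ∉ l, Function.update x (workWire i) 1 (workWire j) = 0 :=
        fun h => by simpa using h i hi
      rw [if_pos (hf' 0), if_pos (hf' 1), hadamard_apply, hadamard_apply]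
      simp only [h0, h1, and_false, if_false, mul_zero, add_zero, List.length_append,
        List.length_singleton, pow_succ]
      split_ifs <;> simp_all [mul_comm, mul_left_comm]
    · rw [if_neg hf, if_neg hf, if_neg hf]

/-- The Hadamard gate on the flag creates two branches. The oracle loads `c` where the flag is one,
and the Fourier phases act only there because `j = 0` in the other branch. Flipping the flag then
lets the controlled Hadamard gates reach the branch whose work register is still zero, so one
controlled oracle call suffices. -/
theorem walkPreparation_mulVec {O : Matrix (Fin (2 ^ L)) (Fin (2 ^ L)) ℂ}
    {c : EuclideanSpace ℂ (Fin (2 ^ L))} (hO : ∀ j, O j 0 = c j) (κ : Fin L → Fin 2) :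
    (walkPreparation L).eval O *ᵥ Pi.single (walkBasis κ) 1 = walkState c κ := by
  classical
  have h1 : (oneGate (flagWire L) hadamard : Gate L (WalkWire L)).eval O *ᵥ
      Pi.single (walkBasis κ) 1 = fun x => if IsWalkSector κ x ∧ ∀ i, x (workWire i) = 0
        then ((Real.sqrt 2 : ℝ) : ℂ)⁻¹ else 0 :=
    funext (oneGate_hadamard_walkBasis O κ)
  funext x
  simp only [walkPreparation, Circuit.eval_append, Circuit.eval_singleton, ← Matrix.mulVec_mulVec]
  rw [h1, funext (oracle_mulVec_walk hO κ _)]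
  have hflip (x : WalkWire L → Fin 2) :
      Function.update x (flagWire L) (x (flagWire L) + 1) ∘ workWire = x ∘ workWire := by
    funext i
    exact Function.update_of_ne (by simp) _ _
  have hflip' (x : WalkWire L → Fin 2) :
      Function.update x (flagWire L) (x (flagWire L) + 1) ∘ Sum.inl = x ∘ Sum.inl := by
    funext i
    exact Function.update_of_ne (by simp) _ _
  have hflip'' (x : WalkWire L → Fin 2) (i : Fin L) :
      Function.update x (flagWire L) (x (flagWire L) + 1) (workWire i) = x (workWire i) :=
    Function.update_of_ne (by simp) _ _
  rw [ctrlHadamards_mulVec O κ ((Real.sqrt 2 : ℝ) : ℂ)⁻¹ _ _ _ (List.nodup_finRange L)]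
  · simp only [oneGate_pauliX_mulVec, fourierPhases_mulVec, hflip, hflip', hflip'',
      isWalkSector_update (q := flagWire L) _ (by simp) (by simp), Function.update_self,
      List.mem_finRange, not_true_eq_false, false_imp_iff, implies_true, and_true,
      List.length_finRange, walkState]
    by_cases hs : IsWalkSector κ x
    · rcases fin_two_eq_zero_or_one (x (flagWire L)) with h | h <;> simp [hs, h, hs.1] <;> ring
    · simp [hs]
  · intro x hx
    simp only [oneGate_pauliX_mulVec, fourierPhases_mulVec,
      isWalkSector_update (q := flagWire L) _ (by simp) (by simp), Function.update_self, hx]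
    by_cases hs : IsWalkSector κ x
    · by_cases hw : ∀ i, x (workWire i) = 0
      · simp [hs, hw, binaryValue]
      · simp [hs, hw]
    · simp [hs]

end Walk

/-! ### The product of reflections and its Chebyshev relation -/

section WalkOperator

variable {L : ℕ}

/-- The classical circuit that tests whether the flag and the work register are zero. -/
noncomputable def zeroTest (L : ℕ) : List (ClassicalGate (WalkWire L)) := (exists_zeroTest L).choose

/-- The circuit of `zeroTest`. -/
noncomputable def zeroTestCircuit (L : ℕ) : Circuit L (WalkWire L) := classicalCircuit (zeroTest L)

/-- The one-qubit gate `-|0⟩⟨0| + |1⟩⟨1|`. -/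
noncomputable def signUnitary : Matrix.unitaryGroup (Fin 2) ℂ :=
  diagonalUnitary ![-1, 1] (by intro i; fin_cases i <;> simp)

/-- The wire with the outcome of the test for zero. -/
abbrev testWire (L : ℕ) : WalkWire L := chainWire (Fin.last _)

/-- The reflection about the states in which flag and work register are zero. -/
noncomputable def zeroReflection (O : Matrix (Fin (2 ^ L)) (Fin (2 ^ L)) ℂ) :
    Matrix (WalkWire L → Fin 2) (WalkWire L → Fin 2) ℂ :=
  ((zeroTestCircuit L).eval O)ᴴ * (oneGate (testWire L) signUnitary : Gate L (WalkWire L)).eval O *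
    (zeroTestCircuit L).eval O

/-- The walk operator, the product of two reflections. -/
noncomputable def walkOperator (O : Matrix (Fin (2 ^ L)) (Fin (2 ^ L)) ℂ) :
    Matrix (WalkWire L → Fin 2) (WalkWire L → Fin 2) ℂ :=
  (walkPreparation L).eval O * zeroReflection O *
    (((walkPreparation L).eval O)ᴴ *
      (oneGate (flagWire L) pauliX : Gate L (WalkWire L)).eval O)

theorem gateCount_zeroTestCircuit_le : (zeroTestCircuit L).gateCount ≤ 14 * L + 21 :=
  (gateCount_classicalCircuit_le _).trans (by
    have := (exists_zeroTest L).choose_spec.1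
    change 7 * (exists_zeroTest L).choose.length ≤ _
    omega)

theorem callCount_zeroTestCircuit : (zeroTestCircuit L).callCount = 0 :=
  callCount_classicalCircuit _

variable {O : Matrix (Fin (2 ^ L)) (Fin (2 ^ L)) ℂ}

theorem runClassical_zeroTest {x : WalkWire L → Fin 2} (hx : ∀ j, x (chainWire j) = 0) :
    runClassical (zeroTest L) x (testWire L) = 1 ↔
      x (flagWire L) = 0 ∧ ∀ i, x (workWire i) = 0 :=
  ((exists_zeroTest L).choose_spec.2.2 x hx).trans Fin.forall_fin_succ

/-- Conjugating a diagonal gate by a permutation of the basis states leaves it diagonal, so the test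
ancillas are uncomputed for every input. Only the meaning of the sign requires the chain wires to
start at zero. -/
theorem zeroReflection_mulVec (hO : O ∈ Matrix.unitaryGroup (Fin (2 ^ L)) ℂ)
    (ψ : (WalkWire L → Fin 2) → ℂ) (x : WalkWire L → Fin 2) :
    (zeroReflection O *ᵥ ψ) x =
      (if runClassical (zeroTest L) x (testWire L) = 1 then 1 else -1) * ψ x := by
  rw [zeroReflection, ← Matrix.mulVec_mulVec, ← Matrix.mulVec_mulVec, zeroTestCircuit,
    classicalCircuit_conjTranspose_mulVec O hO, signUnitary, oneGate_diagonal_mulVec,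
    classicalCircuit_mulVec_runClassical]
  congr 1
  rcases fin_two_eq_zero_or_one (runClassical (zeroTest L) x (testWire L)) with h | h <;> simp [h]

theorem zeroReflection_mulVec_of_sector (hO : O ∈ Matrix.unitaryGroup (Fin (2 ^ L)) ℂ)
    (ψ : (WalkWire L → Fin 2) → ℂ) {κ : Fin L → Fin 2} {x : WalkWire L → Fin 2}
    (hx : IsWalkSector κ x) [Decidable (x = walkBasis κ)] :
    (zeroReflection O *ᵥ ψ) x = (if x = walkBasis κ then 1 else -1) * ψ x := by
  rw [zeroReflection_mulVec hO]
  congr 1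
  refine if_congr ?_ rfl rfl
  rw [eq_walkBasis_iff, runClassical_zeroTest hx.2]
  exact ⟨fun h => ⟨hx, h⟩, fun h => h.2⟩

theorem zeroReflection_mem_unitaryGroup (hO : O ∈ Matrix.unitaryGroup (Fin (2 ^ L)) ℂ) :
    zeroReflection O ∈ Matrix.unitaryGroup (WalkWire L → Fin 2) ℂ :=
  mul_mem (mul_mem (Unitary.star_mem (Circuit.eval_mem_unitaryGroup hO _))
    (Gate.eval_mem_unitaryGroup hO _)) (Circuit.eval_mem_unitaryGroup hO _)

theorem walkOperator_mem_unitaryGroup (hO : O ∈ Matrix.unitaryGroup (Fin (2 ^ L)) ℂ) :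
    walkOperator O ∈ Matrix.unitaryGroup (WalkWire L → Fin 2) ℂ :=
  mul_mem (mul_mem (Circuit.eval_mem_unitaryGroup hO _) (zeroReflection_mem_unitaryGroup hO))
    (mul_mem (Unitary.star_mem (Circuit.eval_mem_unitaryGroup hO _))
      (Gate.eval_mem_unitaryGroup hO _))

theorem preservesWire_walkPreparation (O : Matrix (Fin (2 ^ L)) (Fin (2 ^ L)) ℂ) {q : WalkWire L}
    (hf : q ≠ flagWire L) (hw : ∀ i, q ≠ workWire i) :
    PreservesWire ((walkPreparation L).eval O) q := by
  refine PreservesWire.circuit O fun g hg => ?_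
  simp only [walkPreparation, fourierPhases, List.mem_append, List.mem_singleton,
    List.mem_map] at hg
  rcases hg with (((rfl | rfl) | ⟨p, -, rfl⟩) | rfl) | ⟨i, -, rfl⟩
  · exact preservesWire_oneGate O hf _
  · refine PreservesWire.onWires_of_notMem _ _ fun o => ?_
    cases o with
    | none => exact hf.symm
    | some i => exact (hw i).symm
  · exact preservesWire_ctrlGate O _ (hw _) _
  · exact preservesWire_oneGate O hf _
  · exact preservesWire_ctrlGate O _ (hw _) _

theorem walkState_ne_zero {c : EuclideanSpace ℂ (Fin (2 ^ L))} {κ : Fin L → Fin 2}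
    {x : WalkWire L → Fin 2} (h : walkState c κ x ≠ 0) : IsWalkSector κ x := by
  by_contra hx
  exact h (if_neg hx)

/-- Flipping the flag pairs the branch that holds the Fourier summands with the uniform branch. The
two cross terms give the average of `F_k` and its conjugate, which is why `F_k` has to be real. -/
theorem walkState_overlap (c : EuclideanSpace ℂ (Fin (2 ^ L))) (κ : Fin L → Fin 2)
    (hreal : starRingEnd ℂ (dftCoeff c (toNumber L κ)) = dftCoeff c (toNumber L κ)) :
    ∑ x, star (walkState c κ x) *
      walkState c κ (Function.update x (flagWire L) (x (flagWire L) + 1)) =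
      dftCoeff c (toNumber L κ) := by
  -- The strings of the sector are parametrized by the flag and the work register; the state
  -- vanishes elsewhere.
  let f (p : Fin 2 × (Fin L → Fin 2)) : WalkWire L → Fin 2 :=
    Sum.elim κ fun a => WalkAncilla.casesOn a p.1 p.2 fun _ => 0
  have hf : Function.Injective f := by
    intro p q h
    refine Prod.ext (congrFun h (flagWire L)) (funext fun i => congrFun h (workWire i))
  have hsec (p) : IsWalkSector κ (f p) := ⟨rfl, fun _ => rfl⟩
  have hup (p : Fin 2 × (Fin L → Fin 2)) :
      Function.update (f p) (flagWire L) (f p (flagWire L) + 1) = f (p.1 + 1, p.2) := by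
    funext q
    rcases q with i | _ | i | i <;> simp [f]
  rw [← Fintype.sum_of_injective f hf (fun p => star (walkState c κ (f p)) *
    walkState c κ (f (p.1 + 1, p.2))) _ ?_ fun p => by rw [hup]]
  · set E : (Fin L → Fin 2) → ℂ := fun w =>
      Complex.exp (2 * Real.pi * Complex.I * binaryValue w * binaryValue κ / 2 ^ L) *
        c (toNumber L w) with hE
    set s : ℂ := ((Real.sqrt 2 : ℝ) : ℂ)⁻¹ with hs
    have hss : s * s = 2⁻¹ := by
      rw [hs, ← mul_inv, ← Complex.ofReal_mul, Real.mul_self_sqrt zero_le_two]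
      norm_num
    have hstar : star s = s := by
      rw [hs, ← Complex.ofReal_inv]
      exact Complex.conj_ofReal _
    have h0 (w) : walkState c κ (f (0, w)) = s * E w := by
      rw [walkState, if_pos (hsec _)]
      rfl
    have h1 (w) : walkState c κ (f (1, w)) = s * s ^ L := by
      rw [walkState, if_pos (hsec _)]
      rfl
    have hF : dftCoeff c (toNumber L κ) = s ^ L * ∑ w, E w := by
      rw [dftCoeff, ← (toNumber L).sum_comp, Finset.mul_sum]
      refine Finset.sum_congr rfl fun w _ => ?_
      have hN : ((Real.sqrt ((2 ^ L : ℕ) : ℝ) : ℝ) : ℂ)⁻¹ = s ^ L := by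
        rw [sqrt_two_pow_cast, hs, inv_pow]
      rw [fourierMatrix, Matrix.of_apply, toNumber_val, toNumber_val, div_eq_mul_inv _ (_ : ℂ), hN,
        hE]
      push_cast
      ring
    have hsum : ∑ p : Fin 2 × (Fin L → Fin 2), star (walkState c κ (f p)) *
        walkState c κ (f (p.1 + 1, p.2)) =
        2⁻¹ * (star (dftCoeff c (toNumber L κ)) + dftCoeff c (toNumber L κ)) := by
      rw [Fintype.sum_prod_type, Fin.sum_univ_two]
      simp only [zero_add, h0, h1, show (1 : Fin 2) + 1 = 0 from rfl, hF, star_mul', star_sum,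
        star_pow, hstar, ← hss]
      simp only [Finset.mul_sum, ← Finset.sum_add_distrib]
      exact Finset.sum_congr rfl fun w _ => by ring
    rw [hsum, Complex.star_def, hreal]
    ring
  · intro x hx
    have : ¬ IsWalkSector κ x := by
      rintro ⟨h1, h2⟩
      refine hx ⟨(x (flagWire L), x ∘ workWire), funext fun q => ?_⟩
      rcases q with i | _ | i | i
      exacts [(congrFun h1 i).symm, rfl, rfl, (h2 i).symm]
    rw [walkState, if_neg this, star_zero, zero_mul]

/-- On the states that are prepared for it, the walk operator has the real part `F_k`. -/
theorem walkOperator_add_conjTranspose_mulVec (hO : O ∈ Matrix.unitaryGroup (Fin (2 ^ L)) ℂ)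
    {c : EuclideanSpace ℂ (Fin (2 ^ L))} (hOc : ∀ j, O j 0 = c j) (κ : Fin L → Fin 2)
    (hreal : starRingEnd ℂ (dftCoeff c (toNumber L κ)) = dftCoeff c (toNumber L κ)) :
    walkOperator O *ᵥ walkState c κ + (walkOperator O)ᴴ *ᵥ walkState c κ =
      (2 * dftCoeff c (toNumber L κ)) • walkState c κ := by
  classical
  set A := (walkPreparation L).eval O with hA
  set X := (oneGate (flagWire L) pauliX : Gate L (WalkWire L)).eval O with hX
  set R := zeroReflection O with hR
  set φ := walkState c κ with hφ
  set e : (WalkWire L → Fin 2) → ℂ := Pi.single (walkBasis κ) 1 with he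
  have hφA : A *ᵥ e = φ := walkPreparation_mulVec hOc κ
  have hAA : A * Aᴴ = 1 := Circuit.eval_mul_conjTranspose hO _
  have hAA' : Aᴴ * A = 1 := Circuit.conjTranspose_mul_eval hO _
  have hRR : Rᴴ * R = 1 := Matrix.mem_unitaryGroup_iff'.mp (zeroReflection_mem_unitaryGroup hO)
  have hXX : Xᴴ = X := by
    have h1 : X * X = 1 := by
      refine Matrix.ext_of_mulVec_single fun y => funext fun x => ?_
      rw [← Matrix.mulVec_mulVec, hX, oneGate_pauliX_mulVec, oneGate_pauliX_mulVec,
        Matrix.one_mulVec, Function.update_idem, Function.update_self,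
        ClassicalGate.fin_two_add_add_self _ 1, Function.update_eq_self]
    have h2 : Xᴴ * X = 1 :=
      Matrix.mem_unitaryGroup_iff'.mp (Gate.eval_mem_unitaryGroup hO _)
    rw [← mul_one Xᴴ, ← h1, ← mul_assoc, h2, one_mul]
  set β := Aᴴ *ᵥ (X *ᵥ φ) with hβ
  have hRe : Rᴴ *ᵥ e = e := by
    have : R *ᵥ e = e := by
      funext x
      rw [hR, zeroReflection_mulVec hO]
      by_cases hx : x = walkBasis κ
      · subst hx
        rw [if_pos, one_mul]
        exact (runClassical_zeroTest fun _ => rfl).mpr ⟨rfl, fun _ => rfl⟩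
      · rw [he, Pi.single_eq_of_ne hx, mul_zero]
    rw [← this, Matrix.mulVec_mulVec, hRR, Matrix.one_mulVec, this]
  -- The preparation and the flag flip leave the main register and the chain wires alone, so `β`
  -- stays in the sector where the reflection singles out `walkBasis κ`.
  have hsupp {x} (hx : β x ≠ 0) : IsWalkSector κ x := by
    have hpres {q : WalkWire L} (hf : q ≠ flagWire L) (hw : ∀ i, q ≠ workWire i) {b : Fin 2}
        (hb : ∀ y, φ y ≠ 0 → y q = b) : x q = b := by
      rw [hβ, Matrix.mulVec_mulVec] at hx
      exact ((preservesWire_walkPreparation O hf hw).conjTranspose.mul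
        (preservesWire_oneGate O hf _)).mulVec_ne_zero hb hx
    refine ⟨funext fun i => ?_, fun j => ?_⟩
    · exact hpres (by simp) (by simp) fun y hy => congrFun (walkState_ne_zero hy).1 i
    · exact hpres (by simp) (by simp) fun y hy => (walkState_ne_zero hy).2 j
  have hβe : β (walkBasis κ) = dftCoeff c (toNumber L κ) := by
    rw [← walkState_overlap c κ hreal, hβ, Matrix.mulVec, dotProduct]
    refine Finset.sum_congr rfl fun x _ => ?_
    rw [hX, oneGate_pauliX_mulVec, Matrix.conjTranspose_apply, ← hφ, ← hφA, he,
      Matrix.mulVec_single_one]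
    rfl
  -- On the sector `R = 2|e⟩⟨e| - 1`, so `Rβ + β` is twice the projection of `β` onto `e`, whose
  -- coefficient is the overlap `F_k`.
  have hRβ : R *ᵥ β + β = (2 * dftCoeff c (toNumber L κ)) • e := by
    funext x
    rw [Pi.add_apply, Pi.smul_apply, smul_eq_mul]
    by_cases hx : β x = 0
    · have : dftCoeff c (toNumber L κ) * e x = 0 := by
        by_cases hx' : x = walkBasis κ
        · rw [← hβe, ← hx', hx, zero_mul]
        · rw [he, Pi.single_eq_of_ne hx', mul_zero]
      rw [hR, zeroReflection_mulVec hO, hx, mul_assoc, this]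
      simp
    · rw [hR, zeroReflection_mulVec_of_sector hO β (hsupp hx)]
      by_cases hx' : x = walkBasis κ
      · rw [if_pos hx', hx', hβe, he, Pi.single_eq_same]
        ring
      · rw [if_neg hx', he, Pi.single_eq_of_ne hx']
        ring
  have h1 : walkOperator O *ᵥ φ = A *ᵥ (R *ᵥ β) := by
    simp only [walkOperator, ← hA, ← hX, ← hR, hβ, Matrix.mulVec_mulVec, mul_assoc]
  -- Since `R` fixes `e`, the inner reflection fixes `φ = Ae`, and the adjoint walk only flips the
  -- flag: `U†φ = Xφ = Aβ`.
  have h2 : (walkOperator O)ᴴ *ᵥ φ = A *ᵥ β := by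
    have : (walkOperator O)ᴴ = X * A * Rᴴ * Aᴴ := by
      simp only [walkOperator, ← hA, ← hX, ← hR, Matrix.conjTranspose_mul,
        Matrix.conjTranspose_conjTranspose, hXX, mul_assoc]
    rw [this, ← hφA, Matrix.mulVec_mulVec, mul_assoc, hAA', mul_one, ← Matrix.mulVec_mulVec, hRe,
      hβ, Matrix.mulVec_mulVec, hAA, Matrix.one_mulVec, ← hφA, Matrix.mulVec_mulVec]
  rw [h1, h2, ← Matrix.mulVec_add, hRβ, Matrix.mulVec_smul, hφA]

end WalkOperator

/-! ### Slices of a state -/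

section Slices

variable {L : ℕ} {α ρ : Type} [Fintype α] [DecidableEq α] [Fintype ρ] [DecidableEq ρ]

/-- The part of a state in which the first register is in the basis state `z`. -/
def slice (ψ : (α ⊕ ρ → Fin 2) → ℂ) (z : α → Fin 2) (u : ρ → Fin 2) : ℂ := ψ (Sum.elim z u)

theorem slice_onWires_inr (U : Matrix (ρ → Fin 2) (ρ → Fin 2) ℂ) (ψ : (α ⊕ ρ → Fin 2) → ℂ)
    (z : α → Fin 2) :
    slice (onWires Function.Embedding.inr U *ᵥ ψ) z = U *ᵥ slice ψ z := by
  funext u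
  rw [slice, onWires_mulVec]
  refine Finset.sum_congr rfl fun s _ => ?_
  simp only [slice]
  congr 2
  funext q
  rcases q with i | i
  · exact Function.extend_apply' _ _ _ (by simp)
  · exact Function.Embedding.inr.injective.extend_apply s _ i

theorem slice_onWires_inl (V : Matrix (α → Fin 2) (α → Fin 2) ℂ) (ψ : (α ⊕ ρ → Fin 2) → ℂ)
    (z : α → Fin 2) (u : ρ → Fin 2) :
    slice (onWires Function.Embedding.inl V *ᵥ ψ) z u = (V *ᵥ fun z' => slice ψ z' u) z := by
  rw [slice, onWires_mulVec]
  refine Finset.sum_congr rfl fun s _ => ?_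
  simp only [slice]
  congr 2
  funext q
  rcases q with i | i
  · exact Function.Embedding.inl.injective.extend_apply s _ i
  · exact Function.extend_apply' _ _ _ (by simp)

theorem slice_ctrlGate (O : Matrix (Fin (2 ^ L)) (Fin (2 ^ L)) ℂ) (i : α) (r : ρ)
    (h : Sum.inl i ≠ Sum.inr r) (G : Matrix.unitaryGroup (Fin 2) ℂ) (ψ : (α ⊕ ρ → Fin 2) → ℂ)
    (z : α → Fin 2) :
    slice ((ctrlGate (Sum.inl i) (Sum.inr r) h G : Gate L (α ⊕ ρ)).eval O *ᵥ ψ) z =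
      if z i = 1 then (oneGate r G : Gate L ρ).eval O *ᵥ slice ψ z else slice ψ z := by
  funext u
  rw [slice, ctrlGate_mulVec, Sum.elim_inl, Sum.elim_inr]
  split_ifs
  · rw [oneGate_mulVec]
    simp only [slice, Sum.update_elim_inr]
  · rfl

end Slices

/-! ### Norms and the discrete Fourier transform -/

section FourierTransform

theorem sum_norm_sq_mulVec {n : Type*} [Fintype n] [DecidableEq n] {U : Matrix n n ℂ}
    (hU : U ∈ Matrix.unitaryGroup n ℂ) (v : n → ℂ) :
    ∑ i, ‖(U *ᵥ v) i‖ ^ 2 = ∑ i, ‖v i‖ ^ 2 := by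
  have key (w : n → ℂ) : ((∑ i, ‖w i‖ ^ 2 : ℝ) : ℂ) = star w ⬝ᵥ w := by
    rw [Complex.ofReal_sum, dotProduct]
    refine Finset.sum_congr rfl fun i _ => ?_
    rw [Pi.star_apply, Complex.star_def, Complex.conj_mul']
    push_cast
    rfl
  have h := Matrix.mem_unitaryGroup_iff'.mp hU
  rw [Matrix.star_eq_conjTranspose] at h
  rw [← Complex.ofReal_inj, key, key, Matrix.star_mulVec, Matrix.dotProduct_mulVec,
    Matrix.vecMul_vecMul, h, Matrix.vecMul_one]

variable {N : ℕ}

/-- The number `exp (2πi jk / N)`. -/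
noncomputable def fourierChar (k j : Fin N) : ℂ :=
  Complex.exp (2 * Real.pi * Complex.I * ((j : ℕ) : ℂ) * ((k : ℕ) : ℂ) / (N : ℂ))

theorem fourierMatrix_apply (k j : Fin N) :
    fourierMatrix N k j = fourierChar k j / ((Real.sqrt N : ℝ) : ℂ) := rfl

theorem fourierChar_comm (k j : Fin N) : fourierChar k j = fourierChar j k := by
  rw [fourierChar, fourierChar, mul_right_comm]

theorem fourierChar_add [NeZero N] (k j j' : Fin N) :
    fourierChar k (j + j') = fourierChar k j * fourierChar k j' := by
  have hN : (N : ℂ) ≠ 0 := Nat.cast_ne_zero.mpr (NeZero.ne N)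
  rw [fourierChar, fourierChar, fourierChar, ← Complex.exp_add, Fin.val_add,
    ← mul_one (Complex.exp _),
    ← Complex.exp_nat_mul_two_pi_mul_I (((j : ℕ) + j') / N * k), ← Complex.exp_add]
  congr 1
  have h : (((j : ℕ) + j' : ℕ) : ℂ) = ((((j : ℕ) + j') % N : ℕ) : ℂ) +
      N * (((j : ℕ) + j') / N : ℕ) := by
    rw [← Nat.cast_mul, ← Nat.cast_add, Nat.mod_add_div]
  rw [Nat.cast_add] at h
  rw [← add_div, ← add_mul, ← mul_add, h, Nat.cast_mul]
  field_simp

theorem fourierChar_zero [NeZero N] (k : Fin N) : fourierChar k 0 = 1 := by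
  simp [fourierChar]

theorem fourierChar_ne_zero (k j : Fin N) : fourierChar k j ≠ 0 := Complex.exp_ne_zero _

theorem star_fourierChar (k j : Fin N) : star (fourierChar k j) = (fourierChar k j)⁻¹ := by
  rw [fourierChar, Complex.star_def, ← Complex.exp_conj, ← Complex.exp_neg]
  congr 1
  simp [neg_div, map_ofNat]

theorem norm_fourierChar (k j : Fin N) : ‖fourierChar k j‖ = 1 := by
  have h : 2 * (Real.pi : ℂ) * Complex.I * ((j : ℕ) : ℂ) * ((k : ℕ) : ℂ) / (N : ℂ) =
      ((2 * Real.pi * j * k / N : ℝ) : ℂ) * Complex.I := by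
    push_cast
    ring
  rw [fourierChar, h, Complex.norm_exp_ofReal_mul_I]

/-- The angle cosine `cos (2πy / N)`. -/
noncomputable def gridCos (N y : ℕ) : ℝ := Real.cos (2 * Real.pi * y / N)

theorem fourierChar_one_add_inv [NeZero N] (hN : 1 < N) (y : Fin N) :
    (fourierChar y 1 + (fourierChar y 1)⁻¹) / 2 = (gridCos N y : ℂ) := by
  rw [gridCos, Complex.ofReal_cos, Complex.cos, fourierChar, ← Complex.exp_neg]
  have h1 : ((1 : Fin N) : ℕ) = 1 := by
    rw [Fin.val_one', Nat.mod_eq_of_lt hN]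
  rw [h1]
  push_cast
  congr 3 <;> ring

/-- A cyclic translation becomes multiplication by a character; applied with `1` and `-1`, this is
what turns the cosine into the average of the shifts. -/
theorem fourierMatrix_conjTranspose_mulVec_add [NeZero N] (v : Fin N → ℂ) (a y : Fin N) :
    ((fourierMatrix N)ᴴ *ᵥ fun j => v (j + a)) y =
      fourierChar y a * ((fourierMatrix N)ᴴ *ᵥ v) y := by
  simp only [Matrix.mulVec, dotProduct]
  rw [Finset.mul_sum, ← Equiv.sum_comp (Equiv.addRight a) fun j => fourierChar y a *
      ((fourierMatrix N)ᴴ y j * v j)]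
  refine Finset.sum_congr rfl fun j _ => ?_
  simp only [Equiv.coe_addRight, Matrix.conjTranspose_apply, fourierMatrix_apply, star_div₀,
    star_fourierChar]
  rw [fourierChar_comm _ y, fourierChar_comm _ y, fourierChar_add]
  have := fourierChar_ne_zero y a
  field_simp

/-- In the Fourier basis, multiplication by the angle cosine is the average of the two shifts. -/
theorem sum_norm_sq_gridCos_sub {m : ℕ} (hm : m ≠ 0) (v : Fin (2 ^ m) → ℂ) (a : ℂ) :
    ∑ y : Fin (2 ^ m), ‖((gridCos (2 ^ m) y : ℂ) - a) * ((fourierMatrix (2 ^ m))ᴴ *ᵥ v) y‖ ^ 2 =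
      ∑ j, ‖(v (j + 1) + v (j - 1)) / 2 - a * v j‖ ^ 2 := by
  rw [← sum_norm_sq_mulVec (Unitary.star_mem (fourierMatrix_mem_unitaryGroup m))
    fun j => (v (j + 1) + v (j - 1)) / 2 - a * v j]
  refine Finset.sum_congr rfl fun y _ => ?_
  congr 2
  have h : (fun j => (v (j + 1) + v (j - 1)) / 2 - a * v j) =
      (2⁻¹ : ℂ) • ((fun j => v (j + 1)) + fun j => v (j + -1)) - a • v := by
    funext j
    simp only [Pi.sub_apply, Pi.smul_apply, Pi.add_apply, smul_eq_mul, sub_eq_add_neg]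
    ring
  have hneg : fourierChar y (-1) = (fourierChar y 1)⁻¹ := by
    refine eq_inv_of_mul_eq_one_left ?_
    rw [← fourierChar_add, neg_add_cancel, fourierChar_zero]
  rw [h, Matrix.star_eq_conjTranspose, Matrix.mulVec_sub, Matrix.mulVec_smul, Matrix.mulVec_smul,
    Matrix.mulVec_add, Pi.sub_apply, Pi.smul_apply, Pi.smul_apply, Pi.add_apply,
    fourierMatrix_conjTranspose_mulVec_add, fourierMatrix_conjTranspose_mulVec_add, hneg,
    ← fourierChar_one_add_inv (Nat.one_lt_two_pow hm)]
  simp only [smul_eq_mul]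
  ring

end FourierTransform

/-! ### Phase estimation -/

section PhaseEstimation

variable {L : ℕ}

/-- A circuit for the Fourier transform on `n` qubits. -/
noncomputable def fourierCircuit (L n : ℕ) : Circuit L (Fin n) := (exists_fourierCircuit L n).choose

theorem gateCount_fourierCircuit_le (L n : ℕ) :
    (fourierCircuit L n).gateCount ≤ n ^ 2 + 21 * n :=
  (exists_fourierCircuit L n).choose_spec.1

theorem callCount_fourierCircuit (L n : ℕ) : (fourierCircuit L n).callCount = 0 :=
  (exists_fourierCircuit L n).choose_spec.2.1

theorem eval_fourierCircuit (L n : ℕ) (O : Matrix (Fin (2 ^ L)) (Fin (2 ^ L)) ℂ) :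
    (fourierCircuit L n).eval O = onQubits (fourierMatrix (2 ^ n)) :=
  (exists_fourierCircuit L n).choose_spec.2.2 O

/-- The walk operator controlled by a wire of the counter. -/
noncomputable def controlledWalk (L : ℕ) {m : ℕ} (i : Fin m) : Circuit L (Fin m ⊕ WalkWire L) :=
  [ctrlGate (Sum.inl i) (Sum.inr (flagWire L)) Sum.inl_ne_inr pauliX] ++
  Circuit.mapWires .inr (Circuit.inv (walkPreparation L) ++ zeroTestCircuit L) ++
  [ctrlGate (Sum.inl i) (Sum.inr (testWire L)) Sum.inl_ne_inr signUnitary] ++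
  Circuit.mapWires .inr (Circuit.inv (zeroTestCircuit L) ++ walkPreparation L)

/-- Only the flag flip and the sign gate are controlled. When both are switched off, the preparation
and the zero test cancel against their inverses, so neither they nor the oracle calls need a further
control. -/
theorem slice_controlledWalk {O : Matrix (Fin (2 ^ L)) (Fin (2 ^ L)) ℂ}
    (hO : O ∈ Matrix.unitaryGroup (Fin (2 ^ L)) ℂ) {m : ℕ} (i : Fin m)
    (ψ : (Fin m ⊕ WalkWire L → Fin 2) → ℂ) (z : Fin m → Fin 2) :
    slice ((controlledWalk L i).eval O *ᵥ ψ) z =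
      if z i = 1 then walkOperator O *ᵥ slice ψ z else slice ψ z := by
  rw [controlledWalk, Circuit.eval_append, Circuit.eval_append, Circuit.eval_append,
    Circuit.eval_singleton, Circuit.eval_singleton, Circuit.eval_mapWires, Circuit.eval_mapWires,
    ← Matrix.mulVec_mulVec, ← Matrix.mulVec_mulVec, ← Matrix.mulVec_mulVec, slice_onWires_inr,
    slice_ctrlGate, slice_onWires_inr, slice_ctrlGate]
  split_ifs
  · simp only [walkOperator, zeroReflection, Circuit.eval_append, Circuit.eval_inv,
      Matrix.mulVec_mulVec, mul_assoc]
  · simp only [Circuit.eval_append, Circuit.eval_inv]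
    rw [Matrix.mulVec_mulVec, mul_assoc, ← mul_assoc _ (Circuit.eval O (zeroTestCircuit L)),
      Circuit.conjTranspose_mul_eval hO, one_mul, Circuit.eval_mul_conjTranspose hO,
      Matrix.one_mulVec]

/-- The power of the walk operator whose exponent is the value of the counter. -/
noncomputable def walkPowers (L m : ℕ) : Circuit L (Fin m ⊕ WalkWire L) :=
  (List.finRange m).flatMap fun i : Fin m =>
    (List.range (2 ^ (i : ℕ))).flatMap fun _ => controlledWalk L i

theorem slice_walkPowers {O : Matrix (Fin (2 ^ L)) (Fin (2 ^ L)) ℂ}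
    (hO : O ∈ Matrix.unitaryGroup (Fin (2 ^ L)) ℂ) {m : ℕ}
    (ψ : (Fin m ⊕ WalkWire L → Fin 2) → ℂ) (z : Fin m → Fin 2) :
    slice ((walkPowers L m).eval O *ᵥ ψ) z = walkOperator O ^ binaryValue z *ᵥ slice ψ z := by
  have hflat {α : Type} (l : List α) (W : α → Circuit L (Fin m ⊕ WalkWire L)) (k : α → ℕ)
      (hW : ∀ i ψ, slice ((W i).eval O *ᵥ ψ) z = walkOperator O ^ k i *ᵥ slice ψ z)
      (ψ : (Fin m ⊕ WalkWire L → Fin 2) → ℂ) :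
      slice (Circuit.eval O (l.flatMap W) *ᵥ ψ) z =
        walkOperator O ^ (l.map k).sum *ᵥ slice ψ z := by
    induction l generalizing ψ with
    | nil => simp [Circuit.eval]
    | cons i l ih =>
      rw [List.flatMap_cons, Circuit.eval_append, ← Matrix.mulVec_mulVec, ih, hW,
        Matrix.mulVec_mulVec, ← pow_add, List.map_cons, List.sum_cons, add_comm]
  have h1 (i : Fin m) (ψ : (Fin m ⊕ WalkWire L → Fin 2) → ℂ) :
      slice ((controlledWalk L i).eval O *ᵥ ψ) z = walkOperator O ^ (z i : ℕ) *ᵥ slice ψ z := by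
    rw [slice_controlledWalk hO]
    rcases fin_two_eq_zero_or_one (z i) with h | h <;> simp [h]
  rw [walkPowers, hflat _ _ (fun i : Fin m => (z i : ℕ) * 2 ^ (i : ℕ))]
  · rw [← List.ofFn_eq_map, List.sum_ofFn, binaryValue]
  · intro i ψ
    rw [hflat _ _ (fun _ => (z i : ℕ)) fun _ => h1 i]
    simp [mul_comm]

theorem gateCount_controlledWalk_le {m : ℕ} (i : Fin m) :
    (controlledWalk L i).gateCount ≤ 2 * L ^ 2 + 30 * L + 48 := by
  have h1 := gateCount_walkPreparation_le (L := L)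
  have h2 := gateCount_zeroTestCircuit_le (L := L)
  have h3 (r : WalkWire L) (G : Matrix.unitaryGroup (Fin 2) ℂ) :
      Circuit.gateCount [(ctrlGate (Sum.inl i) (Sum.inr r) Sum.inl_ne_inr G :
        Gate L (Fin m ⊕ WalkWire L))] = 1 := rfl
  simp only [controlledWalk, Circuit.gateCount_append, Circuit.gateCount_mapWires,
    Circuit.gateCount_inv, h3]
  omega

theorem callCount_controlledWalk {m : ℕ} (i : Fin m) : (controlledWalk L i).callCount = 2 := by
  have h3 (r : WalkWire L) (G : Matrix.unitaryGroup (Fin 2) ℂ) :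
      Circuit.callCount [(ctrlGate (Sum.inl i) (Sum.inr r) Sum.inl_ne_inr G :
        Gate L (Fin m ⊕ WalkWire L))] = 0 := rfl
  simp only [controlledWalk, Circuit.callCount_append, Circuit.callCount_mapWires,
    Circuit.callCount_inv, h3, callCount_walkPreparation, callCount_zeroTestCircuit]

theorem sum_two_pow_le (m : ℕ) : ∑ i : Fin m, 2 ^ (i : ℕ) ≤ 2 ^ m := by
  rw [Fin.sum_univ_eq_sum_range fun i => 2 ^ i]
  induction m with
  | zero => simp
  | succ m ih =>
    rw [Finset.sum_range_succ, pow_succ]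
    omega

theorem gateCount_walkPowers_le (L m : ℕ) :
    (walkPowers L m).gateCount ≤ 2 ^ m * (2 * L ^ 2 + 30 * L + 48) := by
  rw [walkPowers, Circuit.gateCount_flatMap, ← List.ofFn_eq_map, List.sum_ofFn]
  refine le_trans ?_ (Nat.mul_le_mul_right _ (sum_two_pow_le m))
  rw [Finset.sum_mul]
  refine Finset.sum_le_sum fun i _ => ?_
  rw [Circuit.gateCount_flatMap]
  simpa using Nat.mul_le_mul_left (2 ^ (i : ℕ)) (gateCount_controlledWalk_le i)

theorem callCount_walkPowers_le (L m : ℕ) : (walkPowers L m).callCount ≤ 2 ^ m * 2 := by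
  rw [walkPowers, Circuit.callCount_flatMap, ← List.ofFn_eq_map, List.sum_ofFn]
  refine le_trans ?_ (Nat.mul_le_mul_right _ (sum_two_pow_le m))
  rw [Finset.sum_mul]
  refine Finset.sum_le_sum fun i _ => ?_
  rw [Circuit.callCount_flatMap]
  simp [callCount_controlledWalk]

/-- The circuit that prepares the initial state of the counter. -/
noncomputable def counterPreparation (L m : ℕ) [NeZero m] : Circuit L (Fin m) :=
  [oneGate 0 (hadamard * pauliX)] ++ fourierCircuit L m

/-- The amplitudes of the initial state of the counter. -/
noncomputable def counterAmplitude {m : ℕ} (j : Fin (2 ^ m)) : ℂ :=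
  ((Real.sqrt 2 : ℝ) : ℂ)⁻¹ * ((1 - fourierChar 1 j) / ((Real.sqrt (2 ^ m : ℕ) : ℝ) : ℂ))

theorem toNumber_single_zero {m : ℕ} [NeZero m] :
    toNumber m (Pi.single 0 1) = 1 := by
  refine Fin.ext ?_
  rw [toNumber_val, Fin.val_one', Nat.mod_eq_of_lt (Nat.one_lt_two_pow (NeZero.ne m)), binaryValue,
    Finset.sum_eq_single 0]
  · simp
  · intro i _ hi
    simp [hi]
  · simp

theorem toNumber_zero {m : ℕ} : toNumber m 0 = 0 := by
  refine Fin.ext ?_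
  rw [toNumber_val]
  simp [binaryValue]

/-- The first gate maps `|0⟩` to `(|0⟩ - |1⟩)/√2`, because bit `0` is the least significant. Its
Fourier transform is the constant character minus the first one. -/
theorem counterPreparation_mulVec (O : Matrix (Fin (2 ^ L)) (Fin (2 ^ L)) ℂ) (m : ℕ) [NeZero m] :
    (counterPreparation L m).eval O *ᵥ Pi.single 0 1 =
      fun z => counterAmplitude (toNumber m z) := by
  have h0 : (Circuit.eval O [(oneGate 0 (hadamard * pauliX) : Gate L (Fin m))]) *ᵥ Pi.single 0 1 =
      ((Real.sqrt 2 : ℝ) : ℂ)⁻¹ • (Pi.single 0 1 - Pi.single (Pi.single 0 1) 1) := by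
    have hG (b : Fin 2) : (hadamard * pauliX).1 b 0 =
        ((Real.sqrt 2 : ℝ) : ℂ)⁻¹ * (if b = 1 then -1 else 1) := by
      rw [Submonoid.coe_mul, Matrix.mul_apply, Fin.sum_univ_two, hadamard_apply, hadamard_apply]
      simp [pauliX]
    funext x
    rw [Circuit.eval_singleton, oneGate_mulVec, Fin.sum_univ_two, hG]
    have hne : Function.update x 0 1 ≠ (0 : Fin m → Fin 2) := fun h => by
      simpa using congrFun h 0
    have h01 : (Pi.single 0 1 : Fin m → Fin 2) ≠ 0 := fun h => by
      simpa using congrFun h 0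
    rw [Pi.single_eq_of_ne hne, mul_zero, add_zero, Pi.smul_apply, Pi.sub_apply, smul_eq_mul]
    by_cases hx0 : x = 0
    · subst hx0
      rw [Pi.single_eq_same, Pi.single_eq_of_ne h01.symm]
      simp
    · rw [Pi.single_eq_of_ne hx0]
      by_cases hx1 : x = Pi.single 0 1
      · subst hx1
        have hupd : Function.update (Pi.single 0 1 : Fin m → Fin 2) 0 0 = 0 := by
          funext i
          by_cases hi : i = 0 <;> simp [hi]
        simp [hupd]
      · rw [Pi.single_eq_of_ne hx1, Pi.single_eq_of_ne]
        · simp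
        · intro h
          rcases fin_two_eq_zero_or_one (x 0) with h' | h'
          · rw [← h', Function.update_eq_self] at h
            exact hx0 h
          · refine hx1 (funext fun i => ?_)
            by_cases hi : i = 0
            · subst hi
              simp [h']
            · simpa [hi] using congrFun h i
  rw [counterPreparation, Circuit.eval_append, ← Matrix.mulVec_mulVec, h0, eval_fourierCircuit,
    Matrix.mulVec_smul, Matrix.mulVec_sub, Matrix.mulVec_single_one, Matrix.mulVec_single_one]
  funext z
  change _ * (fourierMatrix (2 ^ m) (toNumber m z) (toNumber m 0) -
    fourierMatrix (2 ^ m) (toNumber m z) (toNumber m (Pi.single 0 1))) = _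
  rw [toNumber_zero, toNumber_single_zero, fourierMatrix_apply, fourierMatrix_apply, ← sub_div,
    fourierChar_zero, fourierChar_comm, counterAmplitude]

/-- The increment is `-ω^j (ω^a - 1)/√(2M)` with `ω = e^{2πi/M}` and `M = 2^m`, so its modulus does
not depend on `j`. This uniformity makes the final sum over `j` immediate. -/
theorem norm_counterAmplitude_add_sub {m : ℕ} (j a : Fin (2 ^ m)) :
    ‖counterAmplitude (j + a) - counterAmplitude j‖ ^ 2 =
      ‖fourierChar 1 a - 1‖ ^ 2 / (2 * 2 ^ m) := by
  have h : counterAmplitude (j + a) - counterAmplitude j = -(((Real.sqrt 2 : ℝ) : ℂ)⁻¹ *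
      (fourierChar 1 j * (fourierChar 1 a - 1) / ((Real.sqrt (2 ^ m : ℕ) : ℝ) : ℂ))) := by
    rw [counterAmplitude, counterAmplitude, fourierChar_add]
    ring
  rw [h, norm_neg, norm_mul, norm_div, norm_mul, norm_fourierChar, norm_inv, one_mul,
    Complex.norm_of_nonneg (Real.sqrt_nonneg _), Complex.norm_of_nonneg (Real.sqrt_nonneg _),
    mul_pow, div_pow, inv_pow, Real.sq_sqrt zero_le_two, Real.sq_sqrt (Nat.cast_nonneg _)]
  push_cast
  field_simp

theorem norm_fourierChar_one_one_sub_le {m : ℕ} (hm : m ≠ 0) :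
    ‖fourierChar (1 : Fin (2 ^ m)) 1 - 1‖ ≤ 2 * Real.pi / 2 ^ m := by
  have h1 : ((1 : Fin (2 ^ m)) : ℕ) = 1 := by
    rw [Fin.val_one', Nat.mod_eq_of_lt (Nat.one_lt_two_pow hm)]
  have h2 : fourierChar (1 : Fin (2 ^ m)) 1 =
      Complex.exp (Complex.I * ((2 * Real.pi / 2 ^ m : ℝ) : ℂ)) := by
    rw [fourierChar, h1]
    congr 1
    push_cast
    ring
  rw [h2]
  refine (Real.norm_exp_I_mul_ofReal_sub_one_le).trans ?_
  rw [Real.norm_of_nonneg (by positivity)]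

/-- The cyclic shift joins the exponents `M - 1` and `0`, with `M = 2^m`, whereas the powers of the
walk do not close up. The vanishing amplitude hides the seam. -/
theorem counterAmplitude_zero {m : ℕ} : counterAmplitude (0 : Fin (2 ^ m)) = 0 := by
  rw [counterAmplitude, fourierChar_zero, sub_self, zero_div, mul_zero]

/-- The circuit of phase estimation. -/
noncomputable def phaseEstimation (L m : ℕ) [NeZero m] : Circuit L (Fin m ⊕ WalkWire L) :=
  Circuit.mapWires .inl (counterPreparation L m) ++ Circuit.mapWires .inr (walkPreparation L) ++
    walkPowers L m ++ Circuit.mapWires .inl (Circuit.inv (fourierCircuit L m))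

theorem gateCount_phaseEstimation_le (L m : ℕ) [NeZero m] :
    (phaseEstimation L m).gateCount ≤
      2 * (m ^ 2 + 21 * m) + (L ^ 2 + L + 3) + 2 ^ m * (2 * L ^ 2 + 30 * L + 48) := by
  have h1 := gateCount_walkPreparation_le (L := L)
  have h2 := gateCount_walkPowers_le L m
  have h3 := gateCount_fourierCircuit_le L m
  have h4 : Circuit.gateCount [(oneGate 0 (hadamard * pauliX) : Gate L (Fin m))] = 1 := rfl
  simp only [phaseEstimation, counterPreparation, Circuit.gateCount_append,
    Circuit.gateCount_mapWires, Circuit.gateCount_inv, h4]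
  omega

theorem callCount_phaseEstimation_le (L m : ℕ) [NeZero m] :
    (phaseEstimation L m).callCount ≤ 1 + 2 ^ m * 2 := by
  have h2 := callCount_walkPowers_le L m
  have h4 : Circuit.callCount [(oneGate 0 (hadamard * pauliX) : Gate L (Fin m))] = 0 := rfl
  simp only [phaseEstimation, counterPreparation, Circuit.callCount_append,
    Circuit.callCount_mapWires, Circuit.callCount_inv, h4, callCount_walkPreparation,
    callCount_fourierCircuit]
  omega

theorem onQubits_mulVec {n : ℕ} (U : Matrix (Fin (2 ^ n)) (Fin (2 ^ n)) ℂ)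
    (ψ : (Fin n → Fin 2) → ℂ) (z : Fin n → Fin 2) :
    (onQubits U *ᵥ ψ) z = (U *ᵥ fun j => ψ ((toNumber n).symm j)) (toNumber n z) := by
  simp only [Matrix.mulVec, dotProduct]
  rw [← (toNumber n).sum_comp]
  refine Finset.sum_congr rfl fun y _ => ?_
  rw [(toNumber n).symm_apply_apply]
  rfl

/-- The state of phase estimation. -/
noncomputable def phaseEstimationState (O : Matrix (Fin (2 ^ L)) (Fin (2 ^ L)) ℂ) (m : ℕ) [NeZero m]
    (κ : Fin L → Fin 2) : (Fin m ⊕ WalkWire L → Fin 2) → ℂ :=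
  (phaseEstimation L m).eval O *ᵥ Pi.single (Sum.elim 0 (walkBasis κ)) 1

/-- For each fixed basis state `u` of the walk wires, the counter holds the inverse Fourier
transform of the sequence `a_j (U^j φ)(u)`, so the discrete Fourier analysis can be done separately
for each `u`. -/
theorem slice_phaseEstimationState {O : Matrix (Fin (2 ^ L)) (Fin (2 ^ L)) ℂ}
    (hO : O ∈ Matrix.unitaryGroup (Fin (2 ^ L)) ℂ)
    {c : EuclideanSpace ℂ (Fin (2 ^ L))} (hOc : ∀ j, O j 0 = c j) (m : ℕ) [NeZero m]
    (κ : Fin L → Fin 2) (z : Fin m → Fin 2) (u : WalkWire L → Fin 2) :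
    slice (phaseEstimationState O m κ) z u = ((fourierMatrix (2 ^ m))ᴴ *ᵥ fun j =>
      counterAmplitude j * (walkOperator O ^ (j : ℕ) *ᵥ walkState c κ) u) (toNumber m z) := by
  have hinit (u : WalkWire L → Fin 2) : (fun z' => slice
      (Pi.single (Sum.elim (0 : Fin m → Fin 2) (walkBasis κ)) 1 : (Fin m ⊕ WalkWire L → Fin 2) → ℂ)
      z' u) = (Pi.single (walkBasis κ) 1 : (WalkWire L → Fin 2) → ℂ) u • Pi.single 0 1 := by
    funext z
    simp only [slice, Pi.single_apply, Pi.smul_apply, smul_eq_mul, Sum.elim_eq_iff]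
    by_cases h1 : z = 0 <;> by_cases h2 : u = walkBasis κ <;> simp [h1, h2]
  have hprep (z' : Fin m → Fin 2) : slice (onWires .inl ((counterPreparation L m).eval O) *ᵥ
      (Pi.single (Sum.elim (0 : Fin m → Fin 2) (walkBasis κ)) 1 :
        (Fin m ⊕ WalkWire L → Fin 2) → ℂ)) z' =
      counterAmplitude (toNumber m z') • Pi.single (walkBasis κ) 1 := by
    funext u
    rw [slice_onWires_inl, hinit, Matrix.mulVec_smul, counterPreparation_mulVec, Pi.smul_apply,
      Pi.smul_apply, smul_eq_mul, smul_eq_mul, mul_comm]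
  rw [phaseEstimationState, phaseEstimation]
  simp only [Circuit.eval_append, Circuit.eval_mapWires, ← Matrix.mulVec_mulVec,
    slice_onWires_inl, slice_walkPowers hO, slice_onWires_inr, hprep, Matrix.mulVec_smul,
    walkPreparation_mulVec hOc, Circuit.eval_inv, eval_fourierCircuit, ← onQubits_conjTranspose,
    onQubits_mulVec, Pi.smul_apply, smul_eq_mul, (toNumber m).apply_symm_apply]
  congr 2
  funext j
  rw [← toNumber_val, (toNumber m).apply_symm_apply]

theorem Fin.val_add_one_of_ne_zero {N : ℕ} [NeZero N] {j : Fin N} (h : j + 1 ≠ 0) :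
    ((j + 1 : Fin N) : ℕ) = j + 1 := by
  have hv : ((j + 1 : Fin N) : ℕ) = ((j : ℕ) + 1) % N := by
    rw [Fin.val_add, Fin.val_one', Nat.add_mod_mod]
  rw [hv]
  refine Nat.mod_eq_of_lt (lt_of_le_of_ne j.2 fun hN => h (Fin.ext ?_))
  rw [hv, hN, Fin.val_zero, Nat.mod_self]

/-- The mean square error of the estimate of `F_k` by phase estimation. -/
theorem phaseEstimationState_meanSquare {O : Matrix (Fin (2 ^ L)) (Fin (2 ^ L)) ℂ}
    (hO : O ∈ Matrix.unitaryGroup (Fin (2 ^ L)) ℂ)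
    {c : EuclideanSpace ℂ (Fin (2 ^ L))} (hOc : ∀ j, O j 0 = c j) (m : ℕ) [NeZero m]
    (κ : Fin L → Fin 2)
    (hreal : starRingEnd ℂ (dftCoeff c (toNumber L κ)) = dftCoeff c (toNumber L κ)) :
    ∑ x, ‖(gridCos (2 ^ m) (binaryValue (x ∘ Sum.inl)) : ℂ) - dftCoeff c (toNumber L κ)‖ ^ 2 *
      ‖phaseEstimationState O m κ x‖ ^ 2 ≤ 2 * Real.pi ^ 2 / (2 ^ m) ^ 2 := by
  set F := dftCoeff c (toNumber L κ) with hF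
  set U := walkOperator O with hU
  set φ := walkState c κ with hφ
  have hUU := walkOperator_mem_unitaryGroup hO
  have hUstar : Uᴴ * U = 1 := Matrix.mem_unitaryGroup_iff'.mp hUU
  set v : (WalkWire L → Fin 2) → Fin (2 ^ m) → ℂ := fun u j =>
    counterAmplitude j * (U ^ (j : ℕ) *ᵥ φ) u with hv
  have hnorm (n : ℕ) : ∑ u, ‖(U ^ n *ᵥ φ) u‖ ^ 2 = 1 := by
    rw [sum_norm_sq_mulVec (pow_mem hUU n), hφ, ← walkPreparation_mulVec hOc κ,
      sum_norm_sq_mulVec (Circuit.eval_mem_unitaryGroup hO _),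
      Finset.sum_eq_single (walkBasis κ)]
    · simp
    · intro x _ hx
      simp [Pi.single_eq_of_ne hx]
    · simp
  -- This is the relation for the real part of `U`, multiplied by `U^n`. The lower neighbour is kept
  -- as `U†U^nφ`, so that `n = 0` needs no exception.
  have hrec (n : ℕ) (u : WalkWire L → Fin 2) :
      F * (U ^ n *ᵥ φ) u = ((U ^ (n + 1) *ᵥ φ) u + (Uᴴ *ᵥ (U ^ n *ᵥ φ)) u) / 2 := by
    have hcomm : Uᴴ * U ^ n = U ^ n * Uᴴ := by
      have : Commute Uᴴ U := by
        rw [Commute, SemiconjBy, hUstar]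
        exact (Matrix.mem_unitaryGroup_iff.mp hUU).symm
      exact (this.pow_right n).eq
    have h := congrFun (congrArg (U ^ n *ᵥ ·)
      (walkOperator_add_conjTranspose_mulVec hO hOc κ hreal)) u
    simp only [← hU, ← hφ, ← hF, Matrix.mulVec_add, Matrix.mulVec_smul, Pi.add_apply,
      Pi.smul_apply, smul_eq_mul, Matrix.mulVec_mulVec, ← pow_succ, ← hcomm] at h
    rw [Matrix.mulVec_mulVec, h]
    ring
  have hpoint (j : Fin (2 ^ m)) (u : WalkWire L → Fin 2) :
      ‖(v u (j + 1) + v u (j - 1)) / 2 - F * v u j‖ ^ 2 ≤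
        ‖fourierChar (1 : Fin (2 ^ m)) 1 - 1‖ ^ 2 / (2 * 2 ^ m) *
          ((‖(U ^ ((j : ℕ) + 1) *ᵥ φ) u‖ ^ 2 + ‖(U ^ ((j - 1 : Fin (2 ^ m)) : ℕ) *ᵥ φ) u‖ ^ 2) / 2) := by
    -- At the wraparound `j + 1 = 0` the exponents differ, but the amplitude is zero.
    have h1 : v u (j + 1) = counterAmplitude (j + 1) * (U ^ ((j : ℕ) + 1) *ᵥ φ) u := by
      by_cases hj : j + 1 = 0
      · rw [hv]
        simp only [hj, counterAmplitude_zero, zero_mul]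
      · have : ((j + 1 : Fin (2 ^ m)) : ℕ) = j + 1 := Fin.val_add_one_of_ne_zero hj
        rw [hv]
        simp only [this]
    -- For `j = 0` the cyclic predecessor has exponent `2^m - 1` instead of `-1`; again the
    -- amplitude vanishes.
    have h2 : counterAmplitude j * (Uᴴ *ᵥ (U ^ (j : ℕ) *ᵥ φ)) u =
        counterAmplitude j * (U ^ ((j - 1 : Fin (2 ^ m)) : ℕ) *ᵥ φ) u := by
      by_cases hj : j = 0
      · rw [hj, counterAmplitude_zero, zero_mul, zero_mul]
      · have : (j : ℕ) = ((j - 1 : Fin (2 ^ m)) : ℕ) + 1 := by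
          rw [← Fin.val_add_one_of_ne_zero] <;> rw [sub_add_cancel]
          exact hj
        rw [this, pow_succ', Matrix.mulVec_mulVec, ← mul_assoc, hUstar, one_mul]
    have h3 : (v u (j + 1) + v u (j - 1)) / 2 - F * v u j =
        ((counterAmplitude (j + 1) - counterAmplitude j) * (U ^ ((j : ℕ) + 1) *ᵥ φ) u +
        (counterAmplitude (j - 1) - counterAmplitude j) *
          (U ^ ((j - 1 : Fin (2 ^ m)) : ℕ) *ᵥ φ) u) / 2 := by
      rw [h1, hv]
      simp only
      rw [mul_left_comm F, hrec, sub_mul _ _ ((U ^ ((j - 1 : Fin (2 ^ m)) : ℕ) *ᵥ φ) u), ← h2]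
      ring
    have h4 : ‖counterAmplitude (j - 1) - counterAmplitude j‖ ^ 2 =
        ‖fourierChar (1 : Fin (2 ^ m)) 1 - 1‖ ^ 2 / (2 * 2 ^ m) := by
      rw [norm_sub_rev, ← norm_counterAmplitude_add_sub (j - 1), sub_add_cancel]
    rw [h3]
    generalize hA : (counterAmplitude (j + 1) - counterAmplitude j) *
      (U ^ ((j : ℕ) + 1) *ᵥ φ) u = A
    generalize hB : (counterAmplitude (j - 1) - counterAmplitude j) *
      (U ^ ((j - 1 : Fin (2 ^ m)) : ℕ) *ᵥ φ) u = B
    have hAB : ‖(A + B) / 2‖ ^ 2 ≤ (‖A‖ ^ 2 + ‖B‖ ^ 2) / 2 := by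
      rw [norm_div, Complex.norm_ofNat]
      have := norm_add_le A B
      have h0 := norm_nonneg (A + B)
      nlinarith [sq_nonneg (‖A‖ - ‖B‖)]
    refine hAB.trans (le_of_eq ?_)
    rw [← hA, ← hB, norm_mul, norm_mul, mul_pow, mul_pow, h4, norm_counterAmplitude_add_sub]
    ring
  have hm : m ≠ 0 := NeZero.ne m
  -- The error is rewritten by Parseval as a sum over counter positions. Each of the `2^m` positions
  -- contributes at most `‖ω - 1‖²/(2 · 2^m)`, since the states `U^nφ` are unit vectors.
  calc ∑ x, ‖(gridCos (2 ^ m) (binaryValue (x ∘ Sum.inl)) : ℂ) - F‖ ^ 2 *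
        ‖phaseEstimationState O m κ x‖ ^ 2
      = ∑ u, ∑ j, ‖(v u (j + 1) + v u (j - 1)) / 2 - F * v u j‖ ^ 2 := by
        rw [← (Equiv.sumArrowEquivProdArrow (Fin m) (WalkWire L) (Fin 2)).symm.sum_comp,
          Fintype.sum_prod_type, Finset.sum_comm]
        refine Finset.sum_congr rfl fun u _ => ?_
        rw [← sum_norm_sq_gridCos_sub hm, ← (toNumber m).sum_comp]
        refine Finset.sum_congr rfl fun z _ => ?_
        rw [norm_mul, mul_pow, hv, ← slice_phaseEstimationState hO hOc, toNumber_val]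
        rfl
    _ ≤ ∑ u, ∑ j : Fin (2 ^ m), ‖fourierChar (1 : Fin (2 ^ m)) 1 - 1‖ ^ 2 / (2 * 2 ^ m) *
          ((‖(U ^ ((j : ℕ) + 1) *ᵥ φ) u‖ ^ 2 +
            ‖(U ^ ((j - 1 : Fin (2 ^ m)) : ℕ) *ᵥ φ) u‖ ^ 2) / 2) :=
        Finset.sum_le_sum fun u _ => Finset.sum_le_sum fun j _ => hpoint j u
    _ = ‖fourierChar (1 : Fin (2 ^ m)) 1 - 1‖ ^ 2 / 2 := by
        rw [Finset.sum_comm]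
        simp only [← Finset.mul_sum, ← Finset.sum_div, Finset.sum_add_distrib, hnorm]
        rw [Finset.sum_const, Finset.card_univ, Fintype.card_fin]
        simp only [nsmul_eq_mul]
        push_cast
        field_simp
        norm_num
    _ ≤ (2 * Real.pi / 2 ^ m) ^ 2 / 2 := by
        gcongr
        exact norm_fourierChar_one_one_sub_le hm
    _ = _ := by
        field_simp

end PhaseEstimation

/-! ### Table lookup -/

section Lookup

variable {m P : ℕ}

/-- The ancillas of the table lookup: for each length `i`, wires that mark the first `i` bits of the
input and of the output, and the output register. -/
inductive LookupAncilla (m P : ℕ) : Type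
  | enc (i : Fin (m + 1)) (s : Fin m → Fin 2) : LookupAncilla m P
  | dec (i : Fin (P + 1)) (s : Fin P → Fin 2) : LookupAncilla m P
  | out (i : Fin P) : LookupAncilla m P
  deriving DecidableEq, Fintype

/-- The wires of the table lookup. -/
abbrev LookupWire (m P : ℕ) : Type := Fin m ⊕ LookupAncilla m P

/-- The bit strings whose bits from position `i` on are zero. -/
def prefixes (n i : ℕ) : Finset (Fin n → Fin 2) :=
  Fintype.piFinset fun l => if (l : ℕ) < i then Finset.univ else {0}

theorem mem_prefixes {n i : ℕ} {s : Fin n → Fin 2} :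
    s ∈ prefixes n i ↔ ∀ l : Fin n, i ≤ l → s l = 0 := by
  rw [prefixes, Fintype.mem_piFinset]
  refine forall_congr' fun l => ?_
  split_ifs with h
  · simpa using fun h' => absurd h (not_lt.mpr h')
  · simp [not_lt.mp h]

theorem card_prefixes_le {n i : ℕ} : (prefixes n i).card ≤ 2 ^ i := by
  rw [prefixes, Fintype.card_piFinset]
  have h (l : Fin n) : (if (l : ℕ) < i then Finset.univ else ({0} : Finset (Fin 2))).card =
      if (l : ℕ) < i then 2 else 1 := by
    split_ifs <;> simp
  simp only [h]
  rw [Finset.prod_ite, Finset.prod_const, Finset.prod_const_one, mul_one]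
  refine Nat.pow_le_pow_right two_pos ?_
  refine le_of_le_of_eq (Finset.card_le_card_of_injOn (t := Finset.range i) (fun l => (l : ℕ))
    ?_ ?_) (Finset.card_range i)
  · intro l hl
    simpa using hl
  · exact fun l _ l' _ h => Fin.ext h

theorem update_mem_prefixes {n : ℕ} {i : Fin n} {s : Fin n → Fin 2} (h : s ∈ prefixes n (i + 1)) :
    Function.update s i 0 ∈ prefixes n i := by
  rw [mem_prefixes] at h ⊢
  intro l hl
  by_cases hli : l = i
  · simp [hli]
  · rw [Function.update_of_ne hli]
    exact h l (lt_of_le_of_ne hl fun h' => hli (Fin.ext h'.symm))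

theorem update_one_mem_prefixes {n : ℕ} {i : Fin n} {s : Fin n → Fin 2} (b : Fin 2)
    (h : s ∈ prefixes n i) : Function.update s i b ∈ prefixes n (i + 1) := by
  rw [mem_prefixes] at h ⊢
  intro l hl
  have hli : l ≠ i := by
    rintro rfl
    omega
  rw [Function.update_of_ne hli]
  exact h l (by omega)

/-- The order in which the wires of the table lookup are computed. -/
def lookupRank : LookupWire m P → ℕ
  | Sum.inl _ => 0
  | Sum.inr (.enc i _) => i + 1
  | Sum.inr (.dec i _) => m + 2 + (P - i)
  | Sum.inr (.out _) => m + P + 3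

theorem sum_ite_eq_of_injOn {α ι : Type*} [DecidableEq ι] (S : Finset α) (τ : α → ι)
    (w : α → Fin 2) {p : α} (hp : p ∈ S) (h : ∀ q ∈ S, τ q = τ p → q = p) :
    ∑ q ∈ S, (if τ q = τ p then w q else 0) = w p := by
  rw [Finset.sum_eq_single p]
  · simp
  · exact fun q hq hqp => if_neg fun h' => hqp (h q hq h')
  · exact fun h' => absurd hp h'

/-- The gates that mark a prefix of the input whose last bit is as given. -/
def encodeGate (p : Σ _ : Fin m, Fin m → Fin 2) : ClassicalGate (LookupWire m P) :=
  .toffoli (Sum.inr (.enc p.1.castSucc (Function.update p.2 p.1 0))) (Sum.inl p.1)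
    (Sum.inr (.enc p.1.succ p.2)) (by simp) (by simp [Fin.ext_iff]) (by simp)

/-- The gates that flip the mark of a prefix of the input which ends in zero. -/
def encodeZeroGate (p : Σ _ : Fin m, Fin m → Fin 2) : ClassicalGate (LookupWire m P) :=
  .cnot (Sum.inr (.enc p.1.castSucc p.2)) (Sum.inr (.enc p.1.succ p.2)) (by simp [Fin.ext_iff])

/-- The gates that map the marks of full inputs to those of full outputs. -/
def tableGate (f : (Fin m → Fin 2) → Fin P → Fin 2) (s : Fin m → Fin 2) :
    ClassicalGate (LookupWire m P) :=
  .cnot (Sum.inr (.enc (Fin.last m) s)) (Sum.inr (.dec (Fin.last P) (f s))) (by simp)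

/-- The gates that mark the prefixes of the output. -/
def decodeGate (b : Fin 2) (p : Σ _ : Fin P, Fin P → Fin 2) : ClassicalGate (LookupWire m P) :=
  .cnot (Sum.inr (.dec p.1.succ (Function.update p.2 p.1 b))) (Sum.inr (.dec p.1.castSucc p.2))
    (by simp [Fin.ext_iff])

/-- The gates that compute the output. -/
def outputGate (p : Σ _ : Fin P, Fin P → Fin 2) : ClassicalGate (LookupWire m P) :=
  .cnot (Sum.inr (.dec p.1.succ (Function.update p.2 p.1 1))) (Sum.inr (.out p.1)) (by simp)

/-- The gates of the table lookup. -/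
noncomputable def lookupGates (f : (Fin m → Fin 2) → Fin P → Fin 2) :
    List (ClassicalGate (LookupWire m P)) :=
  .not (Sum.inr (.enc 0 0)) ::
    (((Finset.univ.sigma fun i : Fin m => prefixes m (i + 1)).toList.map encodeGate) ++
    ((Finset.univ.sigma fun i : Fin m => prefixes m i).toList.map encodeZeroGate) ++
    ((Finset.univ : Finset (Fin m → Fin 2)).toList.map (tableGate f)) ++
    ((Finset.univ.sigma fun i : Fin P => prefixes P i).toList.map (decodeGate 0)) ++
    ((Finset.univ.sigma fun i : Fin P => prefixes P i).toList.map (decodeGate 1)) ++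
    ((Finset.univ.sigma fun i : Fin P => prefixes P i).toList.map outputGate))

/-- Level `i` of either binary tree has at most `2^i` prefixes, so the level sizes form a geometric
sum. Reading output digit `i` from the prefixes of length `i + 1`, rather than from the full table,
keeps the cost free of a factor `P`. -/
theorem length_lookupGates_le (f : (Fin m → Fin 2) → Fin P → Fin 2) :
    (lookupGates f).length ≤ 1 + 4 * 2 ^ m + 3 * 2 ^ P := by
  have h (n : ℕ) : ∑ i : Fin n, (prefixes n i).card ≤ 2 ^ n :=
    (Finset.sum_le_sum fun i _ => card_prefixes_le).trans (sum_two_pow_le n)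
  have h' : ∑ i : Fin m, (prefixes m (i + 1)).card ≤ 2 * 2 ^ m := by
    refine (Finset.sum_le_sum fun i _ => card_prefixes_le).trans ?_
    simp only [pow_succ, ← Finset.sum_mul]
    rw [mul_comm]
    exact Nat.mul_le_mul_left 2 (sum_two_pow_le m)
  have h1 := h m
  have h2 := h P
  simp only [lookupGates, List.length_cons, List.length_append, List.length_map,
    Finset.length_toList, Finset.card_sigma, Finset.card_univ, Fintype.card_pi, Fintype.card_fin,
    Finset.prod_const]
  omega

theorem mem_lookupGates {f : (Fin m → Fin 2) → Fin P → Fin 2} {g : ClassicalGate (LookupWire m P)} :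
    g ∈ lookupGates f → g = .not (Sum.inr (.enc 0 0)) ∨ (∃ p, encodeGate p = g) ∨
      (∃ p, encodeZeroGate p = g) ∨ (∃ s, tableGate f s = g) ∨ (∃ b p, decodeGate b p = g) ∨
      ∃ p, outputGate p = g := by
  intro h
  simp only [lookupGates, List.mem_cons, List.mem_append, List.mem_map] at h
  rcases h with h | (((((⟨p, -, h⟩ | ⟨p, -, h⟩) | ⟨p, -, h⟩) | ⟨p, -, h⟩) | ⟨p, -, h⟩) | ⟨p, -, h⟩)
  exacts [.inl h, .inr (.inl ⟨p, h⟩), .inr (.inr (.inl ⟨p, h⟩)), .inr (.inr (.inr (.inl ⟨p, h⟩))),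
    .inr (.inr (.inr (.inr (.inl ⟨0, p, h⟩)))), .inr (.inr (.inr (.inr (.inl ⟨1, p, h⟩)))),
    .inr (.inr (.inr (.inr (.inr ⟨p, h⟩))))]

theorem lookupGates_target {f : (Fin m → Fin 2) → Fin P → Fin 2}
    {g : ClassicalGate (LookupWire m P)} (h : g ∈ lookupGates f) : ∃ a, g.target = Sum.inr a := by
  rcases mem_lookupGates h with rfl | ⟨p, rfl⟩ | ⟨p, rfl⟩ | ⟨p, rfl⟩ | ⟨b, p, rfl⟩ | ⟨p, rfl⟩ <;>
    exact ⟨_, rfl⟩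

theorem lookupGates_rank {f : (Fin m → Fin 2) → Fin P → Fin 2}
    {g : ClassicalGate (LookupWire m P)} (h : g ∈ lookupGates f) :
    ∀ a ∈ g.sources, lookupRank a < lookupRank g.target := by
  intro a ha
  rcases mem_lookupGates h with rfl | ⟨p, rfl⟩ | ⟨p, rfl⟩ | ⟨p, rfl⟩ | ⟨b, p, rfl⟩ | ⟨p, rfl⟩ <;>
    simp only [encodeGate, encodeZeroGate, tableGate, decodeGate, outputGate,
      ClassicalGate.sources, List.mem_cons, List.not_mem_nil, or_false] at ha
  · rcases ha with rfl | rfl <;>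
      simp [encodeGate, ClassicalGate.target, lookupRank]
  all_goals
    subst ha
    simp [encodeZeroGate, tableGate, decodeGate, outputGate, ClassicalGate.target, lookupRank]
  all_goals omega

/-- The final bits of a run of the table lookup `f` for the input `y`. -/
def IsLookupResult (f : (Fin m → Fin 2) → Fin P → Fin 2) (y : Fin m → Fin 2)
    (x : LookupAncilla m P → Fin 2) : Prop :=
  ∀ a, x a = (if .enc 0 0 = a then 1 else 0) +
    (∑ p ∈ Finset.univ.sigma fun i : Fin m => prefixes m (i + 1),
      (if .enc p.1.succ p.2 = a then
        x (.enc p.1.castSucc (Function.update p.2 p.1 0)) * y p.1 else 0) +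
    ∑ p ∈ Finset.univ.sigma fun i : Fin m => prefixes m i,
      (if .enc p.1.succ p.2 = a then x (.enc p.1.castSucc p.2) else 0) +
    ∑ s, (if .dec (Fin.last P) (f s) = a then x (.enc (Fin.last m) s) else 0) +
    ∑ p ∈ Finset.univ.sigma fun i : Fin P => prefixes P i,
      (if .dec p.1.castSucc p.2 = a then x (.dec p.1.succ (Function.update p.2 p.1 0)) else 0) +
    ∑ p ∈ Finset.univ.sigma fun i : Fin P => prefixes P i,
      (if .dec p.1.castSucc p.2 = a then x (.dec p.1.succ (Function.update p.2 p.1 1)) else 0) +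
    ∑ p ∈ Finset.univ.sigma fun i : Fin P => prefixes P i,
      (if .out p.1 = a then x (.dec p.1.succ (Function.update p.2 p.1 1)) else 0))

/-- The branching rule of the input tree: with mark `A`, chosen bit `b` and input bit `c`, the
child's mark is `A c` for `b = 1`, and `A c + A = A (1 - c)` for `b = 0`. -/
theorem fin_two_ite_mul_add (A : Prop) (b c : Fin 2) [Decidable A] [Decidable (A ∧ b = c)] :
    (if A then 1 else 0) * c + (if b = 0 then if A then 1 else 0 else 0) =
      if A ∧ b = c then (1 : Fin 2) else 0 := by
  by_cases hA : A
  · simp only [hA, true_and, if_true]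
    revert b c
    intro b c _
    rcases fin_two_eq_zero_or_one b with rfl | rfl <;>
      rcases fin_two_eq_zero_or_one c with rfl | rfl <;> simp
  · simp [hA]

theorem fin_two_ite_add_ite (A : Prop) (b : Fin 2) [Decidable A] [Decidable (A ∧ 0 = b)]
    [Decidable (A ∧ 1 = b)] :
    (if A ∧ 0 = b then 1 else 0) + (if A ∧ 1 = b then 1 else 0) =
      if A then (1 : Fin 2) else 0 := by
  rcases fin_two_eq_zero_or_one b with rfl | rfl <;> simp

theorem forall_lt_succ_update_iff {n : ℕ} (i : Fin n) (s v : Fin n → Fin 2) (b : Fin 2) :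
    (∀ l : Fin n, (l : ℕ) < i + 1 → Function.update s i b l = v l) ↔
      (∀ l : Fin n, (l : ℕ) < i → s l = v l) ∧ b = v i := by
  constructor
  · intro h
    refine ⟨fun l hl => ?_, ?_⟩
    · rw [← h l (by omega), Function.update_of_ne (by rintro rfl; omega)]
    · rw [← h i (Nat.lt_succ_self _), Function.update_self]
  · rintro ⟨h, hi⟩ l hl
    by_cases hli : l = i
    · rw [hli, hi, Function.update_self]
    · have : (l : ℕ) ≠ i := fun h' => hli (Fin.ext h')
      rw [Function.update_of_ne hli, h l (by omega)]

/-- Induction down the binary tree: a prefix is marked exactly when its parent is marked and its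
last bit matches the input. Prefixes are padded with zeros, so the parent arises by resetting bit
`i` to zero. -/
theorem IsLookupResult.enc {f : (Fin m → Fin 2) → Fin P → Fin 2} {y : Fin m → Fin 2}
    {x : LookupAncilla m P → Fin 2} (heq : IsLookupResult f y x) (i : Fin (m + 1)) :
    ∀ s ∈ prefixes m i, x (.enc i s) = if ∀ l : Fin m, (l : ℕ) < i → s l = y l then 1 else 0 := by
  refine Fin.induction ?_ (fun i ih => ?_) i
  · intro s hs
    have hs0 : s = 0 := funext fun l => mem_prefixes.mp hs l (Nat.zero_le _)
    subst hs0
    rw [heq]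
    simp [Fin.succ_ne_zero]
  · intro s hs
    have hs : s ∈ prefixes m (i + 1) := hs
    have h1 := sum_ite_eq_of_injOn (Finset.univ.sigma fun i : Fin m => prefixes m (i + 1))
      (fun p => LookupAncilla.enc (P := P) p.1.succ p.2)
      (fun p => x (.enc p.1.castSucc (Function.update p.2 p.1 0)) * y p.1)
      (p := ⟨i, s⟩) (by simpa using hs) (by
        rintro ⟨i', s'⟩ - h
        simp at h
        simp [h])
    have h2 : ∑ p ∈ Finset.univ.sigma fun i : Fin m => prefixes m i,
        (if LookupAncilla.enc (P := P) p.1.succ p.2 = .enc i.succ s then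
          x (.enc p.1.castSucc p.2) else 0) =
        if s i = 0 then x (.enc i.castSucc (Function.update s i 0)) else 0 := by
      split_ifs with h
      · have hs' : Function.update s i 0 = s := by rw [← h, Function.update_eq_self]
        rw [hs']
        refine sum_ite_eq_of_injOn (Finset.univ.sigma fun i : Fin m => prefixes m i)
          (fun p => LookupAncilla.enc (P := P) p.1.succ p.2)
          (fun p => x (.enc p.1.castSucc p.2)) (p := ⟨i, s⟩) ?_ ?_
        · have := update_mem_prefixes hs
          rw [hs'] at this
          simpa using this
        · rintro ⟨i', s'⟩ - h
          simp at h
          simp [h]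
      · refine Finset.sum_eq_zero fun p hp => if_neg fun h' => h ?_
        simp only [LookupAncilla.enc.injEq, Fin.succ_inj] at h'
        rw [← h'.1, ← h'.2]
        exact mem_prefixes.mp (Finset.mem_sigma.mp hp).2 _ le_rfl
    have h3 : (∀ l : Fin m, (l : ℕ) < i.succ → s l = y l) ↔
        (∀ l : Fin m, (l : ℕ) < i.castSucc → Function.update s i 0 l = y l) ∧ s i = y i := by
      have := forall_lt_succ_update_iff i (Function.update s i 0) y (s i)
      rwa [Function.update_idem, Function.update_eq_self] at this
    beta_reduce at h1
    rw [heq, h1, h2, ih _ (update_mem_prefixes hs), if_congr h3 rfl rfl]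
    simp only [reduceCtorEq, if_false, Finset.sum_const_zero, add_zero, LookupAncilla.enc.injEq,
      (Fin.succ_ne_zero i).symm, false_and, zero_add]
    exact fin_two_ite_mul_add _ _ _

/-- Induction from the leaves to the root: at the leaves the table copies the single marked input to
its output, and every shorter prefix adds its two children. At most one child is marked, so addition
modulo two is a disjunction. -/
theorem IsLookupResult.dec {f : (Fin m → Fin 2) → Fin P → Fin 2} {y : Fin m → Fin 2}
    {x : LookupAncilla m P → Fin 2} (heq : IsLookupResult f y x) (i : Fin (P + 1)) :
    ∀ s ∈ prefixes P i,
      x (.dec i s) = if ∀ l : Fin P, (l : ℕ) < i → s l = f y l then 1 else 0 := by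
  refine Fin.reverseInduction ?_ (fun i ih => ?_) i
  · intro s _
    have hlast (s' : Fin m → Fin 2) : x (.enc (Fin.last m) s') = if s' = y then 1 else 0 := by
      rw [heq.enc _ _ (mem_prefixes.mpr fun l hl => absurd l.2 (not_lt.mpr hl))]
      simp [funext_iff]
    rw [heq]
    simp only [reduceCtorEq, if_false, Finset.sum_const_zero, add_zero, zero_add,
      LookupAncilla.dec.injEq, Fin.castSucc_ne_last, false_and, true_and, hlast]
    rw [Finset.sum_eq_single y]
    · simp [funext_iff, eq_comm]
    · intro s' _ h
      simp [h]
    · simp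
  · intro s hs
    have hs : s ∈ prefixes P i := hs
    have h1 (b : Fin 2) := sum_ite_eq_of_injOn (Finset.univ.sigma fun i : Fin P => prefixes P i)
      (fun p => LookupAncilla.dec (m := m) p.1.castSucc p.2)
      (fun p => x (.dec p.1.succ (Function.update p.2 p.1 b)))
      (p := ⟨i, s⟩) (by simpa using hs) (by
        rintro ⟨i', s'⟩ - h
        simp at h
        simp [h])
    have h3 (b : Fin 2) : (∀ l : Fin P, (l : ℕ) < i.succ → Function.update s i b l = f y l) ↔
        (∀ l : Fin P, (l : ℕ) < i.castSucc → s l = f y l) ∧ b = f y i :=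
      forall_lt_succ_update_iff i s (f y) b
    have h4 (b : Fin 2) := ih _ (update_one_mem_prefixes b hs)
    beta_reduce at h1
    rw [heq, h1, h1, h4, h4, if_congr (h3 0) rfl rfl, if_congr (h3 1) rfl rfl]
    simp only [reduceCtorEq, if_false, Finset.sum_const_zero, add_zero, zero_add,
      LookupAncilla.dec.injEq, (Fin.castSucc_ne_last _).symm, false_and]
    exact fin_two_ite_add_ite _ _

/-- Digit `i` adds the marks of all prefixes of length `i + 1` that end in one. The only candidate
is the prefix `s₀` of `f y` extended by one, and it is marked exactly when the digit is one. -/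
theorem IsLookupResult.out {f : (Fin m → Fin 2) → Fin P → Fin 2} {y : Fin m → Fin 2}
    {x : LookupAncilla m P → Fin 2} (heq : IsLookupResult f y x) (i : Fin P) :
    x (.out i) = f y i := by
  obtain ⟨s₀, hdef⟩ : ∃ s₀ : Fin P → Fin 2, ∀ l, s₀ l = if (l : ℕ) < i then f y l else 0 :=
    ⟨_, fun _ => rfl⟩
  have hs₀ : s₀ ∈ prefixes P i :=
    mem_prefixes.mpr fun l hl => (hdef l).trans (if_neg (not_lt.mpr hl))
  have hpre (s : Fin P → Fin 2) (hs : s ∈ prefixes P i) :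
      (∀ l : Fin P, (l : ℕ) < i → s l = f y l) ↔ s = s₀ := by
    constructor
    · intro h
      funext l
      rw [hdef]
      by_cases hl : (l : ℕ) < i
      · rw [if_pos hl, h l hl]
      · rw [if_neg hl, mem_prefixes.mp hs l (not_lt.mp hl)]
    · rintro rfl l hl
      rw [hdef, if_pos hl]
  have hval (s : Fin P → Fin 2) (hs : s ∈ prefixes P i) :
      x (.dec i.succ (Function.update s i 1)) = if s = s₀ ∧ 1 = f y i then 1 else 0 := by
    have h := heq.dec i.succ _ (update_one_mem_prefixes 1 hs)
    have h' : (∀ l : Fin P, (l : ℕ) < (i.succ : ℕ) → Function.update s i 1 l = f y l) ↔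
        s = s₀ ∧ 1 = f y i :=
      (forall_lt_succ_update_iff i s (f y) 1).trans (and_congr_left' (hpre s hs))
    rw [h, if_congr h' rfl rfl]
  rw [heq]
  simp only [reduceCtorEq, if_false, Finset.sum_const_zero, add_zero, zero_add,
    LookupAncilla.out.injEq]
  rw [Finset.sum_eq_single (⟨i, s₀⟩ : Σ _ : Fin P, Fin P → Fin 2), if_pos rfl, hval s₀ hs₀]
  · rcases fin_two_eq_zero_or_one (f y i) with h | h <;> simp [h]
  · rintro ⟨i', s⟩ hp hne
    split_ifs with hi
    · simp only at hi
      subst hi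
      rw [hval s (Finset.mem_sigma.mp hp).2, if_neg]
      rintro ⟨rfl, -⟩
      exact hne rfl
    · rfl
  · exact fun h => absurd (Finset.mem_sigma.mpr ⟨Finset.mem_univ _, hs₀⟩) h

/-- Every source precedes its target in the order by `lookupRank`, so the gates can be ordered to
make the final bits solve the equations in `IsLookupResult`. Those equations determine the output
without following the run of the circuit. -/
theorem exists_lookup (f : (Fin m → Fin 2) → Fin P → Fin 2) :
    ∃ l : List (ClassicalGate (LookupWire m P)), l.length ≤ 1 + 4 * 2 ^ m + 3 * 2 ^ P ∧
      (∀ g ∈ l, ∃ a, g.target = Sum.inr a) ∧ ∀ x : LookupWire m P → Fin 2,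
        (∀ a, x (Sum.inr a) = 0) →
          ∀ i, runClassical l x (Sum.inr (.out i)) = f (x ∘ Sum.inl) i := by
  obtain ⟨l, hperm, hrun⟩ := exists_perm_runClassical_apply lookupRank (lookupGates f)
    fun g hg => lookupGates_rank hg
  have htarget : ∀ g ∈ l, ∃ a, g.target = Sum.inr a :=
    fun g hg => lookupGates_target (hperm.mem_iff.mp hg)
  refine ⟨l, hperm.length_eq.trans_le (length_lookupGates_le f), htarget, fun x hx => ?_⟩
  have hin (i : Fin m) : runClassical l x (Sum.inl i) = x (Sum.inl i) := by
    refine runClassical_of_forall_target_ne l x fun g hg => ?_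
    obtain ⟨a, ha⟩ := htarget g hg
    rw [ha]
    exact Sum.inl_ne_inr
  refine IsLookupResult.out (x := fun a => runClassical l x (Sum.inr a)) fun a => ?_
  refine (hrun x (Sum.inr a)).trans ?_
  rw [hx, zero_add]
  simp only [lookupGates, List.map_cons, List.map_append, List.map_map, List.sum_cons,
    List.sum_append, Finset.sum_map_toList, Function.comp_apply, encodeGate, encodeZeroGate,
    tableGate, decodeGate, outputGate, ClassicalGate.target, ClassicalGate.increment,
    Sum.inr.injEq, hin]

end Lookup

/-! ### Digits of real numbers -/

section Digits

/-- The leading digit `b` is chosen with `2u - b` again in `[0, 1]`. The endpoint `u = 1` has no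
terminating expansion of this form, but all ones miss it by exactly `2^{-p}`, so the nonstrict bound
covers the closed interval. -/
theorem exists_digits (p : ℕ) {u : ℝ} (h0 : 0 ≤ u) (h1 : u ≤ 1) :
    ∃ g : Fin p → Fin 2, |∑ i : Fin p, ((g i : ℕ) : ℝ) / 2 ^ ((i : ℕ) + 1) - u| ≤ 1 / 2 ^ p := by
  induction p generalizing u with
  | zero => exact ⟨0, by simpa [abs_of_nonneg h0] using h1⟩
  | succ p ih =>
    have key (b : Fin 2) (hb0 : 0 ≤ 2 * u - (b : ℕ)) (hb1 : 2 * u - (b : ℕ) ≤ 1) :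
        ∃ g : Fin (p + 1) → Fin 2,
          |∑ i : Fin (p + 1), ((g i : ℕ) : ℝ) / 2 ^ ((i : ℕ) + 1) - u| ≤ 1 / 2 ^ (p + 1) := by
      obtain ⟨g, hg⟩ := ih hb0 hb1
      refine ⟨Fin.cons b g, ?_⟩
      have h : ∑ i : Fin (p + 1), (((Fin.cons b g : Fin (p + 1) → Fin 2) i : ℕ) : ℝ) /
          2 ^ ((i : ℕ) + 1) - u =
          (∑ i : Fin p, ((g i : ℕ) : ℝ) / 2 ^ ((i : ℕ) + 1) - (2 * u - (b : ℕ))) / 2 := by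
        have hs (i : Fin p) : ((g i : ℕ) : ℝ) / 2 ^ ((i : ℕ) + 1 + 1) =
            ((g i : ℕ) : ℝ) / 2 ^ ((i : ℕ) + 1) / 2 := by
          rw [pow_succ _ ((i : ℕ) + 1), div_div]
        rw [Fin.sum_univ_succ]
        simp only [Fin.cons_zero, Fin.cons_succ, Fin.val_succ, Fin.val_zero, hs,
          ← Finset.sum_div]
        ring
      rw [h, abs_div, abs_two, pow_succ, ← div_div]
      exact div_le_div_of_nonneg_right hg zero_le_two
    by_cases hu : u ≤ 1 / 2
    · exact key 0 (by simpa using h0) (by norm_num; linarith)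
    · exact key 1 (by norm_num; linarith) (by norm_num; linarith)

/-- The sign digit is chosen with `v + b` in `[0, 1]`. The value `1` must be allowed although no
code represents it, since the cosine at `y = 0` is `1`. -/
theorem exists_codeValue (p : ℕ) {v : ℝ} (h0 : -1 ≤ v) (h1 : v ≤ 1) :
    ∃ f : Fin (p + 1) → Fin 2, |codeValue f - v| ≤ 1 / 2 ^ p := by
  have key (b : Fin 2) (hb0 : 0 ≤ v + (b : ℕ)) (hb1 : v + (b : ℕ) ≤ 1) :
      ∃ f : Fin (p + 1) → Fin 2, |codeValue f - v| ≤ 1 / 2 ^ p := by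
    obtain ⟨g, hg⟩ := exists_digits p hb0 hb1
    refine ⟨Fin.cons b g, hg.trans_eq' ?_⟩
    simp only [codeValue, Fin.cons_zero, Fin.cons_succ]
    congr 1
    ring
  by_cases hv : 0 ≤ v
  · exact key 0 (by simpa using hv) (by simpa using h1)
  · exact key 1 (by norm_num; linarith) (by norm_num; linarith)

end Digits

/-! ### Classical circuits on some of the wires -/

section ClassicalOnWires

variable {L : ℕ} {ι κ : Type} [Fintype ι] [DecidableEq ι] [Fintype κ] [DecidableEq κ]

/-- The basis states are permuted. -/
theorem exists_equiv_onWires_classicalCircuit (e : ι ↪ κ) (l : List (ClassicalGate ι)) :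
    ∃ R : (κ → Fin 2) ≃ (κ → Fin 2), (∀ x, R x ∘ e = runClassical l (x ∘ e)) ∧
      (∀ x i, (∀ s, e s ≠ i) → R x i = x i) ∧
      ∀ (O : Matrix (Fin (2 ^ L)) (Fin (2 ^ L)) ℂ) (ψ : (κ → Fin 2) → ℂ) (x : κ → Fin 2),
        (onWires e ((classicalCircuit l).eval O) *ᵥ ψ) (R x) = ψ x := by
  let r (x : κ → Fin 2) : κ → Fin 2 := Function.extend e (runClassical l (x ∘ e)) x
  have hr (x) : r x ∘ e = runClassical l (x ∘ e) := funext fun s => e.injective.extend_apply _ _ _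
  have hr' (x i) (hi : ∀ s, e s ≠ i) : r x i = x i :=
    Function.extend_apply' _ _ _ (by simpa using hi)
  have hinj : Function.Injective r := by
    intro x y hxy
    have h1 : x ∘ e = y ∘ e := runClassical_injective l (by rw [← hr, ← hr, hxy])
    funext i
    by_cases hi : ∃ s, e s = i
    · obtain ⟨s, rfl⟩ := hi
      exact congrFun h1 s
    · have hi' : ∀ s, e s ≠ i := by simpa using hi
      rw [← hr' x i hi', ← hr' y i hi', hxy]
  refine ⟨Equiv.ofBijective r (Finite.injective_iff_bijective.mp hinj), hr, hr', fun O ψ x => ?_⟩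
  change (_ *ᵥ ψ) (r x) = ψ x
  have h := classicalCircuit_mulVec_runClassical O l (fun s => ψ (Function.extend e s (r x))) (x ∘ e)
  rw [onWires_mulVec, hr]
  refine h.trans ?_
  congr 1
  funext i
  by_cases hi : ∃ s, e s = i
  · obtain ⟨s, rfl⟩ := hi
    exact e.injective.extend_apply _ _ _
  · rw [Function.extend_apply' _ _ _ hi]
    exact hr' x i (by simpa using hi)

end ClassicalOnWires

/-! ### The Fourier transform in the computational basis -/

section FourierTransformCircuit

variable {L : ℕ} {O : Matrix (Fin (2 ^ L)) (Fin (2 ^ L)) ℂ}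

theorem preservesWire_walkOperator (hO : O ∈ Matrix.unitaryGroup (Fin (2 ^ L)) ℂ) (i : Fin L) :
    PreservesWire (walkOperator O) (Sum.inl i) := by
  have hprep := preservesWire_walkPreparation O (q := (Sum.inl i : WalkWire L)) (by simp) (by simp)
  refine (hprep.mul ?_).mul (hprep.conjTranspose.mul (preservesWire_oneGate O (by simp) _))
  intro x y hxy
  have h := zeroReflection_mulVec hO (Pi.single y 1) x
  rw [Matrix.mulVec_single_one] at h
  have hx : (Pi.single y 1 : (WalkWire L → Fin 2) → ℂ) x ≠ 0 := by
    intro h0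
    rw [h0, mul_zero] at h
    exact hxy h
  by_contra hne
  exact hx (Pi.single_eq_of_ne (fun h' => hne (by rw [h'])) _)

theorem phaseEstimationState_ne_zero (hO : O ∈ Matrix.unitaryGroup (Fin (2 ^ L)) ℂ)
    {c : EuclideanSpace ℂ (Fin (2 ^ L))} (hOc : ∀ j, O j 0 = c j) (m : ℕ) [NeZero m]
    (κ : Fin L → Fin 2) {x : Fin m ⊕ WalkWire L → Fin 2} (hx : phaseEstimationState O m κ x ≠ 0)
    (i : Fin L) : x (Sum.inr (Sum.inl i)) = κ i := by
  have hs := slice_phaseEstimationState hO hOc m κ (x ∘ Sum.inl) (x ∘ Sum.inr)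
  rw [slice, Sum.elim_comp_inl_inr] at hs
  rw [hs, Matrix.mulVec, dotProduct] at hx
  obtain ⟨j, -, hj⟩ := Finset.exists_ne_zero_of_sum_ne_zero hx
  have hpow (n : ℕ) : PreservesWire (walkOperator O ^ n) (Sum.inl i) := by
    induction n with
    | zero =>
      rw [pow_zero]
      exact .one _
    | succ n ih =>
      rw [pow_succ]
      exact ih.mul (preservesWire_walkOperator hO i)
  generalize (j : ℕ) = n at hj
  have hj' : (walkOperator O ^ n *ᵥ walkState c κ) (x ∘ Sum.inr) ≠ 0 := by
    intro h
    rw [h, mul_zero, mul_zero] at hj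
    exact hj rfl
  have hκ : ∀ y, walkState c κ y ≠ 0 → y (Sum.inl i) = κ i :=
    fun y hy => congrFun (walkState_ne_zero hy).1 i
  exact (hpow n).mulVec_ne_zero hκ hj'

/-- The wires of the Fourier transform in the computational basis: counter, wires of the walk
operator, and ancillas of the table lookup. -/
abbrev TransformWire (L m : ℕ) : Type := (Fin m ⊕ WalkWire L) ⊕ LookupAncilla m (m + 1)

/-- The codes of the angle cosines. -/
theorem exists_cosineTable (m : ℕ) : ∃ f : (Fin m → Fin 2) → Fin (m + 1) → Fin 2,
    ∀ y, |codeValue (f y) - gridCos (2 ^ m) (binaryValue y)| ≤ 1 / 2 ^ m := by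
  choose f hf using fun y : Fin m → Fin 2 => exists_codeValue m
    (Real.neg_one_le_cos (2 * Real.pi * binaryValue y / (2 ^ m : ℕ)))
    (Real.cos_le_one (2 * Real.pi * binaryValue y / (2 ^ m : ℕ)))
  exact ⟨f, hf⟩

theorem sq_norm_sub_le (u v : ℝ) (z : ℂ) {η : ℝ} (h : |u - v| ≤ η) :
    ‖(u : ℂ) - z‖ ^ 2 ≤ 2 * ‖(v : ℂ) - z‖ ^ 2 + 2 * η ^ 2 := by
  have h1 : ‖(u : ℂ) - z‖ ≤ ‖(v : ℂ) - z‖ + η := by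
    refine (norm_sub_le_norm_sub_add_norm_sub _ (v : ℂ) _).trans ?_
    rw [add_comm]
    gcongr
    rwa [← Complex.ofReal_sub, Complex.norm_real]
  have h2 : 0 ≤ ‖(u : ℂ) - z‖ := norm_nonneg _
  nlinarith [sq_nonneg (‖(v : ℂ) - z‖ - η)]

/-- A circuit that computes the code of `F_k` with mean square error `O (4 ^ -m)`. -/
theorem exists_transformCircuit (L m : ℕ) [NeZero m] :
    ∃ Q : Circuit L (TransformWire L m),
      Q.gateCount ≤ 2 * (m ^ 2 + 21 * m) + (L ^ 2 + L + 3) + 2 ^ m * (2 * L ^ 2 + 30 * L + 48) +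
        7 * (1 + 4 * 2 ^ m + 3 * 2 ^ (m + 1)) ∧
      Q.callCount ≤ 1 + 2 ^ m * 2 ∧
      ∀ (c : EuclideanSpace ℂ (Fin (2 ^ L))) (O : Matrix (Fin (2 ^ L)) (Fin (2 ^ L)) ℂ),
        (∀ k, starRingEnd ℂ (dftCoeff c k) = dftCoeff c k) → IsOracleFor O c →
        ∀ κ : Fin L → Fin 2,
          (∀ x, (Q.eval O *ᵥ Pi.single (Sum.elim (Sum.elim 0 (walkBasis κ)) 0) 1) x ≠ 0 →
            ∀ i, x (Sum.inl (Sum.inr (Sum.inl i))) = κ i) ∧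
          ∑ x, ‖(codeValue (fun i => x (Sum.inr (.out i))) : ℂ) - dftCoeff c (toNumber L κ)‖ ^ 2 *
            ‖(Q.eval O *ᵥ Pi.single (Sum.elim (Sum.elim 0 (walkBasis κ)) 0) 1) x‖ ^ 2 ≤
            49 / (2 ^ m) ^ 2 := by
  obtain ⟨f, hf⟩ := exists_cosineTable m
  obtain ⟨l, hlen, htarget, hrun⟩ := exists_lookup f
  -- The table reads the counter in place and uses fresh ancillas for everything it writes.
  let e : LookupWire m (m + 1) ↪ TransformWire L m :=
    ⟨Sum.map Sum.inl id, Sum.map_injective.mpr ⟨Sum.inl_injective, Function.injective_id⟩⟩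
  obtain ⟨R, hRe, hRi, hR⟩ := exists_equiv_onWires_classicalCircuit (L := L) e l
  refine ⟨Circuit.mapWires .inl (phaseEstimation L m) ++ Circuit.mapWires e (classicalCircuit l),
    ?_, ?_, fun c O hreal hOc κ => ?_⟩
  · rw [Circuit.gateCount_append, Circuit.gateCount_mapWires, Circuit.gateCount_mapWires]
    exact add_le_add (gateCount_phaseEstimation_le L m)
      ((gateCount_classicalCircuit_le l).trans (Nat.mul_le_mul_left 7 hlen))
  · rw [Circuit.callCount_append, Circuit.callCount_mapWires, Circuit.callCount_mapWires,
      callCount_classicalCircuit]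
    exact callCount_phaseEstimation_le L m
  set φ : (TransformWire L m → Fin 2) → ℂ :=
    onWires .inl ((phaseEstimation L m).eval O) *ᵥ
      Pi.single (Sum.elim (Sum.elim 0 (walkBasis κ)) 0) 1 with hφdef
  have hφ (z : Fin m ⊕ WalkWire L → Fin 2) (u : LookupAncilla m (m + 1) → Fin 2) :
      φ (Sum.elim z u) = if u = 0 then phaseEstimationState O m κ z else 0 := by
    have h : (fun z' => slice (Pi.single (Sum.elim
        (Sum.elim (0 : Fin m → Fin 2) (walkBasis κ)) 0) 1 : (TransformWire L m → Fin 2) → ℂ) z' u) =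
        (if u = 0 then (1 : ℂ) else 0) •
          Pi.single (Sum.elim (0 : Fin m → Fin 2) (walkBasis κ)) 1 := by
      funext z
      simp only [slice, Pi.single_apply, Pi.smul_apply, smul_eq_mul, Sum.elim_eq_iff]
      by_cases h1 : z = Sum.elim (0 : Fin m → Fin 2) (walkBasis κ) <;>
        by_cases h2 : u = 0 <;> simp [h1, h2]
    change slice φ z u = _
    rw [hφdef, slice_onWires_inl, h, Matrix.mulVec_smul, Pi.smul_apply, smul_eq_mul, ite_mul,
      one_mul, zero_mul]
    rfl
  have hφ0 {x} (hx : φ x ≠ 0) :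
      x ∘ Sum.inr = 0 ∧ phaseEstimationState O m κ (x ∘ Sum.inl) ≠ 0 := by
    rw [← Sum.elim_comp_inl_inr x, hφ] at hx
    split_ifs at hx with h
    · exact ⟨h, hx⟩
    · exact absurd rfl hx
  have heval : Circuit.eval O (Circuit.mapWires .inl (phaseEstimation L m) ++
      Circuit.mapWires e (classicalCircuit l)) *ᵥ
        Pi.single (Sum.elim (Sum.elim 0 (walkBasis κ)) 0) 1 =
      onWires e ((classicalCircuit l).eval O) *ᵥ φ := by
    rw [Circuit.eval_append, ← Matrix.mulVec_mulVec, Circuit.eval_mapWires, Circuit.eval_mapWires]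
  rw [heval]
  constructor
  · intro x hx i
    obtain ⟨x, rfl⟩ := R.surjective x
    rw [hR] at hx
    rw [hRi]
    · exact phaseEstimationState_ne_zero hOc.1 hOc.2 m κ (hφ0 hx).2 i
    · rintro (s | s) h <;> simp [e] at h
  -- Summing over the preimages under the permutation `R` replaces the final amplitudes by those of
  -- phase estimation, while the digit wires show the table entry of the counter.
  · rw [← R.sum_comp]
    simp only [hR]
    have hdigits {x} (hx : φ x ≠ 0) :
        (fun i => R x (Sum.inr (.out i))) = f (x ∘ Sum.inl ∘ Sum.inl) := by
      funext i
      have h1 := congrFun (hRe x) (Sum.inr (.out i))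
      exact h1.trans (hrun (x ∘ e) (fun a => congrFun (hφ0 hx).1 a) i)
    have hnorm : ∑ x, ‖φ x‖ ^ 2 = 1 := by
      rw [hφdef, sum_norm_sq_mulVec
        (onWires_mem_unitaryGroup _ (Circuit.eval_mem_unitaryGroup hOc.1 _)),
        Finset.sum_eq_single
          (Sum.elim (Sum.elim (0 : Fin m → Fin 2) (walkBasis κ)) 0 : TransformWire L m → Fin 2)]
      · simp
      · intro x _ hx
        simp [Pi.single_eq_of_ne hx]
      · simp
    have hms : ∑ x : TransformWire L m → Fin 2,
        ‖(gridCos (2 ^ m) (binaryValue (x ∘ Sum.inl ∘ Sum.inl)) : ℂ) -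
          dftCoeff c (toNumber L κ)‖ ^ 2 * ‖φ x‖ ^ 2 ≤ 2 * Real.pi ^ 2 / (2 ^ m) ^ 2 := by
      refine (le_of_eq ?_).trans (phaseEstimationState_meanSquare hOc.1 hOc.2 m κ (hreal _))
      rw [← (Equiv.sumArrowEquivProdArrow _ _ _).symm.sum_comp, Fintype.sum_prod_type]
      refine Finset.sum_congr rfl fun z _ => ?_
      rw [Finset.sum_eq_single 0]
      · change _ * ‖φ (Sum.elim z 0)‖ ^ 2 = _
        rw [hφ, if_pos rfl]
        rfl
      · intro u _ hu
        change _ * ‖φ (Sum.elim z u)‖ ^ 2 = _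
        rw [hφ, if_neg hu, norm_zero]
        ring
      · simp
    -- Rounding gives `2 · 2π² + 2 = 4π² + 2 ≤ 46` over `4^m`; `49` is the next square, for a root
    -- of `7/2^m`.
    have hpi : Real.pi ^ 2 ≤ 11 := by
      nlinarith [Real.pi_pos, Real.pi_lt_d2]
    calc _ ≤ ∑ x : TransformWire L m → Fin 2,
          (2 * (‖(gridCos (2 ^ m) (binaryValue (x ∘ Sum.inl ∘ Sum.inl)) : ℂ) -
            dftCoeff c (toNumber L κ)‖ ^ 2 * ‖φ x‖ ^ 2) + 2 * (1 / 2 ^ m) ^ 2 * ‖φ x‖ ^ 2) := by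
          refine Finset.sum_le_sum fun x _ => ?_
          by_cases hx : φ x = 0
          · simp [hx]
          · rw [hdigits hx]
            have := sq_norm_sub_le _ _ (dftCoeff c (toNumber L κ)) (hf (x ∘ Sum.inl ∘ Sum.inl))
            refine (mul_le_mul_of_nonneg_right this (sq_nonneg _)).trans_eq ?_
            ring
      _ ≤ 2 * (2 * Real.pi ^ 2 / (2 ^ m) ^ 2) + 2 * (1 / 2 ^ m) ^ 2 * 1 := by
          rw [Finset.sum_add_distrib, ← Finset.mul_sum, ← Finset.mul_sum, hnorm]
          gcongr
      _ = (4 * Real.pi ^ 2 + 2) / (2 ^ m) ^ 2 := by ring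
      _ ≤ 49 / (2 ^ m) ^ 2 := by
          gcongr
          linarith

end FourierTransformCircuit

/-! ### The spectral decomposition of circulant matrices -/

section Circulant

variable {L : ℕ} {c : EuclideanSpace ℂ (Fin (2 ^ L))}

/-- The columns of the Fourier matrix are characters. Shifting the summation index by `j` pulls the
character value at `j` out of row `j`, and what is left is `√N` times the Fourier coefficient. -/
theorem circulantMatrix_mul_fourierMatrix {N : ℕ} [NeZero N] (c : EuclideanSpace ℂ (Fin N)) :
    circulantMatrix c * fourierMatrix N =
      fourierMatrix N * Matrix.diagonal fun k => ((Real.sqrt N : ℝ) : ℂ) * dftCoeff c k := by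
  have hN : ((Real.sqrt N : ℝ) : ℂ) ≠ 0 :=
    Complex.ofReal_ne_zero.mpr (Real.sqrt_ne_zero'.mpr (Nat.cast_pos.mpr (NeZero.pos N)))
  ext j l
  rw [Matrix.mul_diagonal, Matrix.mul_apply, dftCoeff, Finset.mul_sum, Finset.mul_sum,
    ← Equiv.sum_comp (Equiv.addRight j)]
  refine Finset.sum_congr rfl fun k _ => ?_
  simp only [Equiv.coe_addRight, circulantMatrix, Matrix.of_apply, add_sub_cancel_right,
    fourierMatrix_apply]
  rw [fourierChar_comm _ l, fourierChar_comm j l, fourierChar_add]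
  field_simp

theorem fourierMatrix_mul_conjTranspose (L : ℕ) :
    fourierMatrix (2 ^ L) * (fourierMatrix (2 ^ L))ᴴ = 1 :=
  Matrix.mem_unitaryGroup_iff.mp (fourierMatrix_mem_unitaryGroup L)

theorem fourierMatrix_conjTranspose_mul (L : ℕ) :
    (fourierMatrix (2 ^ L))ᴴ * fourierMatrix (2 ^ L) = 1 :=
  Matrix.mem_unitaryGroup_iff'.mp (fourierMatrix_mem_unitaryGroup L)

theorem circulantMatrix_eq (c : EuclideanSpace ℂ (Fin (2 ^ L))) :
    circulantMatrix c = fourierMatrix (2 ^ L) *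
      (Matrix.diagonal fun k => ((Real.sqrt (2 ^ L) : ℝ) : ℂ) * dftCoeff c k) *
        (fourierMatrix (2 ^ L))ᴴ := by
  have h := circulantMatrix_mul_fourierMatrix c
  rw [Nat.cast_pow, Nat.cast_ofNat] at h
  rw [← h, mul_assoc, fourierMatrix_mul_conjTranspose, mul_one]

/-- Unitary conjugation turns the Hermitian matrix into the diagonal one, which is thus Hermitian,
so its entries are real. -/
theorem conj_dftCoeff (hc : (circulantMatrix c).IsHermitian) (k : Fin (2 ^ L)) :
    starRingEnd ℂ (dftCoeff c k) = dftCoeff c k := by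
  set D : Matrix (Fin (2 ^ L)) (Fin (2 ^ L)) ℂ :=
    Matrix.diagonal fun k => ((Real.sqrt (2 ^ L) : ℝ) : ℂ) * dftCoeff c k with hD
  have h1 : D = (fourierMatrix (2 ^ L))ᴴ * circulantMatrix c * fourierMatrix (2 ^ L) := by
    rw [circulantMatrix_eq, ← hD]
    simp only [mul_assoc, fourierMatrix_conjTranspose_mul, mul_one]
    rw [← mul_assoc, fourierMatrix_conjTranspose_mul, one_mul]
  have h2 : Dᴴ = D := by
    rw [h1, Matrix.conjTranspose_mul, Matrix.conjTranspose_mul, hc.eq,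
      Matrix.conjTranspose_conjTranspose, mul_assoc]
  have h3 := congrFun (congrFun h2 k) k
  rw [Matrix.conjTranspose_apply, hD, Matrix.diagonal_apply_eq, star_mul', Complex.star_def,
    Complex.conj_ofReal] at h3
  refine mul_left_cancel₀ (Complex.ofReal_ne_zero.mpr (Real.sqrt_ne_zero'.mpr ?_)) h3
  positivity

/-- `F_k` is a coordinate of the image of a unit vector under a unitary matrix. -/
theorem norm_dftCoeff_le_one (hc : ‖c‖ = 1) (k : Fin (2 ^ L)) : ‖dftCoeff c k‖ ≤ 1 := by
  have h := sum_norm_sq_mulVec (fourierMatrix_mem_unitaryGroup L) c.ofLp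
  have h1 := EuclideanSpace.norm_sq_eq c
  rw [hc] at h1
  have h2 : ‖dftCoeff c k‖ ^ 2 ≤ ∑ i, ‖(fourierMatrix (2 ^ L) *ᵥ c.ofLp) i‖ ^ 2 :=
    Finset.single_le_sum (f := fun i => ‖(fourierMatrix (2 ^ L) *ᵥ c.ofLp) i‖ ^ 2)
      (fun i _ => sq_nonneg _) (Finset.mem_univ k)
  rw [h, ← h1, one_pow] at h2
  exact (sq_le_one_iff₀ (norm_nonneg _)).mp h2

/-- The eigenvalues of the evolution operator. -/
noncomputable def evolutionPhase (t : ℝ) (c : EuclideanSpace ℂ (Fin (2 ^ L))) (k : Fin (2 ^ L)) :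
    ℂ :=
  Complex.exp (-(Complex.I * t) * (((Real.sqrt (2 ^ L) : ℝ) : ℂ) * dftCoeff c k))

theorem exp_circulantMatrix (t : ℝ) (c : EuclideanSpace ℂ (Fin (2 ^ L))) :
    NormedSpace.exp ((-(Complex.I * (t : ℂ))) • circulantMatrix c) =
      fourierMatrix (2 ^ L) * Matrix.diagonal (evolutionPhase t c) * (fourierMatrix (2 ^ L))ᴴ := by
  have hinv : (fourierMatrix (2 ^ L))⁻¹ = (fourierMatrix (2 ^ L))ᴴ :=
    Matrix.inv_eq_right_inv (fourierMatrix_mul_conjTranspose L)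
  have hunit : IsUnit (fourierMatrix (2 ^ L)) :=
    IsUnit.of_mul_eq_one _ (fourierMatrix_mul_conjTranspose L)
  rw [circulantMatrix_eq, ← Matrix.smul_mul, ← Matrix.mul_smul, ← hinv, Matrix.exp_conj _ _ hunit,
    ← Matrix.diagonal_smul, Matrix.exp_diagonal]
  congr 3
  funext k
  rw [Pi.coe_exp, ← Complex.exp_eq_exp_ℂ]
  rfl

theorem norm_exp_neg_mul_sub_le (u v : ℝ) :
    ‖Complex.exp (-(Complex.I * u)) - Complex.exp (-(Complex.I * v))‖ ≤ |u - v| := by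
  have h : Complex.exp (-(Complex.I * u)) - Complex.exp (-(Complex.I * v)) =
      Complex.exp ((-v : ℝ) * Complex.I) * (Complex.exp (Complex.I * (v - u : ℝ)) - 1) := by
    rw [mul_sub, ← Complex.exp_add, mul_one]
    congr 2 <;> push_cast <;> ring
  rw [h, norm_mul, Complex.norm_exp_ofReal_mul_I, one_mul, abs_sub_comm]
  exact Real.norm_exp_I_mul_ofReal_sub_one_le

/-- A phase `√N t v`, instead of an eigenvalue of the evolution operator. -/
theorem norm_exp_sub_evolutionPhase_le (hc : (circulantMatrix c).IsHermitian) {t : ℝ} (ht : 0 ≤ t)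
    (v : ℝ) (k : Fin (2 ^ L)) :
    ‖Complex.exp (-(Complex.I * ((Real.sqrt (2 ^ L) * t * v : ℝ) : ℂ))) - evolutionPhase t c k‖ ≤
      Real.sqrt (2 ^ L) * t * ‖(v : ℂ) - dftCoeff c k‖ := by
  obtain ⟨r, hr⟩ := Complex.conj_eq_iff_real.mp (conj_dftCoeff hc k)
  have h : evolutionPhase t c k =
      Complex.exp (-(Complex.I * ((Real.sqrt (2 ^ L) * t * r : ℝ) : ℂ))) := by
    rw [evolutionPhase, hr]
    congr 1
    push_cast
    ring
  rw [h, hr, ← Complex.ofReal_sub, Complex.norm_real, Real.norm_eq_abs]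
  refine (norm_exp_neg_mul_sub_le _ _).trans_eq ?_
  rw [← mul_sub, abs_mul, abs_of_nonneg (by positivity)]

end Circulant

/-! ### States with ancillas -/

section Ancillas

variable {L a : ℕ}

theorem withAncillas_single (κ : Fin L → Fin 2) :
    (withAncillas a (Pi.single (toNumber L κ) 1)).ofLp = Pi.single (Sum.elim κ 0) 1 := by
  funext x
  simp only [withAncillas, Pi.single_apply, (toNumber L).apply_eq_iff_eq]
  rw [← ite_and]
  refine if_congr ?_ rfl rfl
  constructor
  · rintro ⟨h1, rfl⟩
    rw [show (0 : Fin a → Fin 2) = x ∘ Sum.inr from (funext h1).symm, Sum.elim_comp_inl_inr]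
  · rintro rfl
    exact ⟨fun _ => rfl, rfl⟩

theorem mulVec_withAncillas (M : Matrix (Fin L ⊕ Fin a → Fin 2) (Fin L ⊕ Fin a → Fin 2) ℂ)
    (s : Fin (2 ^ L) → ℂ) :
    M *ᵥ (withAncillas a s).ofLp =
      ∑ κ : Fin L → Fin 2, s (toNumber L κ) • (M *ᵥ Pi.single (Sum.elim κ 0) 1) := by
  have h : (withAncillas a s).ofLp =
      ∑ κ : Fin L → Fin 2, s (toNumber L κ) • Pi.single (Sum.elim κ 0) 1 := by
    funext x
    rw [Finset.sum_apply, Finset.sum_eq_single (x ∘ Sum.inl)]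
    · simp only [withAncillas, Pi.smul_apply, Pi.single_apply, smul_eq_mul, mul_ite, mul_one,
        mul_zero]
      refine if_congr ⟨fun h => ?_, fun h i => ?_⟩ rfl rfl
      · rw [show (0 : Fin a → Fin 2) = x ∘ Sum.inr from (funext h).symm, Sum.elim_comp_inl_inr]
      · rw [h]
        rfl
    · intro κ _ hκ
      rw [Pi.smul_apply, Pi.single_eq_of_ne, smul_zero]
      rintro rfl
      exact hκ rfl
    · simp
  rw [h, Matrix.mulVec_sum]
  simp only [Matrix.mulVec_smul]

theorem norm_withAncillas (s : EuclideanSpace ℂ (Fin (2 ^ L))) :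
    ‖withAncillas a s‖ = ‖s‖ := by
  rw [EuclideanSpace.norm_eq, EuclideanSpace.norm_eq]
  congr 1
  rw [← (Equiv.sumArrowEquivProdArrow _ _ _).symm.sum_comp, Fintype.sum_prod_type,
    ← (toNumber L).sum_comp]
  refine Finset.sum_congr rfl fun z _ => ?_
  rw [Finset.sum_eq_single 0]
  · simp [withAncillas, Function.comp_def]
  · intro u _ hu
    have : ¬ ∀ i, u i = 0 := fun h => hu (funext h)
    simp [withAncillas, this]
  · simp

theorem withAncillas_sub (s s' : Fin (2 ^ L) → ℂ) :
    withAncillas a (s - s') = withAncillas a s - withAncillas a s' := by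
  refine WithLp.ofLp_injective 2 (funext fun x => ?_)
  simp only [withAncillas, Pi.sub_apply, WithLp.ofLp_sub]
  split_ifs <;> simp

theorem norm_toLp_mulVec {n : Type*} [Fintype n] [DecidableEq n] {U : Matrix n n ℂ}
    (hU : U ∈ Matrix.unitaryGroup n ℂ) (v : n → ℂ) :
    ‖WithLp.toLp 2 (U *ᵥ v)‖ = ‖WithLp.toLp 2 v‖ := by
  rw [EuclideanSpace.norm_eq, EuclideanSpace.norm_eq]
  exact congrArg Real.sqrt (sum_norm_sq_mulVec hU v)

theorem onWires_inl_mulVec_withAncillas (U : Matrix (Fin (2 ^ L)) (Fin (2 ^ L)) ℂ)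
    (s : Fin (2 ^ L) → ℂ) :
    onWires ⟨Sum.inl, Sum.inl_injective⟩ (onQubits U) *ᵥ (withAncillas a s).ofLp =
      (withAncillas a (U *ᵥ s)).ofLp := by
  funext x
  have h := slice_onWires_inl (onQubits U) (withAncillas a s).ofLp (x ∘ Sum.inl) (x ∘ Sum.inr)
  rw [slice, Sum.elim_comp_inl_inr] at h
  refine h.trans ?_
  rw [onQubits_mulVec]
  by_cases hx : ∀ i : Fin a, x (Sum.inr i) = 0
  · simp [withAncillas, slice, hx]
  · simp only [withAncillas, slice, Sum.elim_inr, Function.comp_apply, hx, if_false]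
    exact congrFun (Matrix.mulVec_zero U) _

end Ancillas

/-! ### Simulation by the Fourier transform in the computational basis -/

section Simulation

variable {L a p : ℕ} {c : EuclideanSpace ℂ (Fin (2 ^ L))}

/-- The operator writes the codes of the Fourier coefficients on the wires `dig`, with root mean
square error at most `η`, and leaves the main register unchanged. -/
def TransformsWithin (dig : Fin (p + 1) ↪ Fin a)
    (M : Matrix (Fin L ⊕ Fin a → Fin 2) (Fin L ⊕ Fin a → Fin 2) ℂ)
    (c : EuclideanSpace ℂ (Fin (2 ^ L))) (η : ℝ) : Prop :=
  ∀ κ : Fin L → Fin 2, (∀ x, (M *ᵥ Pi.single (Sum.elim κ 0) 1) x ≠ 0 → x ∘ Sum.inl = κ) ∧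
    ∑ x, ‖((codeValue (fun i => x (Sum.inr (dig i))) : ℝ) : ℂ) - dftCoeff c (toNumber L κ)‖ ^ 2 *
      ‖(M *ᵥ Pi.single (Sum.elim κ 0) 1) x‖ ^ 2 ≤ η ^ 2

/-- This only relabels the wires of `exists_transformCircuit`, so that the main register comes first
and all other wires are numbered as ancillas. -/
theorem exists_transformsWithin (L m : ℕ) [NeZero m] :
    ∃ (a : ℕ) (dig : Fin (m + 1) ↪ Fin a) (Q : Circuit L (Fin L ⊕ Fin a)),
      Q.gateCount ≤ 2 * (m ^ 2 + 21 * m) + (L ^ 2 + L + 3) + 2 ^ m * (2 * L ^ 2 + 30 * L + 48) +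
        7 * (1 + 4 * 2 ^ m + 3 * 2 ^ (m + 1)) ∧
      Q.callCount ≤ 1 + 2 ^ m * 2 ∧
      ∀ (c : EuclideanSpace ℂ (Fin (2 ^ L))) (O : Matrix (Fin (2 ^ L)) (Fin (2 ^ L)) ℂ),
        (circulantMatrix c).IsHermitian → IsOracleFor O c →
          TransformsWithin dig (Q.eval O) c (7 / 2 ^ m) := by
  obtain ⟨Q, hgate, hcall, hQ⟩ := exists_transformCircuit L m
  let g := Fintype.equivFin ((Fin m ⊕ WalkAncilla L) ⊕ LookupAncilla m (m + 1))
  let f₀ : TransformWire L m ≃ Fin L ⊕ ((Fin m ⊕ WalkAncilla L) ⊕ LookupAncilla m (m + 1)) :=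
    { toFun := Sum.elim (Sum.elim (fun i => .inr (.inl (.inl i)))
        (Sum.elim .inl fun w => .inr (.inl (.inr w)))) fun w => .inr (.inr w)
      invFun := Sum.elim (fun i => .inl (.inr (.inl i)))
        (Sum.elim (Sum.elim (fun i => .inl (.inl i)) fun w => .inl (.inr (.inr w))) .inr)
      left_inv := by rintro ((i | i | w) | w) <;> rfl
      right_inv := by rintro (i | (i | w) | w) <;> rfl }
  let f : TransformWire L m ≃ Fin L ⊕ Fin _ := f₀.trans ((Equiv.refl _).sumCongr g)
  let dig : Fin (m + 1) ↪ Fin _ :=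
    ⟨fun i => g (Sum.inr (.out i)), fun i j h => by simpa using h⟩
  refine ⟨_, dig, Circuit.mapWires f.toEmbedding Q, ?_, ?_, fun c O hc hOc κ => ?_⟩
  · rwa [Circuit.gateCount_mapWires]
  · rwa [Circuit.callCount_mapWires]
  obtain ⟨hsupp, hms⟩ := hQ c O (conj_dftCoeff hc) hOc κ
  have hstate (x) : ((Circuit.mapWires f.toEmbedding Q).eval O *ᵥ
      Pi.single (Sum.elim κ 0) 1) x =
      (Q.eval O *ᵥ Pi.single (Sum.elim (Sum.elim 0 (walkBasis κ)) 0) 1) (x ∘ f) := by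
    rw [Circuit.eval_mapWires, onWires_equiv_mulVec]
    congr 2
    funext y
    rw [Pi.single_apply, Pi.single_apply]
    refine if_congr ?_ rfl rfl
    rw [Equiv.comp_symm_eq]
    refine Eq.congr_right (funext fun w => ?_)
    rcases w with (i | i | w) | w <;> rfl
  constructor
  · intro x hx
    rw [hstate] at hx
    funext i
    exact hsupp _ hx i
  · refine le_of_eq_of_le ?_ (hms.trans_eq ?_)
    · simp only [hstate]
      rw [← (Equiv.arrowCongr f.symm (Equiv.refl (Fin 2))).sum_comp]
      rfl
    · rw [div_pow]
      norm_num

theorem withAncillas_mulVec_single (M : Matrix (Fin L ⊕ Fin a → Fin 2) (Fin L ⊕ Fin a → Fin 2) ℂ)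
    (k : Fin (2 ^ L)) :
    (Matrix.toEuclideanLin M (withAncillas a (Pi.single k 1))).ofLp =
      M *ᵥ Pi.single (Sum.elim ((toNumber L).symm k) 0) 1 := by
  rw [← withAncillas_single, (toNumber L).apply_symm_apply]
  rfl

/-- Chebyshev's inequality: wherever the code misses by `ε` or more, the squared error divided by
`ε²` is at least one. -/
theorem TransformsWithin.isQFTC {dig : Fin (p + 1) ↪ Fin a}
    {M : Matrix (Fin L ⊕ Fin a → Fin 2) (Fin L ⊕ Fin a → Fin 2) ℂ}
    (hM : M ∈ Matrix.unitaryGroup (Fin L ⊕ Fin a → Fin 2) ℂ) {η ε δ : ℝ}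
    (h : TransformsWithin dig M c η) (hε : 0 < ε) (hη : η ^ 2 ≤ δ * ε ^ 2) :
    IsQFTC dig M c ε δ := by
  classical
  intro k ψ
  obtain ⟨hsupp, hms⟩ := h ((toNumber L).symm k)
  have hψ : ψ.ofLp = M *ᵥ Pi.single (Sum.elim ((toNumber L).symm k) 0) 1 :=
    withAncillas_mulVec_single M k
  rw [← hψ] at hsupp hms
  rw [(toNumber L).apply_symm_apply] at hms
  refine ⟨fun x hx => by rw [hsupp x hx, (toNumber L).apply_symm_apply], ?_⟩
  have hnorm : ∑ x, ‖ψ x‖ ^ 2 = 1 := by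
    rw [hψ, sum_norm_sq_mulVec hM, Finset.sum_eq_single (Sum.elim ((toNumber L).symm k) 0)]
    · simp
    · intro x _ hx
      simp [Pi.single_eq_of_ne hx]
    · simp
  have hsum : ∑ x, ‖ψ x‖ ^ 2 ≤ ∑ x, (Set.indicator
      {x | ‖((codeValue (fun i => x (Sum.inr (dig i))) : ℝ) : ℂ) - dftCoeff c k‖ < ε}
      (fun x => ‖ψ x‖ ^ 2) x +
      ‖((codeValue (fun i => x (Sum.inr (dig i))) : ℝ) : ℂ) - dftCoeff c k‖ ^ 2 * ‖ψ x‖ ^ 2 /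
        ε ^ 2) := by
    refine Finset.sum_le_sum fun x _ => ?_
    by_cases hx : ‖((codeValue (fun i => x (Sum.inr (dig i))) : ℝ) : ℂ) - dftCoeff c k‖ < ε
    · rw [Set.indicator_of_mem (by exact hx)]
      exact le_add_of_nonneg_right (by positivity)
    · rw [Set.indicator_of_notMem (by exact hx), zero_add, le_div_iff₀ (by positivity), mul_comm]
      gcongr
      exact not_lt.mp hx
  rw [hnorm, Finset.sum_add_distrib, ← Finset.sum_div] at hsum
  have hdiv : (∑ x, ‖((codeValue (fun i => x (Sum.inr (dig i))) : ℝ) : ℂ) - dftCoeff c k‖ ^ 2 *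
      ‖ψ x‖ ^ 2) / ε ^ 2 ≤ δ := by
    rw [div_le_iff₀ (by positivity)]
    exact hms.trans hη
  linarith

/-- The phases of the digits add up to `-√N t` times the encoded number. The digit `f_0` has weight
`-1` in the code, hence its opposite sign. -/
theorem eval_digitPhases_mulVec (O : Matrix (Fin (2 ^ L)) (Fin (2 ^ L)) ℂ)
    (dig : Fin (p + 1) ↪ Fin a) (t : ℝ) (ψ : (Fin L ⊕ Fin a → Fin 2) → ℂ)
    (x : Fin L ⊕ Fin a → Fin 2) :
    ((digitPhases (L := L) dig t).eval O *ᵥ ψ) x =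
      Complex.exp (-(Complex.I * ((Real.sqrt (2 ^ L) * t *
        codeValue (fun i => x (Sum.inr (dig i))) : ℝ) : ℂ))) * ψ x := by
  let θ (i : Fin p) : ℝ := -(Real.sqrt (2 ^ L) * t / 2 ^ ((i : ℕ) + 1))
  have hl : (List.ofFn fun i : Fin p => (phaseGate (Sum.inr (dig i.succ)) (θ i) :
      Gate L (Fin L ⊕ Fin a))) =
      (List.finRange p).map fun i => phaseGate (Sum.inr (dig i.succ)) (θ i) := List.ofFn_eq_map
  change ((Circuit.eval O (phaseGate _ _ :: List.ofFn fun i : Fin p =>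
    phaseGate (Sum.inr (dig i.succ)) (θ i))) *ᵥ ψ) x = _
  rw [hl, Circuit.eval_cons, ← Matrix.mulVec_mulVec,
    Circuit.eval_mulVec_of_diagonal O _ _
      (fun i x => ((x (Sum.inr (dig i.succ)) : ℕ) : ℂ) * (θ i * Complex.I))
      (fun i _ => phaseGate_mulVec O _ _), phaseGate_mulVec, ← mul_assoc, ← Complex.exp_add,
    ← List.ofFn_eq_map, List.sum_ofFn]
  congr 2
  rw [codeValue]
  push_cast
  rw [mul_add, mul_add, neg_add, Finset.mul_sum, Finset.mul_sum, ← Finset.sum_neg_distrib, add_comm]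
  congr 1
  · ring
  · refine Finset.sum_congr rfl fun i _ => ?_
    simp only [θ]
    push_cast
    ring

end Simulation

/-! ### Error and cost of the simulation circuit -/

section Simulation

variable {L a p : ℕ} {c : EuclideanSpace ℂ (Fin (2 ^ L))}

/-- The circuit of the simulation with the circuit `Q` for the Fourier transform in the
computational basis. -/
noncomputable def simulationCircuit (dig : Fin (p + 1) ↪ Fin a) (t : ℝ)
    (Q : Circuit L (Fin L ⊕ Fin a)) : Circuit L (Fin L ⊕ Fin a) :=
  Circuit.inv (Circuit.mapWires .inl (fourierCircuit L L)) ++ Q ++ digitPhases dig t ++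
    Circuit.inv Q ++ Circuit.mapWires .inl (fourierCircuit L L)

theorem conjTranspose_mem_unitaryGroup {n : Type*} [Fintype n] [DecidableEq n] {U : Matrix n n ℂ}
    (hU : U ∈ Matrix.unitaryGroup n ℂ) : Uᴴ ∈ Matrix.unitaryGroup n ℂ :=
  Unitary.star_mem hU

theorem eval_mapWires_fourierCircuit (O : Matrix (Fin (2 ^ L)) (Fin (2 ^ L)) ℂ) :
    (Circuit.mapWires .inl (fourierCircuit L L) : Circuit L (Fin L ⊕ Fin a)).eval O =
      onWires ⟨Sum.inl, Sum.inl_injective⟩ (onQubits (fourierMatrix (2 ^ L))) := by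
  rw [Circuit.eval_mapWires, eval_fourierCircuit]
  rfl

theorem gateCount_simulationCircuit_le (dig : Fin (p + 1) ↪ Fin a) (t : ℝ)
    (Q : Circuit L (Fin L ⊕ Fin a)) :
    (simulationCircuit dig t Q).gateCount ≤ 2 * (L ^ 2 + 21 * L) + 2 * Q.gateCount + (p + 1) := by
  have h1 := gateCount_fourierCircuit_le L L
  have h2 : (digitPhases (L := L) dig t).gateCount ≤ p + 1 :=
    List.countP_le_length.trans_eq (by simp [digitPhases])
  simp only [simulationCircuit, Circuit.gateCount_append, Circuit.gateCount_inv,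
    Circuit.gateCount_mapWires]
  omega

theorem callCount_simulationCircuit (dig : Fin (p + 1) ↪ Fin a) (t : ℝ)
    (Q : Circuit L (Fin L ⊕ Fin a)) : (simulationCircuit dig t Q).callCount = 2 * Q.callCount := by
  have h2 : (digitPhases (L := L) dig t).callCount = 0 := by
    rw [Circuit.callCount, List.countP_eq_zero]
    intro g hg
    rw [digitPhases, List.mem_cons, List.mem_ofFn] at hg
    rcases hg with rfl | ⟨i, rfl⟩ <;> simp [phaseGate, Gate.isCall]
  simp only [simulationCircuit, Circuit.callCount_append, Circuit.callCount_inv,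
    Circuit.callCount_mapWires, callCount_fourierCircuit, h2]
  omega

/-- Since the main register is unchanged, the amplitude at `x` comes only from the input whose main
register agrees with that of `x`. -/
theorem TransformsWithin.mulVec_withAncillas {dig : Fin (p + 1) ↪ Fin a}
    {M : Matrix (Fin L ⊕ Fin a → Fin 2) (Fin L ⊕ Fin a → Fin 2) ℂ} {η : ℝ}
    (h : TransformsWithin dig M c η) (s : Fin (2 ^ L) → ℂ) (x : Fin L ⊕ Fin a → Fin 2) :
    (M *ᵥ (withAncillas a s).ofLp) x =
      s (toNumber L (x ∘ Sum.inl)) * (M *ᵥ Pi.single (Sum.elim (x ∘ Sum.inl) 0) 1) x := by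
  rw [_root_.mulVec_withAncillas, Finset.sum_apply, Finset.sum_eq_single (x ∘ Sum.inl)]
  · rfl
  · intro κ _ hκ
    rw [Pi.smul_apply, smul_eq_mul, mul_eq_zero]
    right
    by_contra hx
    exact hκ ((h κ).1 x hx).symm
  · simp

/-- The exact evolution can be written with `Q` inserted and immediately undone. Undoing `Q` and the
final Fourier transform are isometries, so the error can be measured just after the phase gates.
There it is `e^{-iTv} - e^{-iTF_k}`, bounded by `T|v - F_k|`, in mean square. Errors in modulus
squared add over `k` by orthogonality, and no split into successful and failed outcomes is required.
-/
theorem TransformsWithin.performsWithin {dig : Fin (p + 1) ↪ Fin a} {t : ℝ} (ht : 0 ≤ t)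
    {Q : Circuit L (Fin L ⊕ Fin a)} {O : Matrix (Fin (2 ^ L)) (Fin (2 ^ L)) ℂ}
    (hO : O ∈ Matrix.unitaryGroup (Fin (2 ^ L)) ℂ) (hc : (circulantMatrix c).IsHermitian) {η δ : ℝ}
    (hη : 0 ≤ η) (h : TransformsWithin dig (Q.eval O) c η) (hδ : Real.sqrt (2 ^ L) * t * η ≤ δ) :
    PerformsWithin ((simulationCircuit dig t Q).eval O)
      (NormedSpace.exp ((-(Complex.I * (t : ℂ))) • circulantMatrix c)) δ := by
  intro s
  set T := Real.sqrt (2 ^ L) * t with hT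
  have hT0 : 0 ≤ T := by positivity
  set F := onWires (ι := Fin L ⊕ Fin a) ⟨Sum.inl, Sum.inl_injective⟩
    (onQubits (fourierMatrix (2 ^ L))) with hF
  set s' := (fourierMatrix (2 ^ L))ᴴ *ᵥ s.ofLp with hs'
  set e := evolutionPhase t c with he
  set M := Q.eval O with hM
  set P := (digitPhases (L := L) dig t).eval O with hP
  have hMM : Mᴴ * M = 1 := Circuit.conjTranspose_mul_eval hO _
  have hMU : M ∈ Matrix.unitaryGroup _ ℂ := Circuit.eval_mem_unitaryGroup hO _
  have hFU : F ∈ Matrix.unitaryGroup _ ℂ := by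
    rw [hF, ← eval_mapWires_fourierCircuit O]
    exact Circuit.eval_mem_unitaryGroup hO _
  have hleft : (simulationCircuit dig t Q).eval O *ᵥ (withAncillas a s.ofLp).ofLp =
      F *ᵥ (Mᴴ *ᵥ (P *ᵥ (M *ᵥ (withAncillas a s').ofLp))) := by
    simp only [simulationCircuit, Circuit.eval_append, Circuit.eval_inv,
      eval_mapWires_fourierCircuit, ← Matrix.mulVec_mulVec]
    rw [← onWires_conjTranspose, ← onQubits_conjTranspose, onWires_inl_mulVec_withAncillas]
  have hright : (withAncillas a (NormedSpace.exp ((-(Complex.I * (t : ℂ))) • circulantMatrix c) *ᵥ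
      s.ofLp)).ofLp =
      F *ᵥ (Mᴴ *ᵥ (M *ᵥ (withAncillas a fun k => e k * s' k).ofLp)) := by
    rw [Matrix.mulVec_mulVec _ Mᴴ, hMM, Matrix.one_mulVec, hF, onWires_inl_mulVec_withAncillas,
      exp_circulantMatrix, ← Matrix.mulVec_mulVec, ← Matrix.mulVec_mulVec]
    congr 3
    funext k
    rw [Matrix.mulVec_diagonal]
  have hdiff : Matrix.toEuclideanLin ((simulationCircuit dig t Q).eval O) (withAncillas a s.ofLp) -
      withAncillas a (NormedSpace.exp ((-(Complex.I * (t : ℂ))) • circulantMatrix c) *ᵥ s.ofLp) =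
      WithLp.toLp 2 (F *ᵥ (Mᴴ *ᵥ (P *ᵥ (M *ᵥ (withAncillas a s').ofLp) -
        M *ᵥ (withAncillas a fun k => e k * s' k).ofLp))) := by
    refine WithLp.ofLp_injective 2 ?_
    rw [Matrix.mulVec_sub, Matrix.mulVec_sub, ← hleft, ← hright]
    rfl
  have hs : ∑ κ, ‖s' (toNumber L κ)‖ ^ 2 = ‖s‖ ^ 2 := by
    rw [(toNumber L).sum_comp fun k => ‖s' k‖ ^ 2, hs',
      sum_norm_sq_mulVec (conjTranspose_mem_unitaryGroup (fourierMatrix_mem_unitaryGroup L)),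
      EuclideanSpace.norm_sq_eq]
  rw [hdiff, norm_toLp_mulVec hFU, norm_toLp_mulVec (conjTranspose_mem_unitaryGroup hMU),
    EuclideanSpace.norm_eq]
  refine Real.sqrt_le_iff.mpr ⟨mul_nonneg ((by positivity : 0 ≤ T * η).trans hδ) (norm_nonneg _), ?_⟩
  let v (x : Fin L ⊕ Fin a → Fin 2) : ℝ := codeValue fun i => x (Sum.inr (dig i))
  let A (κ : Fin L → Fin 2) (x : Fin L ⊕ Fin a → Fin 2) : ℝ := ‖s' (toNumber L κ)‖ ^ 2 *
    (T ^ 2 * (‖(v x : ℂ) - dftCoeff c (toNumber L κ)‖ ^ 2 *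
      ‖(M *ᵥ Pi.single (Sum.elim κ 0) 1) x‖ ^ 2))
  calc _ ≤ ∑ x, A (x ∘ Sum.inl) x := by
        refine Finset.sum_le_sum fun x _ => ?_
        have hx : (P *ᵥ (M *ᵥ (withAncillas a s').ofLp) -
            M *ᵥ (withAncillas a fun k => e k * s' k).ofLp) x =
            s' (toNumber L (x ∘ Sum.inl)) *
              ((Complex.exp (-(Complex.I * ((T * v x : ℝ) : ℂ))) - e (toNumber L (x ∘ Sum.inl))) *
              (M *ᵥ Pi.single (Sum.elim (x ∘ Sum.inl) 0) 1) x) := by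
          rw [Pi.sub_apply, hP, eval_digitPhases_mulVec, h.mulVec_withAncillas,
            h.mulVec_withAncillas]
          ring
        change ‖(P *ᵥ (M *ᵥ (withAncillas a s').ofLp) -
            M *ᵥ (withAncillas a fun k => e k * s' k).ofLp) x‖ ^ 2 ≤ _
        rw [hx, norm_mul, norm_mul, mul_pow, mul_pow]
        refine mul_le_mul_of_nonneg_left ?_ (sq_nonneg _)
        rw [← mul_assoc]
        refine mul_le_mul_of_nonneg_right ?_ (sq_nonneg _)
        rw [← mul_pow]
        exact pow_le_pow_left₀ (norm_nonneg _) (norm_exp_sub_evolutionPhase_le hc ht _ _) 2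
    -- Nothing is lost here: the added terms vanish, because `Q` keeps the main register.
    _ ≤ ∑ x, ∑ κ, A κ x := by
        refine Finset.sum_le_sum fun x _ => ?_
        exact Finset.single_le_sum (f := fun κ => A κ x) (fun κ _ => by positivity)
          (Finset.mem_univ _)
    _ = ∑ κ, ‖s' (toNumber L κ)‖ ^ 2 * (T ^ 2 * ∑ x,
          ‖(v x : ℂ) - dftCoeff c (toNumber L κ)‖ ^ 2 *
            ‖(M *ᵥ Pi.single (Sum.elim κ 0) 1) x‖ ^ 2) := by
        rw [Finset.sum_comm]
        simp only [A, Finset.mul_sum]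
    _ ≤ ∑ κ, ‖s' (toNumber L κ)‖ ^ 2 * (T ^ 2 * η ^ 2) := by
        exact Finset.sum_le_sum fun κ _ => mul_le_mul_of_nonneg_left
          (mul_le_mul_of_nonneg_left (h κ).2 (sq_nonneg _)) (sq_nonneg _)
    _ = (T * η) ^ 2 * ‖s‖ ^ 2 := by
        rw [← Finset.sum_mul, hs]
        ring
    _ ≤ (δ * ‖s‖) ^ 2 := by
        rw [mul_pow δ]
        exact mul_le_mul_of_nonneg_right (pow_le_pow_left₀ (mul_nonneg hT0 hη) hδ 2) (sq_nonneg _)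

theorem norm_evolutionPhase (hc : (circulantMatrix c).IsHermitian) (t : ℝ) (k : Fin (2 ^ L)) :
    ‖evolutionPhase t c k‖ = 1 := by
  obtain ⟨r, hr⟩ := Complex.conj_eq_iff_real.mp (conj_dftCoeff hc k)
  have h : evolutionPhase t c k =
      Complex.exp ((-(t * (Real.sqrt (2 ^ L) * r)) : ℝ) * Complex.I) := by
    rw [evolutionPhase, hr]
    congr 1
    push_cast
    ring
  rw [h, Complex.norm_exp_ofReal_mul_I]

theorem exp_circulantMatrix_mem_unitaryGroup (hc : (circulantMatrix c).IsHermitian) (t : ℝ) :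
    NormedSpace.exp ((-(Complex.I * (t : ℂ))) • circulantMatrix c) ∈
      Matrix.unitaryGroup (Fin (2 ^ L)) ℂ := by
  rw [exp_circulantMatrix]
  refine mul_mem (mul_mem (fourierMatrix_mem_unitaryGroup L) ?_)
    (conjTranspose_mem_unitaryGroup (fourierMatrix_mem_unitaryGroup L))
  rw [Matrix.mem_unitaryGroup_iff, Matrix.star_eq_conjTranspose, Matrix.diagonal_conjTranspose,
    Matrix.diagonal_mul_diagonal, ← Matrix.diagonal_one]
  congr 1
  funext k
  simp [Complex.mul_conj, Complex.normSq_eq_norm_sq, norm_evolutionPhase hc]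

/-- Any unitary is within distance two of the evolution operator. -/
theorem performsWithin_of_two_le {U : Matrix (Fin L ⊕ Fin a → Fin 2) (Fin L ⊕ Fin a → Fin 2) ℂ}
    (hU : U ∈ Matrix.unitaryGroup (Fin L ⊕ Fin a → Fin 2) ℂ)
    (hc : (circulantMatrix c).IsHermitian) (t : ℝ) {δ : ℝ} (hδ : 2 ≤ δ) :
    PerformsWithin U (NormedSpace.exp ((-(Complex.I * (t : ℂ))) • circulantMatrix c)) δ := by
  intro s
  have h1 : ‖Matrix.toEuclideanLin U (withAncillas a s)‖ = ‖s‖ :=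
    (norm_toLp_mulVec hU _).trans (norm_withAncillas s)
  have h2 : ‖withAncillas a (NormedSpace.exp ((-(Complex.I * (t : ℂ))) • circulantMatrix c) *ᵥ
      s.ofLp)‖ = ‖s‖ :=
    (norm_withAncillas (WithLp.toLp 2 _)).trans
      (norm_toLp_mulVec (exp_circulantMatrix_mem_unitaryGroup hc t) _)
  refine (norm_sub_le _ _).trans ?_
  rw [h1, h2, ← two_mul]
  gcongr

/-- For short times, the evolution operator is close to the identity. -/
theorem performsWithin_one (hc : (circulantMatrix c).IsHermitian) (hnorm : ‖c‖ = 1) {t δ : ℝ}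
    (ht : 0 ≤ t) (hδ : Real.sqrt (2 ^ L) * t ≤ δ) :
    PerformsWithin (1 : Matrix (Fin L ⊕ Fin a → Fin 2) (Fin L ⊕ Fin a → Fin 2) ℂ)
      (NormedSpace.exp ((-(Complex.I * (t : ℂ))) • circulantMatrix c)) δ := by
  intro s
  set F := fourierMatrix (2 ^ L) with hF
  set V := NormedSpace.exp ((-(Complex.I * (t : ℂ))) • circulantMatrix c) with hV
  have h1 : Matrix.toEuclideanLin (1 : Matrix (Fin L ⊕ Fin a → Fin 2) (Fin L ⊕ Fin a → Fin 2) ℂ)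
      (withAncillas a s.ofLp) - withAncillas a (V *ᵥ s.ofLp) =
      withAncillas a (s.ofLp - V *ᵥ s.ofLp) := by
    rw [withAncillas_sub, Matrix.toLpLin_one]
    rfl
  have h2 : s.ofLp - V *ᵥ s.ofLp =
      F *ᵥ (Matrix.diagonal (fun k => 1 - evolutionPhase t c k) *ᵥ (Fᴴ *ᵥ s.ofLp)) := by
    have hdiag : Matrix.diagonal (fun k => 1 - evolutionPhase t c k) =
        1 - Matrix.diagonal (evolutionPhase t c) := by
      rw [← Matrix.diagonal_one, Matrix.diagonal_sub]
    rw [hdiag, Matrix.mulVec_mulVec, Matrix.mulVec_mulVec, mul_sub, mul_one, sub_mul,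
      fourierMatrix_mul_conjTranspose, Matrix.sub_mulVec, Matrix.one_mulVec, hV,
      exp_circulantMatrix]
  -- The identity corresponds to the estimate `v = 0`, whose error is `|F_k| ≤ 1`.
  have h3 (k : Fin (2 ^ L)) : ‖1 - evolutionPhase t c k‖ ≤ δ := by
    have h := norm_exp_sub_evolutionPhase_le hc ht 0 k
    simp only [mul_zero, Complex.ofReal_zero, neg_zero, Complex.exp_zero, zero_sub, norm_neg] at h
    refine h.trans ((mul_le_of_le_one_right (by positivity) (norm_dftCoeff_le_one hnorm k)).trans hδ)
  have hδ0 : 0 ≤ δ := (by positivity : 0 ≤ Real.sqrt (2 ^ L) * t).trans hδ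
  rw [h1, h2]
  refine (norm_withAncillas (WithLp.toLp 2 (F *ᵥ (Matrix.diagonal
    (fun k => 1 - evolutionPhase t c k) *ᵥ (Fᴴ *ᵥ s.ofLp))))).trans_le ?_
  have hs : ‖s‖ = ‖WithLp.toLp 2 (Fᴴ *ᵥ s.ofLp)‖ := (norm_toLp_mulVec
    (conjTranspose_mem_unitaryGroup (fourierMatrix_mem_unitaryGroup L)) s.ofLp).symm
  rw [norm_toLp_mulVec (fourierMatrix_mem_unitaryGroup L), hs, EuclideanSpace.norm_eq]
  refine Real.sqrt_le_iff.mpr ⟨mul_nonneg hδ0 (norm_nonneg _), ?_⟩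
  rw [mul_pow, EuclideanSpace.norm_sq_eq, Finset.mul_sum]
  refine Finset.sum_le_sum fun k _ => ?_
  rw [← mul_pow]
  refine pow_le_pow_left₀ (norm_nonneg _) ?_ 2
  change ‖(Matrix.diagonal _ *ᵥ _) k‖ ≤ _
  rw [Matrix.mulVec_diagonal, norm_mul]
  exact mul_le_mul_of_nonneg_right (h3 k) (norm_nonneg _)

end Simulation

/-! ### Counting gates -/

theorem sq_le_two_pow_succ (m : ℕ) : m ^ 2 ≤ 2 ^ (m + 1) := by
  have h (m : ℕ) : 2 * m + 1 ≤ 2 ^ (m + 1) := by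
    induction m with
    | zero => simp
    | succ m ih =>
      rw [pow_succ]
      omega
  induction m with
  | zero => simp
  | succ m ih =>
    have := h m
    rw [pow_succ 2 (m + 1)]
    linarith [(by ring : (m + 1) ^ 2 = m ^ 2 + (2 * m + 1))]

/-- Each term is bounded by a multiple of `2^m L²`, with `m² ≤ 2 · 2^m` and `m ≤ 2^m`; the
coefficients add up to `462`. -/
theorem simulation_gateCount_le {L m : ℕ} (hL : 1 ≤ L) :
    2 * (L ^ 2 + 21 * L) + 2 * (2 * (m ^ 2 + 21 * m) + (L ^ 2 + L + 3) +
      2 ^ m * (2 * L ^ 2 + 30 * L + 48) + 7 * (1 + 4 * 2 ^ m + 3 * 2 ^ (m + 1))) + (m + 1) ≤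
      500 * (2 ^ m * L ^ 2) := by
  have h1 := sq_le_two_pow_succ m
  rw [pow_succ 2 m] at h1 ⊢
  have h2 : m < 2 ^ m := Nat.lt_two_pow_self
  have h3 : 1 ≤ 2 ^ m := Nat.one_le_two_pow
  generalize 2 ^ m = B at *
  have h4 : L ≤ L ^ 2 := Nat.le_self_pow two_ne_zero L
  have h5 : L ^ 2 ≤ B * L ^ 2 := Nat.le_mul_of_pos_left _ h3
  have h6 : B * L ≤ B * L ^ 2 := Nat.mul_le_mul_left B h4
  have h7 : B ≤ B * L := Nat.le_mul_of_pos_right _ hL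
  linarith

theorem rpow_three_halves {δ : ℝ} (hδ : 0 < δ) : δ ^ (3 / 2 : ℝ) = δ * Real.sqrt δ := by
  rw [Real.sqrt_eq_rpow, ← Real.rpow_one_add' hδ.le (by norm_num)]
  norm_num

theorem exists_two_pow_between {x : ℝ} (hx : 1 ≤ x) :
    ∃ m : ℕ, m ≠ 0 ∧ x ≤ 2 ^ m ∧ (2 : ℝ) ^ m ≤ 2 * x := by
  obtain ⟨n, h1, h2⟩ := exists_nat_pow_near hx one_lt_two
  refine ⟨n + 1, n.succ_ne_zero, h2.le, ?_⟩
  rw [pow_succ]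
  linarith

/-- The logarithm is natural, and `log 2 ≥ 1/2`. -/
theorem half_le_log_two_pow_sq (L : ℕ) : (L : ℝ) ^ 2 ≤ 4 * Real.log (2 ^ L) ^ 2 := by
  rw [Real.log_pow, mul_pow]
  nlinarith [Real.log_two_gt_d9, sq_nonneg (L : ℝ), sq_nonneg (Real.log 2 - 1 / 2)]

/-! ### Choice of the precision and the degenerate cases -/

theorem theorem2 :
    ∃ K : ℝ, 0 < K ∧ ∀ (L : ℕ) (t δ : ℝ), 1 ≤ L → 0 ≤ t → 0 < δ →
      ∃ (a : ℕ) (W : Circuit L (Fin L ⊕ Fin a)),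
        (W.gateCount : ℝ) ≤
          K * (Real.sqrt (2 ^ L) * t * Real.log (2 ^ L) ^ 2 / δ ^ (3 / 2 : ℝ)) ∧
        (W.callCount : ℝ) ≤ K * (Real.sqrt (2 ^ L) * t / δ ^ (3 / 2 : ℝ)) ∧
        (∀ (c : EuclideanSpace ℂ (Fin (2 ^ L))) (O : Matrix (Fin (2 ^ L)) (Fin (2 ^ L)) ℂ),
          ‖c‖ = 1 → (circulantMatrix c).IsHermitian → IsOracleFor O c →
            PerformsWithin (W.eval O)
              (NormedSpace.exp ((-(Complex.I * (t : ℂ))) • circulantMatrix c)) δ) ∧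
        (δ ^ (3 / 2 : ℝ) ≤ Real.sqrt (2 ^ L) * t →
          IsQFTCSimulation W t (Real.sqrt δ / (Real.sqrt (2 ^ L) * t)) δ) := by
  -- The constant is `500 · 32 · 4`: at most `500 · 2^m L²` gates, `2^m ≤ 32 T/D`, and `L² ≤ 4 (log
  -- N)²`.
  refine ⟨64000, by norm_num, fun L t δ hL ht hδ => ?_⟩
  set T := Real.sqrt (2 ^ L) * t with hT
  set D := δ ^ (3 / 2 : ℝ) with hD
  have hT0 : 0 ≤ T := by positivity
  have hD0 : 0 < D := by positivity
  have hDδ : D = δ * Real.sqrt δ := rpow_three_halves hδ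
  have hlog := half_le_log_two_pow_sq L
  have hL2 : (1 : ℝ) ≤ L ^ 2 := one_le_pow₀ (by exact_mod_cast hL)
  have hrw : T * Real.log (2 ^ L) ^ 2 / D = T / D * Real.log (2 ^ L) ^ 2 := by ring
  rw [hrw]
  have hgates {n B : ℕ} (hn : n ≤ 500 * (B * L ^ 2)) (hB : (B : ℝ) ≤ 32 * (T / D)) :
      (n : ℝ) ≤ 64000 * (T / D * Real.log (2 ^ L) ^ 2) := by
    have hn' : (n : ℝ) ≤ 500 * (B * L ^ 2) := by exact_mod_cast hn
    have h1 : (B : ℝ) * L ^ 2 ≤ 32 * (T / D) * (4 * Real.log (2 ^ L) ^ 2) := by gcongr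
    linarith
  -- When `T < D` no simulation form is required, and the empty circuit works if the evolution is
  -- within `T ≤ δ` of the identity or if `δ ≥ 2` makes every unitary acceptable.
  by_cases hempty : T < D ∧ (T ≤ δ ∨ 2 ≤ δ)
  · refine ⟨0, [], ?_, ?_, fun c O hnorm hc hOc => ?_, fun h => absurd h (not_le.mpr hempty.1)⟩
    · simp only [Circuit.gateCount, List.countP_nil, Nat.cast_zero]
      positivity
    · simp only [Circuit.callCount, List.countP_nil, Nat.cast_zero]
      positivity
    · rcases hempty.2 with h | h
      · exact performsWithin_one hc hnorm ht h
      · exact performsWithin_of_two_le (one_mem _) hc t h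
  -- For `δ ≥ 2` and `T ≥ D` the prescribed form is still required, but an empty `Q` with a single
  -- digit suffices: the demanded probability `1 - δ` is negative.
  by_cases hδ2 : 2 ≤ δ
  · have hDT : D ≤ T := not_lt.mp fun h => hempty ⟨h, .inr hδ2⟩
    have hX : 1 ≤ T / D := (one_le_div hD0).mpr hDT
    have hgate := gateCount_simulationCircuit_le (L := L) (Function.Embedding.refl (Fin (0 + 1))) t []
    refine ⟨1, simulationCircuit (Function.Embedding.refl (Fin (0 + 1))) t [], ?_, ?_,
      fun c O hnorm hc hOc => performsWithin_of_two_le (Circuit.eval_mem_unitaryGroup hOc.1 _) hc t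
        hδ2, fun _ => ⟨0, .refl _, Circuit.mapWires .inl (fourierCircuit L L), [], rfl,
          fun O _ => eval_mapWires_fourierCircuit O, fun c O hnorm hc hOc k => ⟨fun x hx => ?_, ?_⟩⟩⟩
    · refine hgates (B := 1) (hgate.trans ?_) (by push_cast; linarith)
      have hnil : Circuit.gateCount ([] : Circuit L (Fin L ⊕ Fin 1)) = 0 := rfl
      rw [hnil]
      nlinarith
    · rw [callCount_simulationCircuit]
      simp only [Circuit.callCount, List.countP_nil, mul_zero, Nat.cast_zero]
      positivity
    · have h := withAncillas_mulVec_single (a := 1) (Circuit.eval O []) k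
      rw [Circuit.eval, Matrix.one_mulVec] at h
      have hx' : x = Sum.elim ((toNumber L).symm k) 0 := by
        by_contra hne
        exact hx ((congrFun h x).trans (Pi.single_eq_of_ne hne _))
      rw [hx', Sum.elim_comp_inl, Equiv.apply_symm_apply]
    · refine le_trans (by linarith) (Finset.sum_nonneg fun x _ => ?_)
      exact Set.indicator_nonneg (fun _ _ => sq_nonneg _) x
  rw [not_le] at hδ2
  have hsqrt : Real.sqrt δ ≤ 2 := Real.sqrt_le_iff.mpr ⟨zero_le_two, by linarith⟩
  have hsqrt0 : 0 < Real.sqrt δ := Real.sqrt_pos.mpr hδ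
  -- From here on `δ < 2`, so `√δ ≤ 2`. If `T < D`, the first case leaves only `T > δ`, and then `D
  -- = δ√δ ≤ 2δ < 2T`. So `T/D` is bounded below, and additive constants in the costs can be
  -- absorbed.
  have hDT : D ≤ 2 * T := by
    by_cases h : T < D
    · have hTδ : δ < T := not_le.mp fun h' => hempty ⟨h, .inl h'⟩
      rw [hDδ]
      nlinarith
    · linarith
  have hTpos : 0 < T := by linarith
  have hX : 1 / 2 ≤ T / D := by
    rw [le_div_iff₀ hD0]
    linarith
  -- `T/δ = √δ · T/D`; here the stated power `δ^{3/2}` gives away a factor.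
  have hTδ : T / δ ≤ 2 * (T / D) := by
    rw [hDδ, ← mul_div_assoc, div_le_div_iff₀ hδ (by positivity)]
    nlinarith [mul_pos hTpos hδ]
  -- The smallest scale with `7/2^m ≤ δ/T`, up to a factor two; the maximum with `1` permits a
  -- positive `m` even for small `T/δ`.
  obtain ⟨m, hm0, hm1, hm2⟩ := exists_two_pow_between (le_max_left 1 (7 * (T / δ)))
  have hm3 : (2 : ℝ) ^ m ≤ 32 * (T / D) := by
    refine hm2.trans ?_
    rcases max_cases 1 (7 * (T / δ)) with ⟨h, -⟩ | ⟨h, -⟩ <;> rw [h] <;> linarith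
  have hη : 7 / 2 ^ m ≤ δ / T := by
    have h7 : 7 * (T / δ) ≤ 2 ^ m := (le_max_right _ _).trans hm1
    rw [div_le_div_iff₀ (by positivity) hTpos]
    rw [← mul_div_assoc, div_le_iff₀ hδ] at h7
    linarith
  have : NeZero m := ⟨hm0⟩
  obtain ⟨a, dig, Q, hgate, hcall, hQ⟩ := exists_transformsWithin L m
  refine ⟨a, simulationCircuit dig t Q, ?_, ?_, fun c O hnorm hc hOc => ?_, fun _ =>
    ⟨m, dig, Circuit.mapWires .inl (fourierCircuit L L), Q, rfl,
      fun O _ => eval_mapWires_fourierCircuit O, fun c O hnorm hc hOc => ?_⟩⟩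
  · refine hgates (B := 2 ^ m) ?_ (by exact_mod_cast hm3)
    refine (gateCount_simulationCircuit_le dig t Q).trans (le_trans ?_ (simulation_gateCount_le hL))
    gcongr
  · have h1 : (1 : ℝ) ≤ 2 ^ m := one_le_pow₀ one_le_two
    have h2 : ((simulationCircuit dig t Q).callCount : ℝ) ≤ 2 * (1 + 2 ^ m * 2) := by
      rw [callCount_simulationCircuit]
      exact_mod_cast Nat.mul_le_mul_left 2 hcall
    linarith
  · refine (hQ c O hc hOc).performsWithin ht hOc.1 hc (by positivity) ?_
    rw [le_div_iff₀ hTpos] at hη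
    linarith
  -- With `ε = √δ/T`, the condition `η² ≤ δ ε²` reads `η ≤ δ/T`, the same one as for the simulation
  -- error.
  · refine (hQ c O hc hOc).isQFTC (Circuit.eval_mem_unitaryGroup hOc.1 _) (by positivity) ?_
    rw [div_pow (Real.sqrt δ), Real.sq_sqrt hδ.le]
    refine (pow_le_pow_left₀ (by positivity) hη 2).trans_eq ?_
    ring
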